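/- **Setting.** Let $a<b$, $\Omega=(a,b)$, $T>0$, $0<\varepsilon<1$, and let $u^\varepsilon=u^\varepsilon(x,t)$ be a solution, on $[a,b]\times[0,T]$, of $$i\partial_t u^\varepsilon+\partial_{xx}u^\varepsilon=u^\varepsilon\ln\big((\varepsilon+|u^\varepsilon|)^2\big),\qquad u^\varepsilon(\cdot,0)=u_0,\qquad u^\varepsilon(a,t)=u^\varepsilon(b,t)=0 .$$ For an integer $M\ge 1$ and $\tau>0$ put $h=(b-a)/M$, $x_j=a+jh$, $t_k=k\tau$. The semi-implicit finite difference solution $u^{\varepsilon,k}_j$ ($0\le j\le M$, $k\ge 0$) is given by $u^{\varepsilon,k}_0=u^{\varepsilon,k}_M=0$, $u^{\varepsilon,0}_j=u_0(x_j)$, $u^{\varepsilon,1}_j=u^{\varepsilon,0}_j+i\tau\big[u_0''(x_j)-u_0(x_j)\ln((\varepsilon+|u_0(x_j)|)^2)\big]$ for $0\le j\le M$, and, for $k\ge1$, $1\le j\le M-1$, $$i\,\frac{u_j^{\varepsilon,k+1}-u_j^{\varepsilon,k-1}}{2\tau}=-\tfrac12\,\delta_x^2\big(u_j^{\varepsilon,k+1}+u_j^{\varepsilon,k-1}\big)+u_j^{\varepsilon,k}\ln\big((\varepsilon+|u_j^{\varepsilon,k}|)^2\big),\qquad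 \delta_x^2v_j=\frac{v_{j+1}-2v_j+v_{j-1}}{h^2}.$$ Let $e^{\varepsilon,k}_j=u^\varepsilon(x_j,t_k)-u^{\varepsilon,k}_j$ and, for grid vectors vanishing at $j=0,M$, $$\|v\|^2=h\sum_{j=1}^{M-1}|v_j|^2,\quad |v|_{H^1}^2=h\sum_{j=0}^{M-1}\Big|\frac{v_{j+1}-v_j}{h}\Big|^2,\quad \|v\|_{H^1}^2=\|v\|^2+|v|_{H^1}^2,\quad \|v\|_\infty=\max_{0\le j\le M}|v_j|.$$ **Theorem 3.1 (Main result).** Let $C_0>0$ and $0<\varepsilon_0<1$. There are constants $C,c,K>0$ depending only on $C_0$ and $\varepsilon_0$ such that the following holds for all $a<b$, $T>0$, $u_0$ and all $0<\varepsilon\le\varepsilon_0$. Assume that $$u^\varepsilon\in C([0,T];H^5(\Omega))\cap C^2([0,T];H^4(\Omega))\cap C^3([0,T];H^2(\Omega)),$$ $$\|u^\varepsilon\|_{L^\infty(0,T;H^5(\Omega))}+\|\partial_t^2u^\varepsilon\|_{L^\infty(0,T;H^4(\Omega))}+\|\partial_t^3u^\varepsilon\|_{L^\infty(0,T;H^2(\Omega))}\le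 C_0 .$$ Put $$h_0=\tau_0=c\sqrt\varepsilon\,e^{-CT|\ln\varepsilon|^2},\qquad C_1(\varepsilon,T)=K\,e^{CT|\ln\varepsilon|^2},\qquad C_2(\varepsilon,T)=\frac{K}{\varepsilon}\,e^{CT|\ln\varepsilon|^2},\qquad \Lambda=\|u^\varepsilon\|_{L^\infty(\Omega\times(0,T))}.$$ If $0<h\le h_0$, $0<\tau\le\tau_0$ and the stability condition $$\tau\le\frac{1}{2\max\{|\ln\varepsilon|,\ \ln(\varepsilon+\max_j|u^{\varepsilon,k}_j|)\}}\qquad\text{for all } 0\le k\le T/\tau$$ holds, then for all $0\le k\le T/\tau$ $$\|e^{\varepsilon,k}\|\le C_1(\varepsilon,T)(h^2+\tau^2),\qquad \|e^{\varepsilon,k}\|_{H^1}\le C_2(\varepsilon,T)(h^2+\tau^2),\qquad \|u^{\varepsilon,k}\|_\infty\le\Lambda+1 .$$ In particular, for a family $(u^\varepsilon)_{0<\varepsilon\le\varepsilon_0}$ satisfying the bound uniformly in $\varepsilon$, the constants do not depend on $\varepsilon$. -/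

import Mathlib

open MeasureTheory Set
open scoped ContDiff ENNReal

namespace RLogSE

/-! ### Sobolev spaces on a bounded interval -/

/-- `φ` is a (real-valued) test function on the open interval `(a, b)`. -/
def IsTestFunction (a b : ℝ) (φ : ℝ → ℝ) : Prop :=
  ContDiff ℝ ∞ φ ∧ HasCompactSupport φ ∧ tsupport φ ⊆ Ioo a b

/-- `g` is the weak derivative of order `k` of `f` on `(a, b)`. -/
def IsWeakDeriv (a b : ℝ) (k : ℕ) (f g : ℝ → ℂ) : Prop :=
  ∀ φ : ℝ → ℝ, IsTestFunction a b φ →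
    ∫ x in Ioo a b, iteratedDeriv k φ x • f x = (-1 : ℝ) ^ k • ∫ x in Ioo a b, φ x • g x

/-- The tuples `(v₀, …, v_m)` of functions in `L²((a,b); ℂ)`, with the Hilbert norm
`(∑ₖ ‖vₖ‖²)^{1/2}`. -/
abbrev L2Tuple (a b : ℝ) (m : ℕ) : Type :=
  PiLp 2 (fun _ : Fin (m + 1) => Lp ℂ 2 (volume.restrict (Ioo a b)))

/-- A test function or one of its derivatives times an `L²` function is integrable. -/
theorem IsTestFunction.integrable_smul {a b : ℝ} {φ : ℝ → ℝ} (hφ : IsTestFunction a b φ) (k : ℕ)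
    (f : Lp ℂ 2 (volume.restrict (Ioo a b))) :
    Integrable (fun x => iteratedDeriv k φ x • f x) (volume.restrict (Ioo a b)) := by
  have hc : Continuous (iteratedDeriv k φ) :=
    hφ.1.continuous_iteratedDeriv k (by exact_mod_cast le_top)
  have hs : HasCompactSupport (iteratedDeriv k φ) := by
    induction k with
    | zero => simpa using hφ.2.1
    | succ n ih =>
      rw [iteratedDeriv_succ]
      exact (ih (hφ.1.continuous_iteratedDeriv n (by exact_mod_cast le_top))).deriv
  obtain ⟨C, hC⟩ := hs.exists_bound_of_continuous hc
  have hf : Integrable (f : ℝ → ℂ) (volume.restrict (Ioo a b)) :=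
    (Lp.memLp f).integrable (by norm_num)
  exact hf.bdd_smul C hc.aestronglyMeasurable (Filter.Eventually.of_forall hC)

/-- The Sobolev space `H^m(a, b)` of complex-valued functions. A function is recorded together
with its weak derivatives of order `1, …, m`, so that the norm inherited from `L2Tuple` is the
usual `H^m` norm `(∑_{k ≤ m} ‖∂ₓᵏ f‖²_{L²})^{1/2}`. -/
def Sobolev (a b : ℝ) (m : ℕ) : Submodule ℝ (L2Tuple a b m) where
  carrier := {v | ∀ k : Fin (m + 1), IsWeakDeriv a b k (v 0) (v k)}
  zero_mem' := by
    intro k φ hφ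
    have hz : ((0 : Lp ℂ 2 (volume.restrict (Ioo a b))) : ℝ → ℂ) =ᵐ[volume.restrict (Ioo a b)]
      fun _ => 0 := Lp.coeFn_zero ..
    have e1 : ∫ x in Ioo a b, iteratedDeriv k φ x • (0 : L2Tuple a b m) 0 x = 0 :=
      integral_eq_zero_of_ae (hz.mono fun x hx => by
        simp only [PiLp.zero_apply, hx, smul_zero, Pi.zero_apply])
    have e2 : ∫ x in Ioo a b, φ x • (0 : L2Tuple a b m) k x = 0 :=
      integral_eq_zero_of_ae (hz.mono fun x hx => by
        simp only [PiLp.zero_apply, hx, smul_zero, Pi.zero_apply])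
    rw [e1, e2, smul_zero]
  add_mem' := by
    intro v w hv hw k φ hφ
    have h0 := Lp.coeFn_add (v 0) (w 0)
    have hk := Lp.coeFn_add (v k) (w k)
    have e0 : ∫ x in Ioo a b, iteratedDeriv k φ x • (v + w) 0 x =
        (∫ x in Ioo a b, iteratedDeriv k φ x • v 0 x) +
          ∫ x in Ioo a b, iteratedDeriv k φ x • w 0 x := by
      rw [← integral_add (hφ.integrable_smul k (v 0)) (hφ.integrable_smul k (w 0))]
      exact integral_congr_ae (h0.mono fun x hx => by
        rw [PiLp.add_apply]; simp only [hx, Pi.add_apply, smul_add])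
    have ek : ∫ x in Ioo a b, φ x • (v + w) k x =
        (∫ x in Ioo a b, φ x • v k x) + ∫ x in Ioo a b, φ x • w k x := by
      have i1 := hφ.integrable_smul 0 (v k)
      have i2 := hφ.integrable_smul 0 (w k)
      simp only [iteratedDeriv_zero] at i1 i2
      rw [← integral_add i1 i2]
      exact integral_congr_ae (hk.mono fun x hx => by
        rw [PiLp.add_apply]; simp only [hx, Pi.add_apply, smul_add])
    rw [e0, ek, hv k φ hφ, hw k φ hφ, smul_add]
  smul_mem' := by
    intro c v hv k φ hφ
    have h0 := Lp.coeFn_smul c (v 0)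
    have hk := Lp.coeFn_smul c (v k)
    have e0 : ∫ x in Ioo a b, iteratedDeriv k φ x • (c • v) 0 x =
        c • ∫ x in Ioo a b, iteratedDeriv k φ x • v 0 x := by
      rw [← integral_smul]
      exact integral_congr_ae (h0.mono fun x hx => by
        rw [PiLp.smul_apply]; simp only [hx, Pi.smul_apply]; rw [smul_comm])
    have ek : ∫ x in Ioo a b, φ x • (c • v) k x = c • ∫ x in Ioo a b, φ x • v k x := by
      rw [← integral_smul]
      exact integral_congr_ae (hk.mono fun x hx => by
        rw [PiLp.smul_apply]; simp only [hx, Pi.smul_apply]; rw [smul_comm])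
    rw [e0, ek, hv k φ hφ, smul_comm]

/-- The curve `U : [0, T] → H^m(a, b)` is the function `u = u(x, t)`, i.e. for every `t ∈ [0, T]`
the element `U t` is the class of `u(·, t)`. -/
def Represents (a b T : ℝ) {m : ℕ} (U : ℝ → Sobolev a b m) (u : ℝ → ℝ → ℂ) : Prop :=
  ∀ t ∈ Icc 0 T, ((U t : L2Tuple a b m) 0 : ℝ → ℂ) =ᵐ[volume.restrict (Ioo a b)] fun x => u x t

/-- The norm of `L^∞(0, T; H^m(a, b))`. -/
noncomputable def linftyNorm (a b T : ℝ) {m : ℕ} (U : ℝ → Sobolev a b m) : ℝ≥0∞ :=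
  eLpNorm U ∞ (volume.restrict (Ioo 0 T))

/-- `u ∈ C([0,T]; H⁵) ∩ C²([0,T]; H⁴) ∩ C³([0,T]; H²)` and
`‖u‖_{L^∞(0,T;H⁵)} + ‖∂ₜ²u‖_{L^∞(0,T;H⁴)} + ‖∂ₜ³u‖_{L^∞(0,T;H²)} ≤ C₀`. -/
def RegularWithBound (a b T C₀ : ℝ) (u : ℝ → ℝ → ℂ) : Prop :=
  ∃ (U5 : ℝ → Sobolev a b 5) (U4 : ℝ → Sobolev a b 4) (U2 : ℝ → Sobolev a b 2),
    Represents a b T U5 u ∧ Represents a b T U4 u ∧ Represents a b T U2 u ∧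
    ContinuousOn U5 (Icc 0 T) ∧ ContDiffOn ℝ 2 U4 (Icc 0 T) ∧ ContDiffOn ℝ 3 U2 (Icc 0 T) ∧
    linftyNorm a b T U5 + linftyNorm a b T (iteratedDerivWithin 2 U4 (Icc 0 T)) +
      linftyNorm a b T (iteratedDerivWithin 3 U2 (Icc 0 T)) ≤ ENNReal.ofReal C₀

/-! ### The regularized logarithmic Schrödinger equation -/

/-- The regularized logarithmic nonlinearity `z ln (ε + |z|)²`. -/
noncomputable def logNonlin (ε : ℝ) (z : ℂ) : ℂ := z * (Real.log ((ε + ‖z‖) ^ 2) : ℂ)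

/-- `u = u(x, t)` is a solution on `[a, b] × [0, T]` of `i ∂ₜu + ∂ₓₓu = u ln (ε + |u|)²` with
`u(·, 0) = u₀` and homogeneous Dirichlet boundary conditions. -/
structure IsSolution (a b T ε : ℝ) (u₀ : ℝ → ℂ) (u : ℝ → ℝ → ℂ) : Prop where
  continuousOn : ContinuousOn (fun p : ℝ × ℝ => u p.1 p.2) (Icc a b ×ˢ Icc 0 T)
  differentiableAt_time : ∀ x ∈ Ioo a b, ∀ t ∈ Ioo 0 T, DifferentiableAt ℝ (fun s => u x s) t
  contDiffOn_space : ∀ t ∈ Ioo 0 T, ContDiffOn ℝ 2 (fun y => u y t) (Ioo a b)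
  equation : ∀ x ∈ Ioo a b, ∀ t ∈ Ioo 0 T,
    Complex.I * deriv (fun s => u x s) t + iteratedDeriv 2 (fun y => u y t) x =
      logNonlin ε (u x t)
  initial : ∀ x ∈ Icc a b, u x 0 = u₀ x
  boundary : ∀ t ∈ Icc 0 T, u a t = 0 ∧ u b t = 0

/-- `Λ = ‖u‖_{L^∞((a,b) × (0,T))}`. -/
noncomputable def spaceTimeSup (a b T : ℝ) (u : ℝ → ℝ → ℂ) : ℝ :=
  (eLpNorm (fun p : ℝ × ℝ => u p.1 p.2) ∞ (volume.restrict (Ioo a b ×ˢ Ioo 0 T))).toReal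

/-! ### Grid functions

A vector `(v₀, …, v_M)` is given as a function `v : ℕ → ℂ`, of which only the values at
`0, …, M` are ever used. -/

/-- The mesh size `h = (b - a) / M`. -/
noncomputable def mesh (a b : ℝ) (M : ℕ) : ℝ := (b - a) / M

/-- The grid point `x_j = a + j h`. -/
noncomputable def gridPt (a b : ℝ) (M j : ℕ) : ℝ := a + j * mesh a b M

/-- The forward difference `δₓ⁺ v_j = (v_{j+1} - v_j) / h`. -/
noncomputable def dxPlus (h : ℝ) (v : ℕ → ℂ) (j : ℕ) : ℂ := (v (j + 1) - v j) / (h : ℂ)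

/-- The second difference `δₓ² v_j = (v_{j+1} - 2 v_j + v_{j-1}) / h²`, used for `j ≥ 1`. -/
noncomputable def dxx (h : ℝ) (v : ℕ → ℂ) (j : ℕ) : ℂ :=
  (v (j + 1) - 2 * v j + v (j - 1)) / (h : ℂ) ^ 2

/-- The centred difference in time `δₜᶜ u_j^k = (u_j^{k+1} - u_j^{k-1}) / (2 τ)`, used for
`k ≥ 1`. -/
noncomputable def dtc (τ : ℝ) (U : ℕ → ℕ → ℂ) (k j : ℕ) : ℂ :=
  (U (k + 1) j - U (k - 1) j) / (2 * (τ : ℂ))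

/-- The discrete `L²` norm `‖v‖ = (h ∑_{j=1}^{M-1} |v_j|²)^{1/2}`. -/
noncomputable def gridL2 (h : ℝ) (M : ℕ) (v : ℕ → ℂ) : ℝ :=
  √(h * ∑ j ∈ Finset.Icc 1 (M - 1), ‖v j‖ ^ 2)

/-- The discrete `H¹` seminorm `|v|_{H¹} = (h ∑_{j=0}^{M-1} |δₓ⁺ v_j|²)^{1/2}`. -/
noncomputable def gridH1Semi (h : ℝ) (M : ℕ) (v : ℕ → ℂ) : ℝ :=
  √(h * ∑ j ∈ Finset.range M, ‖dxPlus h v j‖ ^ 2)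

/-- The discrete `H¹` norm `(‖v‖² + |v|_{H¹}²)^{1/2}`. -/
noncomputable def gridH1 (h : ℝ) (M : ℕ) (v : ℕ → ℂ) : ℝ :=
  √(gridL2 h M v ^ 2 + gridH1Semi h M v ^ 2)

/-- The discrete sup norm `max_{0 ≤ j ≤ M} |v_j|`. -/
noncomputable def gridSup (M : ℕ) (v : ℕ → ℂ) : ℝ :=
  (Finset.range (M + 1)).sup' Finset.nonempty_range_add_one fun j => ‖v j‖

/-! ### The semi-implicit finite difference scheme -/

/-- `U k j = u_j^k` is the solution of the semi-implicit finite difference scheme on `[a, b]` with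
`M` cells and time step `τ`. The second derivative of `u₀` in the first step is the one on the
closed interval (one-sided at the end points). -/
structure IsSIFD (a b τ ε : ℝ) (M : ℕ) (u₀ : ℝ → ℂ) (U : ℕ → ℕ → ℂ) : Prop where
  boundary : ∀ k, U k 0 = 0 ∧ U k M = 0
  initial : ∀ j ≤ M, U 0 j = u₀ (gridPt a b M j)
  first_step : ∀ j ≤ M, U 1 j = U 0 j + (τ : ℂ) *
    (Complex.I * (iteratedDerivWithin 2 u₀ (Icc a b) (gridPt a b M j) -
      logNonlin ε (u₀ (gridPt a b M j))))
  step : ∀ k ≥ 1, ∀ j ∈ Finset.Icc 1 (M - 1),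
    Complex.I * dtc τ U k j =
      -(1 / 2) * dxx (mesh a b M) (fun i => U (k + 1) i + U (k - 1) i) j + logNonlin ε (U k j)

/-- The stability condition
`0 < τ ≤ 1 / (2 max {|ln ε|, ln (ε + max_j |u_j^k|)})` for all `0 ≤ k ≤ T / τ`. -/
def StabilityCondition (T τ ε : ℝ) (M : ℕ) (U : ℕ → ℕ → ℂ) : Prop :=
  0 < τ ∧ ∀ k : ℕ, (k : ℝ) ≤ T / τ →
    τ ≤ 1 / (2 * max |Real.log ε| (Real.log (ε + gridSup M (U k))))

/-- The error `e_j^k = u(x_j, t_k) - u_j^k`, where `t_k = k τ`. -/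
noncomputable def err (a b τ : ℝ) (M : ℕ) (u : ℝ → ℝ → ℂ) (U : ℕ → ℕ → ℂ) (k j : ℕ) : ℂ :=
  u (gridPt a b M j) (k * τ) - U k j

end RLogSE

/-!
The scheme is a leapfrog scheme whose linear part is averaged over the levels `k + 1` and `k - 1`,
so a perturbation `r` of it with source `χ` conserves mass and energy up to the source:
`‖r^{k+1}‖ ≤ ‖r^{k-1}‖ + 2 τ ‖χ^k‖` and, when `χ` vanishes at the end points, the same for the
discrete `H¹` seminorm (`gridL2_leapfrog_le`, `gridH1Semi_leapfrog_le`). The energy estimate thus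
needs a consistency error in `H¹₀`, and here the boundary is the difficulty: the truncation error
`(h² / 12) ∂ₓ⁴u` of the second difference need not vanish at the end points. But `∂ₓ²u` does, since
the equation expresses it by `∂ₜu` and `u` (`RegularCurves.U5_two_boundary`). Therefore the
numerical solution is compared with the corrected solution `u - (h² / 12) ∂ₓ²u`: the correction
removes the fourth derivative from the consistency error, the remainder involves only the fifth
derivative, and it is of order `h³` in `L²`. What an inverse inequality loses is then still of order
`h²` in `H¹` (`gridL2_corrected_second_diff_le`, `gridH1Semi_le_of_boundary`), and
`RegularCurves.exists_source` provides a source in `H¹₀` of order `h² + τ²` in both norms.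

The nonlinearity is Lipschitz on bounded sets with a constant of order `|ln ε|`, and its
differential is Lipschitz with constant `10 / ε` (`norm_logNonlin_sub_le`, `norm_logNonlinDeriv_sub_le`). As long
as the error is at most one in the sup norm, this gives recursions for the error in `L²` and in `H¹`
with growth rate `O(|ln ε|)`; in the second one the `L²` error enters with the factor `1 / ε`
(`RegularCurves.step_le`). The discrete inequality `‖e‖_∞² ≤ 2 ‖e‖ |e|_{H¹}` and the smallness of
`h` and `τ` recover the sup bound at the next level, which closes the induction in
`RegularCurves.error_bounds`. Finally, `|ln ε| ≤ |ln ε|² / |ln ε₀|` turns the growth rate into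
`C |ln ε|²`.

For the constants to depend on `C₀` and `ε₀` only, no estimate may involve `b - a` or `1 / T`. Point
values are bounded independently of the length of the interval because the functions in question
have a zero or mean value zero (`Sobolev.norm_value_le`); the factor `1 / T` in the bound for `∂ₜu`
in `H⁴`, obtained by interpolation between `u` and `∂ₜ²u`, is integrated over a time interval of
length `T`.
-/

namespace RLogSE

open scoped ComplexConjugate

/-! ### Weighted discrete `L²` norms -/

/-- The weighted norm `(h ∑_{j ∈ s} |v_j|²)^{1/2}`. Both `gridL2` (with `v` itself) and `gridH1Semi`
(with the forward differences of `v`) are instances of it. -/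
noncomputable def l2Norm (h : ℝ) (s : Finset ℕ) (v : ℕ → ℂ) : ℝ :=
  √(h * ∑ j ∈ s, ‖v j‖ ^ 2)

theorem gridL2_eq (h : ℝ) (M : ℕ) (v : ℕ → ℂ) :
    gridL2 h M v = l2Norm h (Finset.Icc 1 (M - 1)) v := rfl

theorem gridH1Semi_eq (h : ℝ) (M : ℕ) (v : ℕ → ℂ) :
    gridH1Semi h M v = l2Norm h (Finset.range M) (dxPlus h v) := rfl

theorem l2Norm_nonneg (h : ℝ) (s : Finset ℕ) (v : ℕ → ℂ) : 0 ≤ l2Norm h s v := Real.sqrt_nonneg _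

theorem l2Norm_sq {h : ℝ} (hh : 0 ≤ h) (s : Finset ℕ) (v : ℕ → ℂ) :
    l2Norm h s v ^ 2 = h * ∑ j ∈ s, ‖v j‖ ^ 2 :=
  Real.sq_sqrt (mul_nonneg hh (Finset.sum_nonneg fun _ _ => by positivity))

theorem l2Norm_mono {h : ℝ} (hh : 0 ≤ h) {s : Finset ℕ} {v w : ℕ → ℂ}
    (H : ∀ j ∈ s, ‖v j‖ ≤ ‖w j‖) : l2Norm h s v ≤ l2Norm h s w := by
  refine Real.sqrt_le_sqrt (mul_le_mul_of_nonneg_left (Finset.sum_le_sum fun j hj => ?_) hh)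
  exact pow_le_pow_left₀ (norm_nonneg _) (H j hj) 2

theorem l2Norm_congr {h : ℝ} {s : Finset ℕ} {v w : ℕ → ℂ}
    (H : ∀ j ∈ s, v j = w j) : l2Norm h s v = l2Norm h s w := by
  unfold l2Norm
  rw [Finset.sum_congr rfl fun j hj => by rw [H j hj]]

theorem l2Norm_eq_norm {h : ℝ} (hh : 0 ≤ h) (s : Finset ℕ) (v : ℕ → ℂ) :
    l2Norm h s v = √h * ‖WithLp.toLp 2 (fun j : s => v j)‖ := by
  rw [EuclideanSpace.norm_eq, l2Norm, Real.sqrt_mul hh, ← Finset.sum_coe_sort]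

theorem l2Norm_add_le {h : ℝ} (hh : 0 ≤ h) (s : Finset ℕ) (v w : ℕ → ℂ) :
    l2Norm h s (fun j => v j + w j) ≤ l2Norm h s v + l2Norm h s w := by
  rw [l2Norm_eq_norm hh, l2Norm_eq_norm hh, l2Norm_eq_norm hh, ← mul_add]
  refine mul_le_mul_of_nonneg_left ?_ (Real.sqrt_nonneg _)
  exact norm_add_le (WithLp.toLp 2 (fun j : s => v j)) (WithLp.toLp 2 (fun j : s => w j))

theorem l2Norm_mul_left (h : ℝ) (s : Finset ℕ) (c : ℂ) (v : ℕ → ℂ) :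
    l2Norm h s (fun j => c * v j) = ‖c‖ * l2Norm h s v := by
  unfold l2Norm
  simp only [norm_mul, mul_pow, ← Finset.mul_sum]
  rw [show h * (‖c‖ ^ 2 * ∑ j ∈ s, ‖v j‖ ^ 2) = ‖c‖ ^ 2 * (h * ∑ j ∈ s, ‖v j‖ ^ 2) by ring,
    Real.sqrt_mul (by positivity), Real.sqrt_sq (norm_nonneg _)]

/-- The Cauchy–Schwarz inequality for the weighted discrete norms. -/
theorem norm_sum_mul_conj_le {h : ℝ} (hh : 0 ≤ h) (s : Finset ℕ) (v w : ℕ → ℂ) :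
    h * ‖∑ j ∈ s, v j * conj (w j)‖ ≤ l2Norm h s v * l2Norm h s w := by
  have h1 : ‖∑ j ∈ s, v j * conj (w j)‖ ≤ √(∑ j ∈ s, ‖v j‖ ^ 2) * √(∑ j ∈ s, ‖w j‖ ^ 2) := by
    refine (norm_sum_le _ _).trans ?_
    simp only [norm_mul, RCLike.norm_conj]
    exact Real.sum_mul_le_sqrt_mul_sqrt _ _ _
  unfold l2Norm
  rw [Real.sqrt_mul hh, Real.sqrt_mul hh]
  calc _ ≤ h * (√(∑ j ∈ s, ‖v j‖ ^ 2) * √(∑ j ∈ s, ‖w j‖ ^ 2)) :=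
        mul_le_mul_of_nonneg_left h1 hh
    _ = (√h * √h) * (√(∑ j ∈ s, ‖v j‖ ^ 2) * √(∑ j ∈ s, ‖w j‖ ^ 2)) := by
        rw [Real.mul_self_sqrt hh]
    _ = _ := by ring

theorem dxPlus_add (h : ℝ) (v w : ℕ → ℂ) (j : ℕ) :
    dxPlus h (fun i => v i + w i) j = dxPlus h v j + dxPlus h w j := by
  unfold dxPlus; ring

theorem dxPlus_mul_left (h : ℝ) (c : ℂ) (v : ℕ → ℂ) (j : ℕ) :
    dxPlus h (fun i => c * v i) j = c * dxPlus h v j := by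
  unfold dxPlus; ring

theorem gridL2_add_le {h : ℝ} (hh : 0 ≤ h) (M : ℕ) (v w : ℕ → ℂ) :
    gridL2 h M (fun j => v j + w j) ≤ gridL2 h M v + gridL2 h M w :=
  l2Norm_add_le hh _ v w

theorem gridL2_mul_left (h : ℝ) (M : ℕ) (c : ℂ) (v : ℕ → ℂ) :
    gridL2 h M (fun j => c * v j) = ‖c‖ * gridL2 h M v :=
  l2Norm_mul_left h _ c v

theorem gridH1Semi_add_le {h : ℝ} (hh : 0 ≤ h) (M : ℕ) (v w : ℕ → ℂ) :
    gridH1Semi h M (fun j => v j + w j) ≤ gridH1Semi h M v + gridH1Semi h M w := by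
  simp only [gridH1Semi_eq]
  rw [show dxPlus h (fun j => v j + w j) = fun j => dxPlus h v j + dxPlus h w j from
    funext (dxPlus_add h v w)]
  exact l2Norm_add_le hh _ _ _

theorem gridH1Semi_mul_left (h : ℝ) (M : ℕ) (c : ℂ) (v : ℕ → ℂ) :
    gridH1Semi h M (fun j => c * v j) = ‖c‖ * gridH1Semi h M v := by
  simp only [gridH1Semi_eq]
  rw [show dxPlus h (fun j => c * v j) = fun j => c * dxPlus h v j from
    funext (dxPlus_mul_left h c v)]
  exact l2Norm_mul_left h _ c _

theorem gridL2_nonneg (h : ℝ) (M : ℕ) (v : ℕ → ℂ) : 0 ≤ gridL2 h M v := Real.sqrt_nonneg _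

theorem gridH1Semi_nonneg (h : ℝ) (M : ℕ) (v : ℕ → ℂ) : 0 ≤ gridH1Semi h M v := Real.sqrt_nonneg _

theorem gridL2_congr (h : ℝ) {M : ℕ} {v w : ℕ → ℂ} (H : ∀ j ≤ M, v j = w j) :
    gridL2 h M v = gridL2 h M w :=
  l2Norm_congr fun j hj => H j (by rw [Finset.mem_Icc] at hj; omega)

theorem gridH1Semi_congr (h : ℝ) {M : ℕ} {v w : ℕ → ℂ} (H : ∀ j ≤ M, v j = w j) :
    gridH1Semi h M v = gridH1Semi h M w :=
  l2Norm_congr fun j hj => by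
    rw [Finset.mem_range] at hj
    rw [dxPlus, dxPlus, H j hj.le, H (j + 1) hj]

theorem gridH1_le {h : ℝ} {M : ℕ} {v : ℕ → ℂ} {A B : ℝ} (hA : gridL2 h M v ≤ A)
    (hB : gridH1Semi h M v ≤ B) : gridH1 h M v ≤ A + B := by
  have h1 := gridL2_nonneg h M v
  have h2 := gridH1Semi_nonneg h M v
  refine Real.sqrt_le_iff.2 ⟨by linarith, ?_⟩
  nlinarith [mul_nonneg h1 h2]

theorem sum_Icc_pred_eq_sum_range {E : Type*} [AddCommMonoid E] (n : ℕ) (g : ℕ → E) :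
    ∑ j ∈ Finset.Icc 1 (n + 1 - 1), g j = ∑ j ∈ Finset.range n, g (j + 1) := by
  rw [Finset.range_eq_Ico, Finset.sum_Ico_add' g 0 n 1]
  rfl

/-- Grid functions vanishing at the end points satisfy an inverse inequality. -/
theorem gridH1Semi_le_of_boundary {h : ℝ} (hh : 0 < h) {M : ℕ} {v : ℕ → ℂ} (h0 : v 0 = 0)
    (hM : v M = 0) : gridH1Semi h M v ≤ 2 / h * gridL2 h M v := by
  rw [gridH1Semi]
  have hL := gridL2_nonneg h M v
  refine Real.sqrt_le_iff.2 ⟨by positivity, ?_⟩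
  rw [mul_pow, gridL2_eq, l2Norm_sq hh.le]
  rcases M with _ | n
  · simp
  rw [sum_Icc_pred_eq_sum_range]
  have e1 : ∀ j, ‖dxPlus h v j‖ ^ 2 ≤ 2 / h ^ 2 * (‖v (j + 1)‖ ^ 2 + ‖v j‖ ^ 2) := by
    intro j
    rw [dxPlus, norm_div, Complex.norm_real, Real.norm_of_nonneg hh.le, div_pow, div_mul_eq_mul_div]
    gcongr
    have := norm_sub_le (v (j + 1)) (v j)
    nlinarith [norm_nonneg (v (j + 1) - v j), norm_nonneg (v (j + 1)), norm_nonneg (v j),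
      sq_nonneg (‖v (j + 1)‖ - ‖v j‖)]
  have e2 : ∑ j ∈ Finset.range (n + 1), (‖v (j + 1)‖ ^ 2 + ‖v j‖ ^ 2) =
      2 * ∑ j ∈ Finset.range n, ‖v (j + 1)‖ ^ 2 := by
    rw [Finset.sum_add_distrib, Finset.sum_range_succ, Finset.sum_range_succ', h0, hM]
    simp; ring
  calc h * ∑ j ∈ Finset.range (n + 1), ‖dxPlus h v j‖ ^ 2
      ≤ h * ∑ j ∈ Finset.range (n + 1), 2 / h ^ 2 * (‖v (j + 1)‖ ^ 2 + ‖v j‖ ^ 2) := by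
        gcongr with j hj; exact e1 j
    _ = _ := by rw [← Finset.mul_sum, e2]; ring

theorem l2Norm_range_eq_gridL2 (h : ℝ) {M : ℕ} {v : ℕ → ℂ} (h0 : v 0 = 0) :
    l2Norm h (Finset.range M) v = gridL2 h M v := by
  rcases M with _ | n
  · simp [gridL2, l2Norm]
  rw [gridL2, l2Norm, sum_Icc_pred_eq_sum_range, Finset.sum_range_succ', h0]
  simp

theorem l2Norm_range_succ_eq_gridL2 (h : ℝ) {M : ℕ} {v : ℕ → ℂ} (hM : v M = 0) :
    l2Norm h (Finset.range M) (fun i => v (i + 1)) = gridL2 h M v := by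
  rcases M with _ | n
  · simp [gridL2, l2Norm]
  rw [gridL2, l2Norm, sum_Icc_pred_eq_sum_range, Finset.sum_range_succ, hM]
  simp

/-- The discrete Gagliardo–Nirenberg inequality `‖v‖_∞² ≤ 2 ‖v‖ |v|_{H¹}` for grid functions that
vanish at the end points. -/
theorem norm_sq_le_gridL2_mul_gridH1Semi {h : ℝ} (hh : 0 < h) {M : ℕ} {v : ℕ → ℂ} (h0 : v 0 = 0)
    (hM : v M = 0) {j : ℕ} (hj : j ≤ M) :
    ‖v j‖ ^ 2 ≤ 2 * (gridL2 h M v * gridH1Semi h M v) := by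
  rcases M with _ | n
  · obtain rfl : j = 0 := by omega
    rw [h0]; simp
    exact mul_nonneg (gridL2_nonneg ..) (gridH1Semi_nonneg ..)
  have step : ∀ i, ‖v (i + 1)‖ ^ 2 - ‖v i‖ ^ 2 ≤
      h * (‖v (i + 1)‖ * ‖dxPlus h v i‖) + h * (‖v i‖ * ‖dxPlus h v i‖) := by
    intro i
    have e : h * ‖dxPlus h v i‖ = ‖v (i + 1) - v i‖ := by
      rw [dxPlus, norm_div, Complex.norm_real, Real.norm_of_nonneg hh.le]; field_simp
    have := norm_sub_norm_le (v (i + 1)) (v i)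
    calc ‖v (i + 1)‖ ^ 2 - ‖v i‖ ^ 2 = (‖v (i + 1)‖ - ‖v i‖) * (‖v (i + 1)‖ + ‖v i‖) := by ring
      _ ≤ ‖v (i + 1) - v i‖ * (‖v (i + 1)‖ + ‖v i‖) := by gcongr
      _ = _ := by rw [← e]; ring
  have tel : ‖v j‖ ^ 2 ≤ ∑ i ∈ Finset.range (n + 1),
      (h * (‖v (i + 1)‖ * ‖dxPlus h v i‖) + h * (‖v i‖ * ‖dxPlus h v i‖)) := by
    have t1 : ‖v j‖ ^ 2 = ∑ i ∈ Finset.range j, (‖v (i + 1)‖ ^ 2 - ‖v i‖ ^ 2) := by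
      rw [Finset.sum_range_sub (fun i => ‖v i‖ ^ 2), h0]; simp
    rw [t1]
    refine (Finset.sum_le_sum fun i _ => step i).trans ?_
    refine Finset.sum_le_sum_of_subset_of_nonneg ?_ fun i _ _ => by positivity
    intro i hi; rw [Finset.mem_range] at *; omega
  have cs : ∀ w : ℕ → ℂ, h * ∑ i ∈ Finset.range (n + 1), ‖w i‖ * ‖dxPlus h v i‖ ≤
      l2Norm h (Finset.range (n + 1)) w * gridH1Semi h (n + 1) v := by
    intro w
    rw [gridH1Semi_eq]
    unfold l2Norm
    rw [Real.sqrt_mul hh.le, Real.sqrt_mul hh.le]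
    have := Real.sum_mul_le_sqrt_mul_sqrt (Finset.range (n + 1)) (fun i => ‖w i‖)
      (fun i => ‖dxPlus h v i‖)
    have h2 := mul_le_mul_of_nonneg_left this hh.le
    refine h2.trans_eq ?_
    nth_rewrite 1 [← Real.mul_self_sqrt hh.le]
    ring
  have c1 := cs (fun i => v (i + 1))
  have c2 := cs v
  rw [l2Norm_range_succ_eq_gridL2 h hM] at c1
  rw [l2Norm_range_eq_gridL2 h h0] at c2
  rw [Finset.sum_add_distrib, ← Finset.mul_sum, ← Finset.mul_sum] at tel
  linarith

/-! ### Energy estimates for the leapfrog scheme -/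

/-- Summation by parts. -/
theorem sum_dxx_mul (h : ℝ) {M : ℕ} (s g : ℕ → ℂ) (h0 : g 0 = 0) (hM : g M = 0) :
    ∑ j ∈ Finset.Icc 1 (M - 1), dxx h s j * g j =
      -∑ j ∈ Finset.range M, dxPlus h s j * dxPlus h g j := by
  rcases M with _ | n
  · simp
  rw [sum_Icc_pred_eq_sum_range]
  have key : ∀ n : ℕ, ∑ j ∈ Finset.range n, dxx h s (j + 1) * g (j + 1) =
      ((s (n + 1) - s n) * g n - (s 1 - s 0) * g 0) / (h : ℂ) ^ 2 -
        ∑ j ∈ Finset.range n, dxPlus h s j * dxPlus h g j := by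
    intro n
    induction n with
    | zero => simp
    | succ n ih =>
      rw [Finset.sum_range_succ, Finset.sum_range_succ, ih]
      simp only [dxx, dxPlus, Nat.add_sub_cancel]
      ring
  rw [key n, Finset.sum_range_succ, h0]
  simp only [dxPlus, hM]
  ring

/-- The common core of the energy estimates in `L²` and in `H¹`. -/
theorem l2Norm_le_of_re_eq {h τ : ℝ} (hh : 0 ≤ h) (hτ : 0 ≤ τ) (s : Finset ℕ) (p q x : ℕ → ℂ)
    (H : (∑ j ∈ s, (p j - q j) * conj (p j + q j)).re =
      2 * τ * (∑ j ∈ s, x j * conj (p j + q j)).im) :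
    l2Norm h s p ≤ l2Norm h s q + 2 * τ * l2Norm h s x := by
  have hp := l2Norm_nonneg h s p
  have hq := l2Norm_nonneg h s q
  have hx := l2Norm_nonneg h s x
  have e1 : (∑ j ∈ s, (p j - q j) * conj (p j + q j)).re =
      ∑ j ∈ s, ‖p j‖ ^ 2 - ∑ j ∈ s, ‖q j‖ ^ 2 := by
    rw [Complex.re_sum, ← Finset.sum_sub_distrib]
    refine Finset.sum_congr rfl fun j _ => ?_
    rw [← Complex.normSq_eq_norm_sq, ← Complex.normSq_eq_norm_sq, Complex.normSq_apply,
      Complex.normSq_apply]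
    simp
    ring
  have e2 : l2Norm h s p ^ 2 - l2Norm h s q ^ 2 =
      2 * τ * (h * (∑ j ∈ s, x j * conj (p j + q j)).im) := by
    rw [l2Norm_sq hh, l2Norm_sq hh, ← mul_sub, ← e1, H]; ring
  have e3 : h * (∑ j ∈ s, x j * conj (p j + q j)).im ≤
      l2Norm h s x * (l2Norm h s p + l2Norm h s q) := by
    calc _ ≤ h * ‖∑ j ∈ s, x j * conj (p j + q j)‖ :=
          mul_le_mul_of_nonneg_left ((le_abs_self _).trans (Complex.abs_im_le_norm _)) hh
      _ ≤ l2Norm h s x * l2Norm h s (fun j => p j + q j) := norm_sum_mul_conj_le hh _ _ _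
      _ ≤ _ := mul_le_mul_of_nonneg_left (l2Norm_add_le hh _ _ _) hx
  -- `p² - q² ≤ 2 τ x (p + q)`; the factor `p + q` cancels unless it vanishes, and then `p = q = 0`
  by_contra! hlt
  have hpos : 0 < l2Norm h s p + l2Norm h s q := by nlinarith [mul_nonneg hτ hx]
  have : (l2Norm h s p - l2Norm h s q - 2 * τ * l2Norm h s x) *
      (l2Norm h s p + l2Norm h s q) ≤ 0 := by nlinarith
  nlinarith

section Energy

variable {h τ : ℝ} {M : ℕ} {p q x : ℕ → ℂ}

/-- One step of a leapfrog scheme: conservation of the discrete mass up to the source. -/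
theorem gridL2_leapfrog_le (hh : 0 < h) (hτ : 0 < τ) (hp0 : p 0 = 0) (hpM : p M = 0)
    (hq0 : q 0 = 0) (hqM : q M = 0)
    (H : ∀ j ∈ Finset.Icc 1 (M - 1), Complex.I * ((p j - q j) / (2 * (τ : ℂ))) =
      -(1 / 2) * dxx h (fun i => p i + q i) j + x j) :
    gridL2 h M p ≤ gridL2 h M q + 2 * τ * gridL2 h M x := by
  refine l2Norm_le_of_re_eq hh.le hτ.le _ p q x ?_
  have hτ' : (τ : ℂ) ≠ 0 := by exact_mod_cast hτ.ne'
  have e1 : ∑ j ∈ Finset.Icc 1 (M - 1), (p j - q j) * conj (p j + q j) =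
      Complex.I * τ * ∑ j ∈ Finset.Icc 1 (M - 1), dxx h (fun i => p i + q i) j * conj (p j + q j) -
      2 * τ * Complex.I * ∑ j ∈ Finset.Icc 1 (M - 1), x j * conj (p j + q j) := by
    rw [Finset.mul_sum, Finset.mul_sum, ← Finset.sum_sub_distrib]
    refine Finset.sum_congr rfl fun j hj => ?_
    have h1 := H j hj
    have h2 : p j - q j = -(2 * τ * Complex.I) * (Complex.I * ((p j - q j) / (2 * (τ : ℂ)))) := by
      have : Complex.I * Complex.I = -1 := Complex.I_mul_I
      field_simp
      linear_combination (p j - q j) * this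
    rw [h1] at h2
    rw [h2]
    ring
  have e2 := sum_dxx_mul h (M := M) (fun i => p i + q i) (fun j => conj (p j + q j))
    (by simp [hp0, hq0]) (by simp [hpM, hqM])
  rw [e1, e2]
  have e3 : ∑ j ∈ Finset.range M, dxPlus h (fun i => p i + q i) j *
      dxPlus h (fun j => conj (p j + q j)) j =
      ((∑ j ∈ Finset.range M, ‖dxPlus h (fun i => p i + q i) j‖ ^ 2 : ℝ) : ℂ) := by
    push_cast
    refine Finset.sum_congr rfl fun j _ => ?_
    rw [← Complex.mul_conj']
    congr 1
    simp [dxPlus]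
  rw [e3]
  generalize (∑ j ∈ Finset.range M, ‖dxPlus h (fun i => p i + q i) j‖ ^ 2 : ℝ) = R
  simp

/-- One step of a leapfrog scheme: conservation of the discrete energy up to the source, which has
to vanish at the end points. -/
theorem gridH1Semi_leapfrog_le (hh : 0 < h) (hτ : 0 < τ) (hp0 : p 0 = 0) (hpM : p M = 0)
    (hq0 : q 0 = 0) (hqM : q M = 0) (hx0 : x 0 = 0) (hxM : x M = 0)
    (H : ∀ j ∈ Finset.Icc 1 (M - 1), Complex.I * ((p j - q j) / (2 * (τ : ℂ))) =
      -(1 / 2) * dxx h (fun i => p i + q i) j + x j) :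
    gridH1Semi h M p ≤ gridH1Semi h M q + 2 * τ * gridH1Semi h M x := by
  refine l2Norm_le_of_re_eq hh.le hτ.le _ (dxPlus h p) (dxPlus h q) (dxPlus h x) ?_
  have hτ' : (τ : ℂ) ≠ 0 := by exact_mod_cast hτ.ne'
  set s : ℕ → ℂ := fun i => conj (p i + q i) with hs
  have hsd : ∀ j, conj (dxPlus h p j + dxPlus h q j) = dxPlus h s j := by
    intro j; simp [dxPlus, hs]; ring
  have hsx : ∀ j, dxx h s j = conj (dxx h (fun i => p i + q i) j) := by
    intro j; simp [dxx, hs, map_ofNat]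
  simp only [hsd]
  have e0 : ∑ j ∈ Finset.range M, (dxPlus h p j - dxPlus h q j) * dxPlus h s j =
      -∑ j ∈ Finset.Icc 1 (M - 1), dxx h s j * (p j - q j) := by
    rw [sum_dxx_mul h s (fun j => p j - q j) (by simp [hp0, hq0]) (by simp [hpM, hqM]), neg_neg]
    refine Finset.sum_congr rfl fun j _ => ?_
    simp [dxPlus]; ring
  have e1 : ∑ j ∈ Finset.range M, dxPlus h x j * dxPlus h s j =
      -∑ j ∈ Finset.Icc 1 (M - 1), dxx h s j * x j := by
    rw [sum_dxx_mul h s x hx0 hxM, neg_neg]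
    exact Finset.sum_congr rfl fun j _ => mul_comm _ _
  have e2 : ∑ j ∈ Finset.Icc 1 (M - 1), dxx h s j * (p j - q j) =
      Complex.I * τ * ((∑ j ∈ Finset.Icc 1 (M - 1), ‖dxx h (fun i => p i + q i) j‖ ^ 2 : ℝ) : ℂ) -
      2 * τ * Complex.I * ∑ j ∈ Finset.Icc 1 (M - 1), dxx h s j * x j := by
    push_cast
    rw [Finset.mul_sum, Finset.mul_sum, ← Finset.sum_sub_distrib]
    refine Finset.sum_congr rfl fun j hj => ?_
    have h1 := H j hj
    have h2 : p j - q j = -(2 * τ * Complex.I) * (Complex.I * ((p j - q j) / (2 * (τ : ℂ)))) := by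
      have : Complex.I * Complex.I = -1 := Complex.I_mul_I
      field_simp
      linear_combination (p j - q j) * this
    rw [h1] at h2
    rw [h2, ← Complex.mul_conj', hsx]
    ring
  rw [e0, e1, e2]
  generalize (∑ j ∈ Finset.Icc 1 (M - 1), ‖dxx h (fun i => p i + q i) j‖ ^ 2 : ℝ) = R
  simp

end Energy

/-- The Gronwall inequality for the three-level recursion of the leapfrog scheme. -/
theorem gronwall_leapfrog {x : ℕ → ℝ} {τ L ρ S : ℝ} (hτ : 0 ≤ τ) (hL : 0 ≤ L) (hρ : 0 ≤ ρ)
    (hS : 0 ≤ S) {n : ℕ} (h0 : x 0 ≤ S) (h1 : 1 ≤ n → x 1 ≤ S)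
    (H : ∀ k, 1 ≤ k → k < n → x (k + 1) ≤ x (k - 1) + 2 * τ * (L * x k + ρ)) :
    ∀ k ≤ n, x k ≤ Real.exp (2 * L * (τ * k)) * (S + 2 * (τ * k) * ρ) := by
  have mono : ∀ k l : ℕ, k ≤ l → Real.exp (2 * L * (τ * k)) * (S + 2 * (τ * k) * ρ) ≤
      Real.exp (2 * L * (τ * l)) * (S + 2 * (τ * l) * ρ) := by
    intro k l hkl
    have : (k : ℝ) ≤ l := by exact_mod_cast hkl
    gcongr
  have base : S ≤ Real.exp (2 * L * (τ * (0 : ℕ))) * (S + 2 * (τ * (0 : ℕ)) * ρ) := by simp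
  intro k
  induction k using Nat.strong_induction_on with
  | _ k ih =>
    intro hk
    rcases k with _ | _ | k
    · exact h0.trans base
    · exact (h1 hk).trans (base.trans (mono _ _ (by omega)))
    have hs := H (k + 1) (by omega) (by omega)
    have i1 := ih (k + 1) (by omega) (by omega)
    have i0 := (ih k (by omega) (by omega)).trans (mono k (k + 1) (by omega))
    simp only [Nat.add_sub_cancel] at hs
    set B := Real.exp (2 * L * (τ * (k + 1 : ℕ))) * (S + 2 * (τ * (k + 1 : ℕ)) * ρ) with hB
    have hB0 : 0 ≤ B := by positivity
    have e : Real.exp (2 * L * (τ * (k + 1 + 1 : ℕ))) =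
        Real.exp (2 * L * τ) * Real.exp (2 * L * (τ * (k + 1 : ℕ))) := by
      rw [← Real.exp_add]; congr 1; push_cast; ring
    have g1 : 1 + 2 * L * τ ≤ Real.exp (2 * L * τ) := by
      have := Real.add_one_le_exp (2 * L * τ); linarith
    have g2 : 1 ≤ Real.exp (2 * L * (τ * (k + 1 + 1 : ℕ))) := Real.one_le_exp (by positivity)
    calc x (k + 1 + 1) ≤ B + 2 * τ * (L * B + ρ) := by
          refine hs.trans ?_
          gcongr
      _ = (1 + 2 * L * τ) * B + 2 * τ * ρ := by ring
      _ ≤ Real.exp (2 * L * τ) * B + Real.exp (2 * L * (τ * (k + 1 + 1 : ℕ))) * (2 * τ * ρ) := by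
          have : 0 ≤ 2 * τ * ρ := by positivity
          nlinarith [mul_le_mul_of_nonneg_right g1 hB0, mul_le_mul_of_nonneg_right g2 this]
      _ = _ := by rw [hB, e]; push_cast; ring

/-! ### The regularized logarithmic nonlinearity -/

/-- The real differential of `logNonlin ε` at `z`, applied to `v`. For `z = 0` the second summand is
`0` by the convention on division by zero, which is the correct value. -/
noncomputable def logNonlinDeriv (ε : ℝ) (z v : ℂ) : ℂ :=
  ((2 * Real.log (ε + ‖z‖) : ℝ) : ℂ) * v + 2 * ((inner ℝ z v / ‖z‖ : ℝ) : ℂ) * z / ((ε + ‖z‖ : ℝ) : ℂ)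

theorem logNonlin_zero (ε : ℝ) : logNonlin ε 0 = 0 := by simp [logNonlin]

theorem logNonlin_eq (ε : ℝ) (z : ℂ) :
    logNonlin ε z = ((2 * Real.log (ε + ‖z‖) : ℝ) : ℂ) * z := by
  rw [logNonlin, Real.log_pow, mul_comm]; norm_num

theorem continuous_log_add_norm {ε : ℝ} (hε : 0 < ε) :
    Continuous fun z : ℂ => 2 * Real.log (ε + ‖z‖) :=
  (Continuous.log (by fun_prop) fun z => by positivity).const_mul 2

theorem continuous_logNonlin {ε : ℝ} (hε : 0 < ε) : Continuous (logNonlin ε) := by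
  have : logNonlin ε = fun z => ((2 * Real.log (ε + ‖z‖) : ℝ) : ℂ) * z := funext (logNonlin_eq ε)
  rw [this]
  have := continuous_log_add_norm hε
  fun_prop

theorem hasDerivAt_logNonlin_line {ε : ℝ} (hε : 0 < ε) (z v : ℂ) (s : ℝ) :
    HasDerivAt (fun s : ℝ => logNonlin ε (z + s * v)) (logNonlinDeriv ε (z + s * v) v) s := by
  have hline : HasDerivAt (fun s : ℝ => z + s * v) v s := by
    simpa using ((Complex.ofRealCLM.hasDerivAt (x := s)).mul_const v).const_add z
  set w : ℂ := z + s * v with hw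
  have hfun : (fun s : ℝ => logNonlin ε (z + s * v)) =
      fun s : ℝ => ((2 * Real.log (ε + ‖z + s * v‖) : ℝ) : ℂ) * (z + s * v) :=
    funext fun s => logNonlin_eq ε _
  rw [hfun]
  by_cases h0 : w = 0
  · -- at a zero of the line the factor `ln (ε + |z|)` need only be continuous
    have e : (fun s' : ℝ => ((2 * Real.log (ε + ‖z + s' * v‖) : ℝ) : ℂ) * (z + s' * v)) =
        fun s' : ℝ => ((s' - s : ℝ) : ℂ) * (((2 * Real.log (ε + ‖z + s' * v‖) : ℝ) : ℂ) * v) := by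
      funext s'
      have : z = -(s * v) := by rw [hw] at h0; linear_combination h0
      rw [this]; push_cast; ring
    rw [e, hasDerivAt_iff_tendsto_slope]
    have hc : Continuous fun s' : ℝ => ((2 * Real.log (ε + ‖z + s' * v‖) : ℝ) : ℂ) * v := by
      have := (continuous_log_add_norm hε).comp
        (show Continuous fun s' : ℝ => z + s' * v by fun_prop)
      simp only [Function.comp_def] at this
      fun_prop
    have h1 := (hc.tendsto s).mono_left (nhdsWithin_le_nhds (s := {s}ᶜ))
    have h2 : logNonlinDeriv ε w v = ((2 * Real.log (ε + ‖z + s * v‖) : ℝ) : ℂ) * v := by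
      rw [← hw, h0]; simp [logNonlinDeriv]
    rw [h2]
    refine h1.congr' ?_
    filter_upwards [self_mem_nhdsWithin] with s' hs'
    have : ((s' - s : ℝ) : ℂ) ≠ 0 := by
      exact_mod_cast sub_ne_zero.2 hs'
    rw [slope_def_module]
    simp only [sub_self, Complex.ofReal_zero, zero_mul, sub_zero, Complex.real_smul,
      Complex.ofReal_inv]
    field_simp
  · have hn : HasDerivAt (fun s : ℝ => ‖z + s * v‖) (inner ℝ w v / ‖w‖) s := by
      have h1 := (hline.norm_sq).sqrt (by simpa using h0)
      simp only [Real.sqrt_sq (norm_nonneg _)] at h1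
      convert h1 using 1
      rw [← hw]; field_simp
    have hpos : 0 < ε + ‖w‖ := by positivity
    have hl := ((hn.const_add ε).log hpos.ne').const_mul 2
    have h3 := (hl.ofReal_comp).mul hline
    refine h3.congr_deriv ?_
    simp only [logNonlinDeriv, ← hw]
    push_cast
    ring

theorem norm_inner_div_norm_le (z v : ℂ) : |inner ℝ z v / ‖z‖| ≤ ‖v‖ := by
  rcases eq_or_ne z 0 with rfl | hz
  · simp
  have hz' : 0 < ‖z‖ := norm_pos_iff.2 hz
  rw [abs_div, abs_norm, div_le_iff₀ hz', mul_comm]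
  exact abs_real_inner_le_norm z v

/-- `|ln (ε + r)| ≤ |ln ε| + R` for `0 ≤ r ≤ R` and `ε < 1`. -/
theorem abs_log_add_le {ε r R : ℝ} (hε : 0 < ε) (hε1 : ε < 1) (hr : 0 ≤ r) (hrR : r ≤ R) :
    |Real.log (ε + r)| ≤ |Real.log ε| + R := by
  have h1 : Real.log ε ≤ Real.log (ε + r) := Real.log_le_log hε (by linarith)
  have h2 : Real.log (ε + r) ≤ ε + r - 1 := Real.log_le_sub_one_of_pos (by linarith)
  rw [abs_le]
  constructor
  · have := neg_abs_le (Real.log ε); linarith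
  · have := abs_nonneg (Real.log ε); linarith

theorem norm_logNonlinDeriv_le {ε R : ℝ} (hε : 0 < ε) (hε1 : ε < 1) {z : ℂ} (hz : ‖z‖ ≤ R)
    (v : ℂ) : ‖logNonlinDeriv ε z v‖ ≤ (2 * |Real.log ε| + 2 * R + 2) * ‖v‖ := by
  have hpos : 0 < ε + ‖z‖ := by positivity
  have h1 : ‖((2 * Real.log (ε + ‖z‖) : ℝ) : ℂ) * v‖ ≤ (2 * (|Real.log ε| + R)) * ‖v‖ := by
    rw [norm_mul, Complex.norm_real, Real.norm_eq_abs, abs_mul, abs_two]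
    have := abs_log_add_le hε hε1 (norm_nonneg z) hz
    gcongr
  have h2 : ‖2 * ((inner ℝ z v / ‖z‖ : ℝ) : ℂ) * z / ((ε + ‖z‖ : ℝ) : ℂ)‖ ≤ 2 * ‖v‖ := by
    rw [norm_div, norm_mul, norm_mul, Complex.norm_real, Complex.norm_real, Real.norm_eq_abs,
      Real.norm_of_nonneg hpos.le, div_le_iff₀ hpos, Complex.norm_ofNat]
    have := norm_inner_div_norm_le z v
    calc 2 * |inner ℝ z v / ‖z‖| * ‖z‖ ≤ 2 * ‖v‖ * ‖z‖ := by gcongr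
      _ ≤ 2 * ‖v‖ * (ε + ‖z‖) := by gcongr; linarith
  calc _ ≤ _ := norm_add_le _ _
    _ ≤ _ := by linarith

theorem abs_log_add_sub_log_add_le {ε r s : ℝ} (hε : 0 < ε) (hr : 0 ≤ r) (hs : 0 ≤ s) :
    |Real.log (ε + r) - Real.log (ε + s)| ≤ |r - s| / ε := by
  wlog h : s ≤ r generalizing r s
  · rw [abs_sub_comm, abs_sub_comm r]; exact this hs hr (le_of_not_ge h)
  have h1 : Real.log (ε + s) ≤ Real.log (ε + r) := Real.log_le_log (by linarith) (by linarith)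
  rw [abs_of_nonneg (by linarith), abs_of_nonneg (by linarith),
    ← Real.log_div (by linarith) (by linarith)]
  have hp : 0 < ε + s := by linarith
  calc _ ≤ (ε + r) / (ε + s) - 1 := Real.log_le_sub_one_of_pos (div_pos (by linarith) hp)
    _ = (r - s) / (ε + s) := by field_simp; ring
    _ ≤ _ := by gcongr; linarith

/-- The field `z ↦ ⟨z, v⟩ z / |z|` is Lipschitz, being homogeneous of degree one. -/
theorem norm_inner_smul_sub_le (z w v : ℂ) :
    ‖((inner ℝ z v / ‖z‖ : ℝ) : ℂ) * z - ((inner ℝ w v / ‖w‖ : ℝ) : ℂ) * w‖ ≤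
      3 * ‖z - w‖ * ‖v‖ := by
  have hb := norm_inner_div_norm_le
  have e : ((inner ℝ z v / ‖z‖ : ℝ) : ℂ) * z - ((inner ℝ w v / ‖w‖ : ℝ) : ℂ) * w =
      ((inner ℝ z v / ‖z‖ : ℝ) : ℂ) * (z - w) +
        ((inner ℝ z v / ‖z‖ - inner ℝ w v / ‖w‖ : ℝ) : ℂ) * w := by push_cast; ring
  have h2 : |inner ℝ z v / ‖z‖ - inner ℝ w v / ‖w‖| * ‖w‖ ≤ 2 * ‖z - w‖ * ‖v‖ := by
    rcases eq_or_ne w 0 with rfl | hw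
    · simp; positivity
    have hw' : ‖w‖ ≠ 0 := norm_ne_zero_iff.2 hw
    rw [← abs_norm w, ← abs_mul, abs_norm]
    -- this also holds for `z = 0`, where the quotient is `0`
    have e2 : (inner ℝ z v / ‖z‖ - inner ℝ w v / ‖w‖) * ‖w‖ =
        (‖w‖ - ‖z‖) * (inner ℝ z v / ‖z‖) + inner ℝ (z - w) v := by
      rw [inner_sub_left]
      rcases eq_or_ne z 0 with rfl | hz
      · simp only [inner_zero_left, norm_zero, div_zero, zero_sub]
        field_simp
        ring
      have hz' : ‖z‖ ≠ 0 := norm_ne_zero_iff.2 hz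
      field_simp
      ring
    rw [e2]
    calc _ ≤ |‖w‖ - ‖z‖| * |inner ℝ z v / ‖z‖| + |inner ℝ (z - w) v| := by
          rw [← abs_mul]; exact abs_add_le _ _
      _ ≤ ‖z - w‖ * ‖v‖ + ‖z - w‖ * ‖v‖ := by
          gcongr
          · rw [abs_sub_comm]; exact abs_norm_sub_norm_le z w
          · exact hb z v
          · exact abs_real_inner_le_norm _ _
      _ = _ := by ring
  rw [e]
  refine (norm_add_le _ _).trans ?_
  rw [norm_mul, norm_mul, Complex.norm_real, Complex.norm_real, Real.norm_eq_abs, Real.norm_eq_abs]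
  have := mul_le_mul_of_nonneg_right (hb z v) (norm_nonneg (z - w))
  linarith

/-- The differential of `logNonlin ε` is Lipschitz with constant `10 / ε`. -/
theorem norm_logNonlinDeriv_sub_le {ε : ℝ} (hε : 0 < ε) (z w v : ℂ) :
    ‖logNonlinDeriv ε z v - logNonlinDeriv ε w v‖ ≤ 10 / ε * ‖z - w‖ * ‖v‖ := by
  set R : ℂ → ℂ := fun z => ((inner ℝ z v / ‖z‖ : ℝ) : ℂ) * z with hR
  have hpz : 0 < ε + ‖z‖ := by positivity
  have hpw : 0 < ε + ‖w‖ := by positivity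
  have hz0 : ((ε + ‖z‖ : ℝ) : ℂ) ≠ 0 := by exact_mod_cast hpz.ne'
  have hw0 : ((ε + ‖w‖ : ℝ) : ℂ) ≠ 0 := by exact_mod_cast hpw.ne'
  have e : logNonlinDeriv ε z v - logNonlinDeriv ε w v =
      ((2 * (Real.log (ε + ‖z‖) - Real.log (ε + ‖w‖)) : ℝ) : ℂ) * v +
      2 * ((R z - R w) / ((ε + ‖z‖ : ℝ) : ℂ)) +
      2 * (((‖w‖ - ‖z‖ : ℝ) : ℂ) * (R w / ((ε + ‖w‖ : ℝ) : ℂ)) / ((ε + ‖z‖ : ℝ) : ℂ)) := by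
    have : ((‖w‖ - ‖z‖ : ℝ) : ℂ) = ((ε + ‖w‖ : ℝ) : ℂ) - ((ε + ‖z‖ : ℝ) : ℂ) := by push_cast; ring
    rw [this]
    simp only [logNonlinDeriv, hR]
    field_simp
    push_cast
    ring
  have hn : |‖w‖ - ‖z‖| ≤ ‖z - w‖ := by rw [abs_sub_comm]; exact abs_norm_sub_norm_le z w
  have h1 : ‖((2 * (Real.log (ε + ‖z‖) - Real.log (ε + ‖w‖)) : ℝ) : ℂ) * v‖ ≤
      2 * (‖z - w‖ / ε) * ‖v‖ := by
    rw [norm_mul, Complex.norm_real, Real.norm_eq_abs, abs_mul, abs_two]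
    gcongr
    refine (abs_log_add_sub_log_add_le hε (norm_nonneg z) (norm_nonneg w)).trans ?_
    gcongr
    exact abs_norm_sub_norm_le z w
  have h2 : ‖2 * ((R z - R w) / ((ε + ‖z‖ : ℝ) : ℂ))‖ ≤ 2 * (3 * ‖z - w‖ * ‖v‖ / ε) := by
    rw [norm_mul, norm_div, Complex.norm_real, Real.norm_of_nonneg hpz.le, Complex.norm_ofNat]
    gcongr
    · exact norm_inner_smul_sub_le z w v
    · linarith [norm_nonneg z]
  have h3 : ‖2 * (((‖w‖ - ‖z‖ : ℝ) : ℂ) * (R w / ((ε + ‖w‖ : ℝ) : ℂ)) / ((ε + ‖z‖ : ℝ) : ℂ))‖ ≤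
      2 * (‖z - w‖ * ‖v‖ / ε) := by
    rw [norm_mul, norm_div, norm_mul, norm_div, Complex.norm_real, Complex.norm_real,
      Complex.norm_real, Real.norm_of_nonneg hpz.le, Real.norm_of_nonneg hpw.le, Complex.norm_ofNat,
      Real.norm_eq_abs]
    have : ‖R w‖ / (ε + ‖w‖) ≤ ‖v‖ := by
      rw [div_le_iff₀ hpw, hR, norm_mul, Complex.norm_real, Real.norm_eq_abs]
      have := norm_inner_div_norm_le w v
      gcongr
      linarith
    gcongr
    linarith [norm_nonneg z]
  rw [e]
  calc _ ≤ _ := norm_add₃_le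
    _ ≤ 2 * (‖z - w‖ / ε) * ‖v‖ + 2 * (3 * ‖z - w‖ * ‖v‖ / ε) + 2 * (‖z - w‖ * ‖v‖ / ε) := by
        linarith
    _ = _ := by ring

theorem norm_line_le {z w : ℂ} {R s : ℝ} (hs : s ∈ Icc (0 : ℝ) 1) (hz : ‖z‖ ≤ R) (hw : ‖w‖ ≤ R) :
    ‖z + s * (w - z)‖ ≤ R := by
  have e : z + s * (w - z) = ((1 - s : ℝ) : ℂ) * z + (s : ℂ) * w := by push_cast; ring
  rw [e]
  refine (norm_add_le _ _).trans ?_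
  rw [norm_mul, norm_mul, Complex.norm_real, Complex.norm_real, Real.norm_of_nonneg hs.1,
    Real.norm_of_nonneg (by linarith [hs.2])]
  nlinarith [hs.1, hs.2]

/-- `logNonlin ε` is Lipschitz on the disc of radius `R`, with a constant of order `|ln ε|`. -/
theorem norm_logNonlin_sub_le {ε R : ℝ} (hε : 0 < ε) (hε1 : ε < 1) {z w : ℂ} (hz : ‖z‖ ≤ R)
    (hw : ‖w‖ ≤ R) :
    ‖logNonlin ε z - logNonlin ε w‖ ≤ (2 * |Real.log ε| + 2 * R + 2) * ‖z - w‖ := by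
  have := norm_image_sub_le_of_norm_deriv_le_segment_01'
    (f := fun s : ℝ => logNonlin ε (w + s * (z - w)))
    (f' := fun s : ℝ => logNonlinDeriv ε (w + s * (z - w)) (z - w))
    (C := (2 * |Real.log ε| + 2 * R + 2) * ‖z - w‖)
    (fun s _ => (hasDerivAt_logNonlin_line hε w (z - w) s).hasDerivWithinAt)
    (fun s hs => norm_logNonlinDeriv_le hε hε1 (norm_line_le ⟨hs.1, hs.2.le⟩ hw hz) _)
  simpa using this

/-- Comparison of two increments of `logNonlin ε`. -/
theorem norm_logNonlin_sub_sub_le {ε R E : ℝ} (hε : 0 < ε) (hε1 : ε < 1) {z₀ z₁ w₀ w₁ : ℂ}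
    (hw₀ : ‖w₀‖ ≤ R) (hw₁ : ‖w₁‖ ≤ R) (h₀ : ‖z₀ - w₀‖ ≤ E) (h₁ : ‖z₁ - w₁‖ ≤ E) :
    ‖(logNonlin ε z₁ - logNonlin ε w₁) - (logNonlin ε z₀ - logNonlin ε w₀)‖ ≤
      (2 * |Real.log ε| + 2 * R + 2) * ‖(z₁ - w₁) - (z₀ - w₀)‖ + 10 / ε * E * ‖z₁ - z₀‖ := by
  have hlin : ∀ z v v' : ℂ, logNonlinDeriv ε z v - logNonlinDeriv ε z v' =
      logNonlinDeriv ε z (v - v') := by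
    intro z v v'
    simp only [logNonlinDeriv, inner_sub_right, sub_div]
    push_cast
    ring
  have := norm_image_sub_le_of_norm_deriv_le_segment_01'
    (f := fun s : ℝ => logNonlin ε (z₀ + s * (z₁ - z₀)) - logNonlin ε (w₀ + s * (w₁ - w₀)))
    (f' := fun s : ℝ => logNonlinDeriv ε (z₀ + s * (z₁ - z₀)) (z₁ - z₀) -
      logNonlinDeriv ε (w₀ + s * (w₁ - w₀)) (w₁ - w₀))
    (C := (2 * |Real.log ε| + 2 * R + 2) * ‖(z₁ - w₁) - (z₀ - w₀)‖ + 10 / ε * E * ‖z₁ - z₀‖)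
    (fun s _ => ((hasDerivAt_logNonlin_line hε z₀ (z₁ - z₀) s).sub
      (hasDerivAt_logNonlin_line hε w₀ (w₁ - w₀) s)).hasDerivWithinAt)
    (fun s hs => by
      have hs' : s ∈ Icc (0 : ℝ) 1 := ⟨hs.1, hs.2.le⟩
      have e : logNonlinDeriv ε (z₀ + s * (z₁ - z₀)) (z₁ - z₀) -
          logNonlinDeriv ε (w₀ + s * (w₁ - w₀)) (w₁ - w₀) =
          logNonlinDeriv ε (w₀ + s * (w₁ - w₀)) ((z₁ - z₀) - (w₁ - w₀)) +
          (logNonlinDeriv ε (z₀ + s * (z₁ - z₀)) (z₁ - z₀) -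
            logNonlinDeriv ε (w₀ + s * (w₁ - w₀)) (z₁ - z₀)) := by
        rw [← hlin _ (z₁ - z₀) (w₁ - w₀)]; abel
      rw [e]
      refine (norm_add_le _ _).trans (add_le_add ?_ ?_)
      · refine (norm_logNonlinDeriv_le hε hε1 (norm_line_le hs' hw₀ hw₁) _).trans_eq ?_
        congr 2; ring
      · refine (norm_logNonlinDeriv_sub_le hε _ _ _).trans ?_
        have e2 : z₀ + s * (z₁ - z₀) - (w₀ + s * (w₁ - w₀)) =
          (z₀ - w₀) + s * ((z₁ - w₁) - (z₀ - w₀)) := by ring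
        rw [e2]
        gcongr
        exact norm_line_le hs' h₀ h₁)
  have e : ∀ x y : ℂ, x + ((1 : ℝ) : ℂ) * (y - x) = y := by intro x y; simp
  simp only [e] at this
  simpa using this

/-! ### Weak derivatives and the lemma of du Bois-Reymond -/

section WeakDeriv

variable {a b : ℝ}

theorem IsTestFunction.deriv {φ : ℝ → ℝ} (hφ : IsTestFunction a b φ) :
    IsTestFunction a b (deriv φ) := by
  refine ⟨?_, hφ.2.1.deriv, ?_⟩
  · exact (contDiff_infty_iff_deriv.1 hφ.1).2
  · exact (closure_mono support_deriv_subset).trans (by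
      rw [(isClosed_tsupport φ).closure_eq]; exact hφ.2.2)

theorem IsTestFunction.eq_zero {φ : ℝ → ℝ} (hφ : IsTestFunction a b φ) {x : ℝ} (hx : x ∉ Ioo a b) :
    φ x = 0 :=
  image_eq_zero_of_notMem_tsupport fun h => hx (hφ.2.2 h)

theorem IsTestFunction.integrable_mul {φ : ℝ → ℝ} (hφ : IsTestFunction a b φ) {f : ℝ → ℂ}
    (hf : IntegrableOn f (Ioo a b)) : IntegrableOn (fun x => φ x • f x) (Ioo a b) := by
  obtain ⟨C, hC⟩ := hφ.2.1.exists_bound_of_continuous hφ.1.continuous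
  exact hf.bdd_smul C hφ.1.continuous.aestronglyMeasurable (Filter.Eventually.of_forall hC)

theorem ae_eq_of_integral_test_eq {f g : ℝ → ℂ} (hf : IntegrableOn f (Ioo a b))
    (hg : IntegrableOn g (Ioo a b))
    (H : ∀ φ : ℝ → ℝ, IsTestFunction a b φ →
      ∫ x in Ioo a b, φ x • f x = ∫ x in Ioo a b, φ x • g x) :
    f =ᵐ[volume.restrict (Ioo a b)] g := by
  have h1 := isOpen_Ioo.ae_eq_zero_of_integral_contDiff_smul_eq_zero (μ := volume)
    (f := fun x => f x - g x) (U := Ioo a b) (hf.sub hg).locallyIntegrableOn ?_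
  · rw [Filter.EventuallyEq, ae_restrict_iff' measurableSet_Ioo]
    filter_upwards [h1] with x hx hxI
    exact sub_eq_zero.1 (hx hxI)
  · intro φ h1 h2 h3
    have ht : IsTestFunction a b φ := ⟨h1, h2, h3⟩
    have e : ∫ x, φ x • (f x - g x) = ∫ x in Ioo a b, φ x • (f x - g x) := by
      refine (setIntegral_eq_integral_of_forall_compl_eq_zero fun x hx => ?_).symm
      rw [ht.eq_zero hx, zero_smul]
    rw [e]
    simp only [smul_sub]
    rw [integral_sub (ht.integrable_mul hf) (ht.integrable_mul hg), H φ ht, sub_self]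

/-- An integrable function with vanishing weak derivative is constant. -/
theorem exists_ae_eq_const_of_integral_deriv_smul_eq_zero (hab : a < b) {d : ℝ → ℂ}
    (hd : IntegrableOn d (Ioo a b))
    (H : ∀ φ : ℝ → ℝ, IsTestFunction a b φ → ∫ x in Ioo a b, deriv φ x • d x = 0) :
    ∃ c : ℂ, d =ᵐ[volume.restrict (Ioo a b)] fun _ => c := by
  let B : ContDiffBump ((a + b) / 2) := ⟨(b - a) / 8, (b - a) / 4, by linarith, by linarith⟩
  set φ₀ : ℝ → ℝ := B.normed volume with hφ₀
  have ht₀ : IsTestFunction a b φ₀ := by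
    refine ⟨B.contDiff_normed, B.hasCompactSupport_normed, ?_⟩
    rw [hφ₀, B.tsupport_normed_eq, Real.closedBall_eq_Icc]
    intro x hx
    have h1 : (a + b) / 2 - (b - a) / 4 ≤ x := hx.1
    have h2 : x ≤ (a + b) / 2 + (b - a) / 4 := hx.2
    exact ⟨by linarith, by linarith⟩
  have hint₀ : ∫ x, φ₀ x = 1 := B.integral_normed
  refine ⟨∫ x in Ioo a b, φ₀ x • d x, ae_eq_of_integral_test_eq hd (by simp) fun φ hφ => ?_⟩
  -- `φ - m φ₀` has integral zero, hence is the derivative of a test function `χ`, so testing `d`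
  -- with it gives zero
  set m : ℝ := ∫ x, φ x with hm
  set ψ : ℝ → ℝ := fun x => φ x - m * φ₀ x with hψ
  have hψc : ContDiff ℝ ∞ ψ := hφ.1.sub (contDiff_const.mul ht₀.1)
  obtain ⟨a', b', ha', hb', hK⟩ : ∃ a' b', a < a' ∧ b' < b ∧
      ∀ x, x ∉ Icc a' b' → ψ x = 0 := by
    have hKc : IsCompact (tsupport φ ∪ tsupport φ₀) := hφ.2.1.union ht₀.2.1
    have hKs : tsupport φ ∪ tsupport φ₀ ⊆ Ioo a b := union_subset hφ.2.2 ht₀.2.2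
    have hne : (tsupport φ ∪ tsupport φ₀).Nonempty := by
      by_contra hemp
      rw [not_nonempty_iff_eq_empty, union_empty_iff, tsupport_eq_empty_iff,
        tsupport_eq_empty_iff] at hemp
      rw [hemp.2] at hint₀
      simp at hint₀
    obtain ⟨a', ha'⟩ := hKc.exists_isLeast hne
    obtain ⟨b', hb'⟩ := hKc.exists_isGreatest hne
    refine ⟨a', b', (hKs ha'.1).1, (hKs hb'.1).2, fun x hx => ?_⟩
    have hxK : x ∉ tsupport φ ∪ tsupport φ₀ := fun h => hx ⟨ha'.2 h, hb'.2 h⟩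
    rw [mem_union, not_or] at hxK
    simp only [hψ]
    rw [image_eq_zero_of_notMem_tsupport hxK.1, image_eq_zero_of_notMem_tsupport hxK.2]
    simp
  set χ : ℝ → ℝ := fun x => ∫ y in a..x, ψ y with hχ
  have hχd : ∀ x, HasDerivAt χ (ψ x) x := fun x =>
    intervalIntegral.integral_hasDerivAt_right (hψc.continuous.intervalIntegrable _ _)
      (hψc.continuous.stronglyMeasurableAtFilter _ _) hψc.continuous.continuousAt
  have hχ' : deriv χ = ψ := funext fun x => (hχd x).deriv
  have hχ0 : ∀ x, x ∉ Icc a' b' → χ x = 0 := by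
    intro x hx
    rcases lt_or_ge x a' with hlt | hge
    · refine (intervalIntegral.integral_congr (g := fun _ => 0) fun y hy => ?_).trans (by simp)
      refine hK y fun h => ?_
      rcases le_total a x with h1 | h1
      · rw [uIcc_of_le h1] at hy; linarith [hy.2, h.1]
      · rw [uIcc_of_ge h1] at hy; linarith [hy.2, h.1]
    · have hxb : b' < x := by
        by_contra! h; exact hx ⟨hge, h⟩
      rw [hχ]
      simp only
      rw [intervalIntegral.integral_eq_integral_of_support_subset]
      · rw [hψ, integral_sub (hφ.1.continuous.integrable_of_hasCompactSupport hφ.2.1)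
          ((ht₀.1.continuous.integrable_of_hasCompactSupport ht₀.2.1).const_mul m),
          integral_const_mul, hint₀]
        simp [hm]
      · intro y hy
        have : y ∈ Icc a' b' := by
          by_contra h; exact hy (hK y h)
        exact ⟨by linarith [this.1], by linarith [this.2]⟩
  have hsupp : tsupport χ ⊆ Icc a' b' :=
    closure_minimal (fun x hx => by by_contra h; exact hx (hχ0 x h)) isClosed_Icc
  have htχ : IsTestFunction a b χ := by
    refine ⟨?_, HasCompactSupport.intro isCompact_Icc hχ0, hsupp.trans fun x hx => ?_⟩
    · rw [contDiff_infty_iff_deriv, hχ']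
      exact ⟨fun x => (hχd x).differentiableAt, hψc⟩
    · exact ⟨by linarith [hx.1], by linarith [hx.2]⟩
  have h0 := H χ htχ
  rw [hχ'] at h0
  have e1 : ∫ x in Ioo a b, ψ x • d x =
      (∫ x in Ioo a b, φ x • d x) - m • ∫ x in Ioo a b, φ₀ x • d x := by
    rw [← integral_smul]
    refine Eq.trans ?_ (integral_sub (hφ.integrable_mul hd) ((ht₀.integrable_mul hd).smul m))
    refine integral_congr_ae (Filter.Eventually.of_forall fun x => ?_)
    simp only [hψ, sub_smul, mul_smul]
  have e2 : m = ∫ x in Ioo a b, φ x := by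
    rw [hm]
    exact (setIntegral_eq_integral_of_forall_compl_eq_zero fun x hx => hφ.eq_zero hx).symm
  rw [h0] at e1
  rw [integral_smul_const, ← e2]
  exact (sub_eq_zero.1 e1.symm)

theorem intervalIntegral_eq_integral_indicator {g : ℝ → ℂ} {x : ℝ} (hx : x ∈ Ioo a b) :
    ∫ y in a..x, g y = ∫ y in Ioo a b, (Iic x).indicator g y := by
  rw [intervalIntegral.integral_of_le hx.1.le, setIntegral_indicator measurableSet_Iic]
  congr 2
  ext y
  simp only [mem_Ioc, mem_inter_iff, mem_Ioo, mem_Iic]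
  exact ⟨fun h => ⟨⟨h.1, h.2.trans_lt hx.2⟩, h.2⟩, fun h => ⟨h.1.1, h.2⟩⟩

/-- The weak derivative of a primitive of `g` is `g`. -/
theorem integral_deriv_smul_primitive {φ : ℝ → ℝ} (hφ : IsTestFunction a b φ) {g : ℝ → ℂ}
    (hg : IntegrableOn g (Ioo a b)) :
    ∫ x in Ioo a b, deriv φ x • ∫ y in a..x, g y = -∫ y in Ioo a b, φ y • g y := by
  have hφ' := hφ.deriv
  have e1 : ∫ x in Ioo a b, deriv φ x • ∫ y in a..x, g y =
      ∫ x in Ioo a b, ∫ y in Ioo a b, deriv φ x • (Iic x).indicator g y := by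
    refine setIntegral_congr_fun measurableSet_Ioo fun x hx => ?_
    rw [intervalIntegral_eq_integral_indicator hx, integral_smul]
  have hint : Integrable (Function.uncurry fun x y => deriv φ x • (Iic x).indicator g y)
      ((volume.restrict (Ioo a b)).prod (volume.restrict (Ioo a b))) := by
    have hd : Integrable (fun x => deriv φ x) (volume.restrict (Ioo a b)) :=
      (hφ'.1.continuous.integrable_of_hasCompactSupport hφ'.2.1).restrict
    have h1 : Integrable (fun p : ℝ × ℝ => deriv φ p.1 • g p.2)
        ((volume.restrict (Ioo a b)).prod (volume.restrict (Ioo a b))) := hd.smul_prod hg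
    have h2 := h1.indicator (s := {p : ℝ × ℝ | p.2 ≤ p.1})
      (measurableSet_le measurable_snd measurable_fst)
    refine h2.congr (Filter.Eventually.of_forall fun p => ?_)
    by_cases hp : p.2 ≤ p.1
    · simp [Function.uncurry, indicator, hp]
    · simp [Function.uncurry, indicator, hp]
  rw [e1, integral_integral_swap hint, ← integral_neg]
  refine setIntegral_congr_fun measurableSet_Ioo fun y hy => ?_
  have e2 : ∀ x, deriv φ x • (Iic x).indicator g y = (Ici y).indicator (deriv φ) x • g y := by
    intro x
    by_cases hxy : y ≤ x
    · simp [indicator, hxy]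
    · simp [indicator, hxy]
  simp only [e2]
  rw [integral_smul_const, setIntegral_indicator measurableSet_Ici]
  have e3 : Ioo a b ∩ Ici y = Ico y b := by
    ext x
    simp only [mem_Ico, mem_inter_iff, mem_Ioo, mem_Ici]
    exact ⟨fun h => ⟨h.2, h.1.2⟩, fun h => ⟨⟨hy.1.trans_le h.1, h.2⟩, h.1⟩⟩
  rw [e3, integral_Ico_eq_integral_Ioc, ← intervalIntegral.integral_of_le hy.2.le,
    intervalIntegral.integral_deriv_eq_sub
      (fun x _ => (hφ.1.differentiable (by simp)).differentiableAt)
      (hφ'.1.continuous.intervalIntegrable _ _),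
    hφ.eq_zero (x := b) (by simp), zero_sub, neg_smul]

theorem continuousOn_primitive (hab : a < b) {g : ℝ → ℂ} (hg : IntegrableOn g (Ioo a b)) :
    ContinuousOn (fun x => ∫ y in a..x, g y) (Icc a b) := by
  have := intervalIntegral.continuousOn_primitive_interval (μ := volume) (f := g) (a := a) (b := b)
    (by rw [uIcc_of_le hab.le]; exact (integrableOn_Icc_iff_integrableOn_Ioo (by simp) (by simp)).2 hg)
  rwa [uIcc_of_le hab.le] at this

/-- A function with an integrable weak derivative is a primitive of it. -/
theorem exists_ae_eq_const_add_primitive (hab : a < b) {f g : ℝ → ℂ}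
    (hf : IntegrableOn f (Ioo a b)) (hg : IntegrableOn g (Ioo a b))
    (H : ∀ φ : ℝ → ℝ, IsTestFunction a b φ →
      ∫ x in Ioo a b, deriv φ x • f x = -∫ x in Ioo a b, φ x • g x) :
    ∃ c : ℂ, f =ᵐ[volume.restrict (Ioo a b)] fun x => c + ∫ y in a..x, g y := by
  have hG : IntegrableOn (fun x => ∫ y in a..x, g y) (Ioo a b) := by
    exact (continuousOn_primitive hab hg).integrableOn_Icc.mono_set Ioo_subset_Icc_self
  obtain ⟨c, hc⟩ := exists_ae_eq_const_of_integral_deriv_smul_eq_zero hab (hf.sub hG)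
    fun φ hφ => by
      have hφ' := hφ.deriv
      simp only [Pi.sub_apply, smul_sub]
      rw [integral_sub (hφ'.integrable_mul hf) (hφ'.integrable_mul hG), H φ hφ,
        integral_deriv_smul_primitive hφ hg, sub_self]
  refine ⟨c, hc.mono fun x hx => ?_⟩
  simp only [Pi.sub_apply] at hx
  rw [← hx]; ring

end WeakDeriv

/-! ### Point values of Sobolev functions -/

section Value

variable {a b : ℝ} {m n : ℕ}

theorem eqOn_Icc_of_ae_eq_Ioo (hab : a < b) {f g : ℝ → ℂ}
    (h : f =ᵐ[volume.restrict (Ioo a b)] g) (hf : ContinuousOn f (Icc a b))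
    (hg : ContinuousOn g (Icc a b)) : EqOn f g (Icc a b) := by
  rw [restrict_Ioo_eq_restrict_Icc] at h
  exact Measure.eqOn_Icc_of_ae_eq _ hab.ne h hf hg

/-- The weak derivative of order `k` of an element of `H^m`, meaningful for `k ≤ m`. -/
noncomputable def Sobolev.comp (F : Sobolev a b m) (k : ℕ) : Lp ℂ 2 (volume.restrict (Ioo a b)) :=
  (F : L2Tuple a b m) (Fin.ofNat (m + 1) k)

/-- The value at `x` of the continuous representative of the weak derivative of order `k` of an
element of `H^m`, meaningful for `k < m` and `x ∈ [a, b]`. It is the primitive of the weak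
derivative of order `k + 1` with the right mean value. -/
noncomputable def Sobolev.value (F : Sobolev a b m) (k : ℕ) (x : ℝ) : ℂ :=
  (b - a)⁻¹ • (∫ y in Ioo a b, (Sobolev.comp F k y - ∫ z in a..y, Sobolev.comp F (k + 1) z)) +
    ∫ y in a..x, Sobolev.comp F (k + 1) y

theorem Sobolev.integrableOn_comp (F : Sobolev a b m) (k : ℕ) :
    IntegrableOn (Sobolev.comp F k) (Ioo a b) :=
  (Lp.memLp (Sobolev.comp F k)).integrable (by norm_num)

theorem Sobolev.isWeakDeriv_comp (F : Sobolev a b m) {k : ℕ} (hk : k ≤ m) :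
    IsWeakDeriv a b k (Sobolev.comp F 0) (Sobolev.comp F k) := by
  have h := F.2 (Fin.ofNat (m + 1) k)
  rw [Fin.val_ofNat, Nat.mod_eq_of_lt (by omega)] at h
  exact h

theorem Sobolev.integral_deriv_smul_comp (F : Sobolev a b m) {k : ℕ} (hk : k < m) {φ : ℝ → ℝ}
    (hφ : IsTestFunction a b φ) :
    ∫ x in Ioo a b, deriv φ x • Sobolev.comp F k x = -∫ x in Ioo a b, φ x • Sobolev.comp F (k + 1) x := by
  have h1 := Sobolev.isWeakDeriv_comp F hk.le (deriv φ) hφ.deriv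
  have h2 := Sobolev.isWeakDeriv_comp F (Nat.succ_le_of_lt hk) φ hφ
  rw [← iteratedDeriv_succ', h2, pow_succ, mul_smul] at h1
  have h3 := smul_right_injective ℂ (pow_ne_zero k (show (-1 : ℝ) ≠ 0 by norm_num)) h1
  rw [← h3]
  simp

theorem Sobolev.comp_ae_eq_value (F : Sobolev a b m) (hab : a < b) {k : ℕ} (hk : k < m) :
    Sobolev.comp F k =ᵐ[volume.restrict (Ioo a b)] Sobolev.value F k := by
  obtain ⟨c, hc⟩ := exists_ae_eq_const_add_primitive hab (Sobolev.integrableOn_comp F k)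
    (Sobolev.integrableOn_comp F (k + 1)) fun φ hφ => Sobolev.integral_deriv_smul_comp F hk hφ
  have e : ∫ y in Ioo a b, (Sobolev.comp F k y - ∫ z in a..y, Sobolev.comp F (k + 1) z) = (b - a) • c := by
    rw [integral_congr_ae (g := fun _ => c)]
    · simp [Measure.real, ENNReal.toReal_ofReal (sub_nonneg.2 hab.le)]
    · exact hc.mono fun x hx => by simp only [hx]; ring
  refine hc.mono fun x hx => ?_
  rw [hx, Sobolev.value, e, smul_smul, inv_mul_cancel₀ (sub_ne_zero.2 hab.ne'), one_smul]

theorem intervalIntegrable_of_integrableOn_Ioo {E : Type*} [NormedAddCommGroup E] {g : ℝ → E}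
    (hg : IntegrableOn g (Ioo a b)) {x y : ℝ} (hx : x ∈ Icc a b) (hy : y ∈ Icc a b) :
    IntervalIntegrable g volume x y := by
  have h : IntegrableOn g (Icc a b) := (integrableOn_Icc_iff_integrableOn_Ioo (by simp) (by simp)).2 hg
  rw [intervalIntegrable_iff]
  exact h.mono_set (uIoc_subset_uIcc.trans (uIcc_subset_Icc hx hy))

theorem Sobolev.value_sub (F : Sobolev a b m) (k : ℕ) {x y : ℝ} (hx : x ∈ Icc a b)
    (hy : y ∈ Icc a b) : Sobolev.value F k x - Sobolev.value F k y = ∫ z in y..x, Sobolev.comp F (k + 1) z := by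
  have ha : a ∈ Icc a b := ⟨le_rfl, hx.1.trans hx.2⟩
  have hi := Sobolev.integrableOn_comp F (k + 1)
  rw [Sobolev.value, Sobolev.value, add_sub_add_left_eq_sub,
    intervalIntegral.integral_interval_sub_left (intervalIntegrable_of_integrableOn_Ioo hi ha hx)
      (intervalIntegrable_of_integrableOn_Ioo hi ha hy)]

theorem Sobolev.continuousOn_value (F : Sobolev a b m) (hab : a < b) (k : ℕ) :
    ContinuousOn (Sobolev.value F k) (Icc a b) :=
  continuousOn_const.add (continuousOn_primitive hab (Sobolev.integrableOn_comp F (k + 1)))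

theorem Sobolev.hasDerivWithinAt_value (F : Sobolev a b m) (hab : a < b) {k : ℕ} (hk : k + 1 < m)
    {x : ℝ} (hx : x ∈ Icc a b) :
    HasDerivWithinAt (Sobolev.value F k) (Sobolev.value F (k + 1) x) (Icc a b) x := by
  have ha : a ∈ Icc a b := ⟨le_rfl, hab.le⟩
  have hc := Sobolev.continuousOn_value F hab (k + 1)
  have hi := (hc.integrableOn_Icc (μ := volume)).mono_set Ioo_subset_Icc_self
  have hae := Sobolev.comp_ae_eq_value F hab hk
  have : Fact (x ∈ Icc a b) := ⟨hx⟩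
  have h1 : HasDerivWithinAt (fun x => ∫ y in a..x, Sobolev.value F (k + 1) y) (Sobolev.value F (k + 1) x)
      (Icc a b) x :=
    intervalIntegral.integral_hasDerivWithinAt_right
      (intervalIntegrable_of_integrableOn_Ioo hi ha hx)
      (hc.stronglyMeasurableAtFilter_nhdsWithin measurableSet_Icc x) (hc x hx)
  have e : ∀ y ∈ Icc a b, Sobolev.value F k y = Sobolev.value F k a + ∫ z in a..y, Sobolev.value F (k + 1) z := by
    intro y hy
    have h2 := Sobolev.value_sub F k hy ha
    have h3 : ∫ z in a..y, Sobolev.comp F (k + 1) z = ∫ z in a..y, Sobolev.value F (k + 1) z := by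
      rw [intervalIntegral.integral_of_le hy.1, intervalIntegral.integral_of_le hy.1,
        integral_Ioc_eq_integral_Ioo, integral_Ioc_eq_integral_Ioo]
      exact integral_congr_ae (ae_restrict_of_ae_restrict_of_subset
        (Ioo_subset_Ioo_right hy.2) hae)
    rw [← h3, ← h2]; ring
  exact (h1.const_add (Sobolev.value F k a)).congr e (e x hx)

/-- Weak derivatives are unique. -/
theorem Sobolev.comp_eq_of_ae_eq (F : Sobolev a b m) (G : Sobolev a b n)
    (h : Sobolev.comp F 0 =ᵐ[volume.restrict (Ioo a b)] Sobolev.comp G 0) {k : ℕ} (hm : k ≤ m)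
    (hn : k ≤ n) : Sobolev.comp F k = Sobolev.comp G k := by
  refine Lp.ext (ae_eq_of_integral_test_eq (Sobolev.integrableOn_comp F k)
    (Sobolev.integrableOn_comp G k) fun φ hφ => ?_)
  have e1 := Sobolev.isWeakDeriv_comp F hm φ hφ
  have e2 := Sobolev.isWeakDeriv_comp G hn φ hφ
  have e3 : ∫ x in Ioo a b, iteratedDeriv k φ x • Sobolev.comp F 0 x =
      ∫ x in Ioo a b, iteratedDeriv k φ x • Sobolev.comp G 0 x :=
    integral_congr_ae (h.mono fun x hx => by simp only [hx])
  rw [e1, e2] at e3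
  exact smul_right_injective ℂ (pow_ne_zero k (show (-1 : ℝ) ≠ 0 by norm_num)) e3

/-- Point values only depend on the function, not on the order of the Sobolev space in which it is
considered. -/
theorem Sobolev.value_congr (F : Sobolev a b m) (hab : a < b) (G : Sobolev a b n)
    (h : Sobolev.comp F 0 =ᵐ[volume.restrict (Ioo a b)] Sobolev.comp G 0) {k : ℕ} (hm : k < m)
    (hn : k < n) {x : ℝ} (hx : x ∈ Icc a b) : Sobolev.value F k x = Sobolev.value G k x := by
  have h2 := (Sobolev.comp_ae_eq_value F hab hm).symm
  rw [Sobolev.comp_eq_of_ae_eq F G h hm.le hn.le] at h2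
  exact eqOn_Icc_of_ae_eq_Ioo hab (h2.trans (Sobolev.comp_ae_eq_value G hab hn))
    (Sobolev.continuousOn_value F hab k) (Sobolev.continuousOn_value G hab k) hx

theorem Sobolev.norm_sq_eq (F : Sobolev a b m) :
    ‖F‖ ^ 2 = ∑ k ∈ Finset.range (m + 1), ‖Sobolev.comp F k‖ ^ 2 := by
  change ‖(F : L2Tuple a b m)‖ ^ 2 = _
  rw [PiLp.norm_sq_eq_of_L2, Finset.sum_range]
  refine Finset.sum_congr rfl fun k _ => ?_
  rw [Sobolev.comp, Fin.ofNat_val_eq_self]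

theorem Sobolev.norm_le_norm_of_ae_eq (F : Sobolev a b m) (G : Sobolev a b n) (hmn : m ≤ n)
    (h : Sobolev.comp F 0 =ᵐ[volume.restrict (Ioo a b)] Sobolev.comp G 0) : ‖F‖ ≤ ‖G‖ := by
  refine abs_le_of_sq_le_sq' ?_ (norm_nonneg G) |>.2
  rw [Sobolev.norm_sq_eq, Sobolev.norm_sq_eq]
  have e : ∀ k ∈ Finset.range (m + 1), ‖Sobolev.comp F k‖ ^ 2 = ‖Sobolev.comp G k‖ ^ 2 := by
    intro k hk
    rw [Finset.mem_range] at hk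
    rw [Sobolev.comp_eq_of_ae_eq F G h (by omega) (by omega)]
  rw [Finset.sum_congr rfl e]
  exact Finset.sum_le_sum_of_subset_of_nonneg (Finset.range_mono (by omega))
    fun _ _ _ => by positivity

/-- A continuous function of class `H^m` agrees with the continuous representative. -/
theorem Sobolev.value_zero_eq (F : Sobolev a b m) (hab : a < b) (hm : 0 < m) {f : ℝ → ℂ}
    (hf : ContinuousOn f (Icc a b)) (h : Sobolev.comp F 0 =ᵐ[volume.restrict (Ioo a b)] f) {x : ℝ}
    (hx : x ∈ Icc a b) : Sobolev.value F 0 x = f x := by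
  have h2 := (Sobolev.comp_ae_eq_value F hab hm).symm.trans h
  exact eqOn_Icc_of_ae_eq_Ioo hab h2 (Sobolev.continuousOn_value F hab 0) hf hx

theorem Sobolev.value_add (hab : a < b) (F G : Sobolev a b m) {k : ℕ} (hk : k < m) {x : ℝ}
    (hx : x ∈ Icc a b) : Sobolev.value (F + G) k x = Sobolev.value F k x + Sobolev.value G k x := by
  have h1 := Lp.coeFn_add (Sobolev.comp F k) (Sobolev.comp G k)
  have h2 : Sobolev.value (F + G) k =ᵐ[volume.restrict (Ioo a b)] fun x => Sobolev.value F k x + Sobolev.value G k x := by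
    filter_upwards [Sobolev.comp_ae_eq_value (F + G) hab hk, Sobolev.comp_ae_eq_value F hab hk,
      Sobolev.comp_ae_eq_value G hab hk, h1] with x e1 e2 e3 e4
    rw [← e1, ← e2, ← e3]
    exact e4
  exact eqOn_Icc_of_ae_eq_Ioo hab h2 (Sobolev.continuousOn_value (F + G) hab k)
    ((Sobolev.continuousOn_value F hab k).add (Sobolev.continuousOn_value G hab k)) hx

theorem Sobolev.value_smul (hab : a < b) (c : ℝ) (F : Sobolev a b m) {k : ℕ} (hk : k < m) {x : ℝ}
    (hx : x ∈ Icc a b) : Sobolev.value (c • F) k x = c • Sobolev.value F k x := by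
  have h1 := Lp.coeFn_smul c (Sobolev.comp F k)
  have h2 : Sobolev.value (c • F) k =ᵐ[volume.restrict (Ioo a b)] fun x => c • Sobolev.value F k x := by
    filter_upwards [Sobolev.comp_ae_eq_value (c • F) hab hk, Sobolev.comp_ae_eq_value F hab hk, h1] with x e1 e2 e4
    rw [← e1, ← e2]
    exact e4
  exact eqOn_Icc_of_ae_eq_Ioo hab h2 (Sobolev.continuousOn_value (c • F) hab k)
    ((Sobolev.continuousOn_value F hab k).const_smul c) hx

end Value

/-! ### Bounds for point values

The constants do not depend on the length of the interval. -/

theorem sq_integral_norm_le {g : ℝ → ℂ} {c d : ℝ} (hcd : c ≤ d)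
    (hg : IntervalIntegrable g volume c d)
    (hg2 : IntervalIntegrable (fun x => ‖g x‖ ^ 2) volume c d) :
    (∫ x in c..d, ‖g x‖) ^ 2 ≤ (d - c) * ∫ x in c..d, ‖g x‖ ^ 2 := by
  rcases hcd.eq_or_lt with rfl | hlt
  · simp
  have hl : 0 < d - c := sub_pos.2 hlt
  set J := ∫ x in c..d, ‖g x‖ with hJ
  have h0 : 0 ≤ ∫ x in c..d, (‖g x‖ - J / (d - c)) ^ 2 :=
    intervalIntegral.integral_nonneg hcd fun x _ => sq_nonneg _
  have e : ∫ x in c..d, (‖g x‖ - J / (d - c)) ^ 2 =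
      (∫ x in c..d, ‖g x‖ ^ 2) - 2 * (J / (d - c)) * J + (d - c) * (J / (d - c)) ^ 2 := by
    have e1 : ∀ x, (‖g x‖ - J / (d - c)) ^ 2 =
        ‖g x‖ ^ 2 - 2 * (J / (d - c)) * ‖g x‖ + (J / (d - c)) ^ 2 := fun x => by ring
    simp only [e1]
    rw [intervalIntegral.integral_add (hg2.sub (hg.norm.const_mul _)) (by simp),
      intervalIntegral.integral_sub hg2 (hg.norm.const_mul _),
      intervalIntegral.integral_const_mul, intervalIntegral.integral_const, smul_eq_mul, ← hJ]
  rw [e] at h0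
  have e2 : (d - c) * ((∫ x in c..d, ‖g x‖ ^ 2) - 2 * (J / (d - c)) * J +
      (d - c) * (J / (d - c)) ^ 2) = (d - c) * (∫ x in c..d, ‖g x‖ ^ 2) - J ^ 2 := by
    field_simp; ring
  have := mul_nonneg hl.le h0
  linarith

section Bounds

variable {a b : ℝ} {m : ℕ}

theorem Sobolev.integrableOn_comp_sq (F : Sobolev a b m) (k : ℕ) :
    IntegrableOn (fun x => ‖Sobolev.comp F k x‖ ^ 2) (Ioo a b) :=
  (Lp.memLp (Sobolev.comp F k)).integrable_norm_pow (by norm_num)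

theorem Sobolev.intervalIntegrable_comp (F : Sobolev a b m) (k : ℕ) {x y : ℝ} (hx : x ∈ Icc a b)
    (hy : y ∈ Icc a b) : IntervalIntegrable (Sobolev.comp F k) volume x y :=
  intervalIntegrable_of_integrableOn_Ioo (Sobolev.integrableOn_comp F k) hx hy

theorem Sobolev.intervalIntegrable_comp_sq (F : Sobolev a b m) (k : ℕ) {x y : ℝ} (hx : x ∈ Icc a b)
    (hy : y ∈ Icc a b) : IntervalIntegrable (fun x => ‖Sobolev.comp F k x‖ ^ 2) volume x y :=
  intervalIntegrable_of_integrableOn_Ioo (Sobolev.integrableOn_comp_sq F k) hx hy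

theorem Sobolev.integral_comp_sq_le (F : Sobolev a b m) (hab : a ≤ b) (k : ℕ) :
    ∫ x in a..b, ‖Sobolev.comp F k x‖ ^ 2 ≤ ‖F‖ ^ 2 := by
  have h1 : ‖Sobolev.comp F k‖ ≤ ‖F‖ := PiLp.norm_apply_le (F : L2Tuple a b m) (Fin.ofNat (m + 1) k)
  have h2 : ∫ x in a..b, ‖Sobolev.comp F k x‖ ^ 2 = ‖Sobolev.comp F k‖ ^ 2 := by
    have h3 := L2.inner_def (𝕜 := ℂ) (Sobolev.comp F k) (Sobolev.comp F k)
    rw [inner_self_eq_norm_sq_to_K] at h3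
    simp only [inner_self_eq_norm_sq_to_K] at h3
    rw [intervalIntegral.integral_of_le hab, integral_Ioc_eq_integral_Ioo]
    have h4 : ∫ x in Ioo a b, ((‖Sobolev.comp F k x‖ : ℂ) ^ 2) =
        ((∫ x in Ioo a b, ‖Sobolev.comp F k x‖ ^ 2 : ℝ) : ℂ) := by
      rw [← integral_complex_ofReal]
      simp
    have h5 : ((‖Sobolev.comp F k‖ ^ 2 : ℝ) : ℂ) = ((∫ x in Ioo a b, ‖Sobolev.comp F k x‖ ^ 2 : ℝ) : ℂ) := by
      rw [← h4]; push_cast; exact h3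
    exact_mod_cast h5.symm
  rw [h2]
  gcongr

theorem Sobolev.norm_value_sub_le (F : Sobolev a b m) (k : ℕ) {c d x y : ℝ} (hc : a ≤ c)
    (hd : d ≤ b) (hx : x ∈ Icc c d) (hy : y ∈ Icc c d) :
    ‖Sobolev.value F k x - Sobolev.value F k y‖ ≤ ∫ z in c..d, ‖Sobolev.comp F (k + 1) z‖ := by
  have hcd : c ≤ d := hx.1.trans hx.2
  have hx' : x ∈ Icc a b := ⟨hc.trans hx.1, hx.2.trans hd⟩
  have hy' : y ∈ Icc a b := ⟨hc.trans hy.1, hy.2.trans hd⟩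
  rw [Sobolev.value_sub F k hx' hy']
  refine (intervalIntegral.norm_integral_le_abs_integral_norm).trans ?_
  rw [intervalIntegral.abs_integral_eq_abs_integral_uIoc, abs_of_nonneg
    (integral_nonneg fun z => norm_nonneg _), intervalIntegral.integral_of_le hcd]
  refine setIntegral_mono_set ?_ (Filter.Eventually.of_forall fun z => norm_nonneg _) ?_
  · exact ((Sobolev.intervalIntegrable_comp F (k + 1) ⟨hc, hcd.trans hd⟩ ⟨hc.trans hcd, hd⟩).norm).1
  · refine Filter.Eventually.of_forall fun z hz => ?_
    rcases le_total y x with h | h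
    · rw [uIoc_of_le h] at hz; exact ⟨hy.1.trans_lt hz.1, hz.2.trans hx.2⟩
    · rw [uIoc_of_ge h] at hz; exact ⟨hx.1.trans_lt hz.1, hz.2.trans hy.2⟩

/-- The one-dimensional Sobolev inequality on a subinterval, with explicit dependence on its
length. -/
theorem Sobolev.mul_norm_value_sq_le (F : Sobolev a b m) (hab : a < b) {k : ℕ} (hk : k < m)
    {c d x : ℝ} (hc : a ≤ c) (hd : d ≤ b) (hx : x ∈ Icc c d) :
    (d - c) * ‖Sobolev.value F k x‖ ^ 2 ≤ 2 * (∫ y in c..d, ‖Sobolev.comp F k y‖ ^ 2) +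
      2 * (d - c) ^ 2 * ∫ y in c..d, ‖Sobolev.comp F (k + 1) y‖ ^ 2 := by
  have hcd : c ≤ d := hx.1.trans hx.2
  have hc' : c ∈ Icc a b := ⟨hc, hcd.trans hd⟩
  have hd' : d ∈ Icc a b := ⟨hc.trans hcd, hd⟩
  set J := ∫ z in c..d, ‖Sobolev.comp F (k + 1) z‖ with hJ
  have hJ2 : J ^ 2 ≤ (d - c) * ∫ y in c..d, ‖Sobolev.comp F (k + 1) y‖ ^ 2 :=
    sq_integral_norm_le hcd (Sobolev.intervalIntegrable_comp F _ hc' hd')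
      (Sobolev.intervalIntegrable_comp_sq F _ hc' hd')
  have hpt : ∀ y ∈ Icc c d, ‖Sobolev.value F k x‖ ^ 2 ≤ 2 * ‖Sobolev.value F k y‖ ^ 2 + 2 * J ^ 2 := by
    intro y hy
    have h1 := Sobolev.norm_value_sub_le F k hc hd hx hy
    have h2 : ‖Sobolev.value F k x‖ ≤ ‖Sobolev.value F k y‖ + J := by
      have := norm_sub_norm_le (Sobolev.value F k x) (Sobolev.value F k y); linarith
    have h3 := pow_le_pow_left₀ (norm_nonneg _) h2 2
    nlinarith [sq_nonneg (‖Sobolev.value F k y‖ - J)]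
  have hcont : ContinuousOn (fun y => ‖Sobolev.value F k y‖ ^ 2) (uIcc c d) := by
    rw [uIcc_of_le hcd]
    exact ((Sobolev.continuousOn_value F hab k).mono (Icc_subset_Icc hc hd)).norm.pow 2
  have h1 : ∫ y in c..d, ‖Sobolev.value F k x‖ ^ 2 ≤ ∫ y in c..d, (2 * ‖Sobolev.value F k y‖ ^ 2 + 2 * J ^ 2) :=
    intervalIntegral.integral_mono_on hcd (by simp)
      ((hcont.intervalIntegrable.const_mul 2).add (by simp)) hpt
  rw [intervalIntegral.integral_add (hcont.intervalIntegrable.const_mul 2) (by simp),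
    intervalIntegral.integral_const_mul, intervalIntegral.integral_const,
    intervalIntegral.integral_const, smul_eq_mul, smul_eq_mul] at h1
  have h2 : ∫ y in c..d, ‖Sobolev.value F k y‖ ^ 2 = ∫ y in c..d, ‖Sobolev.comp F k y‖ ^ 2 := by
    rw [intervalIntegral.integral_of_le hcd, intervalIntegral.integral_of_le hcd,
      integral_Ioc_eq_integral_Ioo, integral_Ioc_eq_integral_Ioo]
    refine integral_congr_ae ((ae_restrict_of_ae_restrict_of_subset
        (Ioo_subset_Ioo hc hd) (Sobolev.comp_ae_eq_value F hab hk)).mono fun y hy => ?_)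
    simp only [hy]
  rw [h2] at h1
  have h3 := mul_le_mul_of_nonneg_left hJ2 (sub_nonneg.2 hcd)
  nlinarith

theorem integral_subinterval_le {e : ℝ → ℝ} (he : IntegrableOn e (Ioo a b)) (he0 : ∀ x, 0 ≤ e x)
    {c d : ℝ} (hc : a ≤ c) (hcd : c ≤ d) (hd : d ≤ b) : ∫ x in c..d, e x ≤ ∫ x in a..b, e x := by
  have ha' : a ∈ Icc a b := ⟨le_rfl, hc.trans (hcd.trans hd)⟩
  have hb' : b ∈ Icc a b := ⟨hc.trans (hcd.trans hd), le_rfl⟩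
  exact intervalIntegral.integral_mono_interval hc hcd hd
    (Filter.Eventually.of_forall he0) (intervalIntegrable_of_integrableOn_Ioo he ha' hb')

/-- Evaluation of a derivative at a point, as a continuous linear functional on `H^m`. -/
noncomputable def valueCLM (hab : a < b) {k : ℕ} (hk : k < m) {x : ℝ} (hx : x ∈ Icc a b) :
    Sobolev a b m →L[ℝ] ℂ :=
  LinearMap.mkContinuous
    { toFun := fun F => Sobolev.value F k x
      map_add' := fun F G => Sobolev.value_add hab F G hk hx
      map_smul' := fun c F => Sobolev.value_smul hab c F hk hx }
    (√((2 + 2 * (b - a) ^ 2) / (b - a))) fun F => by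
      have h1 := Sobolev.mul_norm_value_sq_le F hab hk le_rfl le_rfl hx
      have h2 := Sobolev.integral_comp_sq_le F hab.le k
      have h3 := Sobolev.integral_comp_sq_le F hab.le (k + 1)
      have hl : 0 < b - a := sub_pos.2 hab
      change ‖Sobolev.value F k x‖ ≤ _
      rw [← Real.sqrt_sq (norm_nonneg F), ← Real.sqrt_mul (by positivity)]
      refine Real.le_sqrt_of_sq_le ?_
      rw [div_mul_eq_mul_div, le_div_iff₀ hl]
      nlinarith [mul_le_mul_of_nonneg_left h3 (show 0 ≤ 2 * (b - a) ^ 2 by positivity)]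

@[simp]
theorem valueCLM_apply (hab : a < b) {k : ℕ} (hk : k < m) {x : ℝ} (hx : x ∈ Icc a b)
    (F : Sobolev a b m) : valueCLM hab hk hx F = Sobolev.value F k x := rfl

/-- A function whose mean value vanishes, or which has a zero, is bounded by its `H¹` norm,
regardless of the length of the interval: long intervals are shortened to length one, and on short
ones the oscillation controls the function. -/
theorem Sobolev.norm_value_le (F : Sobolev a b m) (hab : a < b) {k : ℕ} (hk : k < m) {x : ℝ}
    (hx : x ∈ Icc a b)
    (h : (∃ y ∈ Icc a b, Sobolev.value F k y = 0) ∨ ∫ y in a..b, Sobolev.value F k y = 0) :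
    ‖Sobolev.value F k x‖ ≤ 2 * ‖F‖ := by
  have hn := norm_nonneg F
  have hk1 := Sobolev.integral_comp_sq_le F hab.le (k + 1)
  have hk0 := Sobolev.integral_comp_sq_le F hab.le k
  rcases le_or_gt (b - a) 1 with hl | hl
  · have hJ2 := sq_integral_norm_le hab.le
      (Sobolev.intervalIntegrable_comp F (k + 1) (left_mem_Icc.2 hab.le) (right_mem_Icc.2 hab.le))
      (Sobolev.intervalIntegrable_comp_sq F (k + 1) (left_mem_Icc.2 hab.le) (right_mem_Icc.2 hab.le))
    set J := ∫ z in a..b, ‖Sobolev.comp F (k + 1) z‖ with hJ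
    have hJ0 : 0 ≤ J := intervalIntegral.integral_nonneg hab.le fun _ _ => norm_nonneg _
    have hJF : J ≤ ‖F‖ := by
      refine abs_le_of_sq_le_sq' ?_ hn |>.2
      have h0 : 0 ≤ ∫ y in a..b, ‖Sobolev.comp F (k + 1) y‖ ^ 2 :=
        intervalIntegral.integral_nonneg hab.le fun _ _ => by positivity
      nlinarith
    have hdiff : ∀ y ∈ Icc a b, ‖Sobolev.value F k x - Sobolev.value F k y‖ ≤ J :=
      fun y hy => Sobolev.norm_value_sub_le F k le_rfl le_rfl hx hy
    rcases h with ⟨y, hy, h0⟩ | h0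
    · have := hdiff y hy
      rw [h0, sub_zero] at this
      linarith
    · have hi : IntervalIntegrable (Sobolev.value F k) volume a b :=
        ContinuousOn.intervalIntegrable (by
          rw [uIcc_of_le hab.le]; exact Sobolev.continuousOn_value F hab k)
      have e : ∫ y in a..b, (Sobolev.value F k x - Sobolev.value F k y) = (b - a) • Sobolev.value F k x := by
        rw [intervalIntegral.integral_sub (by simp) hi, h0, intervalIntegral.integral_const,
          sub_zero]
      have h2 := intervalIntegral.norm_integral_le_of_norm_le_const (a := a) (b := b)
        (f := fun y => Sobolev.value F k x - Sobolev.value F k y) (C := J) fun y hy => by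
          rw [uIoc_of_le hab.le] at hy
          exact hdiff y ⟨hy.1.le, hy.2⟩
      rw [e, norm_smul, Real.norm_eq_abs, mul_comm] at h2
      have := le_of_mul_le_mul_right h2 (abs_pos.2 (sub_ne_zero.2 hab.ne'))
      linarith
  · obtain ⟨c, hc, hcb, hxc⟩ : ∃ c, a ≤ c ∧ c + 1 ≤ b ∧ x ∈ Icc c (c + 1) := by
      rcases le_total (x + 1) b with h1 | h1
      · exact ⟨x, hx.1, h1, le_rfl, by linarith⟩
      · exact ⟨b - 1, by linarith, by linarith, by linarith, by linarith [hx.2]⟩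
    have h1 := Sobolev.mul_norm_value_sq_le F hab hk hc hcb hxc
    have h2 := (integral_subinterval_le (Sobolev.integrableOn_comp_sq F k) (fun _ => by positivity) hc
      (by linarith) hcb).trans hk0
    have h3 := (integral_subinterval_le (Sobolev.integrableOn_comp_sq F (k + 1)) (fun _ => by positivity) hc
      (by linarith) hcb).trans hk1
    rw [add_sub_cancel_left] at h1
    refine abs_le_of_sq_le_sq' ?_ (by positivity) |>.2
    nlinarith

end Bounds

/-! ### Second-order Taylor estimates in normed spaces -/

section Taylor

variable {E : Type*} [NormedAddCommGroup E] [NormedSpace ℝ E]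

theorem norm_le_mul_of_deriv {p p₁ : ℝ → E} {h B : ℝ}
    (hp : ∀ s ∈ Icc 0 h, HasDerivWithinAt p (p₁ s) (Icc 0 h) s) (h0 : p 0 = 0)
    (hB : ∀ s ∈ Icc 0 h, ‖p₁ s‖ ≤ B) {s : ℝ} (hs : s ∈ Icc 0 h) : ‖p s‖ ≤ B * s := by
  have := norm_image_sub_le_of_norm_deriv_le_segment' hp
    (fun x hx => hB x ⟨hx.1, hx.2.le⟩) s hs
  rwa [h0, sub_zero, sub_zero] at this

theorem norm_le_mul_sq_of_second_deriv {p p₁ p₂ : ℝ → E} {h B : ℝ}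
    (hp : ∀ s ∈ Icc 0 h, HasDerivWithinAt p (p₁ s) (Icc 0 h) s)
    (hp₁ : ∀ s ∈ Icc 0 h, HasDerivWithinAt p₁ (p₂ s) (Icc 0 h) s) (h0 : p 0 = 0) (h1 : p₁ 0 = 0)
    (hB : ∀ s ∈ Icc 0 h, ‖p₂ s‖ ≤ B) {s : ℝ} (hs : s ∈ Icc 0 h) : ‖p s‖ ≤ B * s ^ 2 := by
  have hB0 : 0 ≤ B := (norm_nonneg _).trans (hB s hs)
  have hsub : Icc 0 s ⊆ Icc 0 h := Icc_subset_Icc_right hs.2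
  have := norm_le_mul_of_deriv (p := p) (p₁ := p₁) (h := s) (B := B * s)
    (fun t ht => (hp t (hsub ht)).mono hsub) h0
    (fun t ht => (norm_le_mul_of_deriv hp₁ h1 hB (hsub ht)).trans
      (mul_le_mul_of_nonneg_left ht.2 hB0)) (right_mem_Icc.2 hs.1)
  rwa [mul_assoc, ← sq] at this

theorem hasDerivWithinAt_add_left {f f₁ : ℝ → E} {x h : ℝ}
    (hf : ∀ y ∈ Icc (x - h) (x + h), HasDerivWithinAt f (f₁ y) (Icc (x - h) (x + h)) y) {s : ℝ}
    (hs : s ∈ Icc 0 h) : HasDerivWithinAt (fun s => f (x + s)) (f₁ (x + s)) (Icc 0 h) s := by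
  have h1 : HasDerivWithinAt (fun s => x + s) 1 (Icc 0 h) s :=
    ((hasDerivAt_id s).const_add x).hasDerivWithinAt
  have h2 := (hf (x + s) ⟨by linarith [hs.1, hs.2], by linarith [hs.2]⟩).scomp s h1
    (fun t ht => ⟨by linarith [ht.1, ht.2], by linarith [ht.2]⟩)
  simpa [Function.comp_def] using h2

theorem hasDerivWithinAt_sub_left {f f₁ : ℝ → E} {x h : ℝ}
    (hf : ∀ y ∈ Icc (x - h) (x + h), HasDerivWithinAt f (f₁ y) (Icc (x - h) (x + h)) y) {s : ℝ}
    (hs : s ∈ Icc 0 h) : HasDerivWithinAt (fun s => f (x - s)) (-f₁ (x - s)) (Icc 0 h) s := by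
  have h1 : HasDerivWithinAt (fun s => x - s) (-1) (Icc 0 h) s :=
    ((hasDerivAt_id s).const_sub x).hasDerivWithinAt
  have h2 := (hf (x - s) ⟨by linarith [hs.2], by linarith [hs.1, hs.2]⟩).scomp s h1
    (fun t ht => ⟨by linarith [ht.2], by linarith [ht.1, ht.2]⟩)
  simpa [Function.comp_def] using h2

/-- Comparison of the symmetric sum `f (x + s) + f (x - s)` with an approximation `r s`. -/
theorem norm_symm_sum_sub_le {f f₁ f₂ r r₁ r₂ : ℝ → E} {x h B : ℝ}
    (hf : ∀ y ∈ Icc (x - h) (x + h), HasDerivWithinAt f (f₁ y) (Icc (x - h) (x + h)) y)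
    (hf₁ : ∀ y ∈ Icc (x - h) (x + h), HasDerivWithinAt f₁ (f₂ y) (Icc (x - h) (x + h)) y)
    (hr : ∀ s, HasDerivAt r (r₁ s) s) (hr₁ : ∀ s, HasDerivAt r₁ (r₂ s) s)
    (h0 : r 0 = f x + f x) (h1 : r₁ 0 = 0)
    (hB : ∀ s ∈ Icc 0 h, ‖f₂ (x + s) + f₂ (x - s) - r₂ s‖ ≤ B) {s : ℝ} (hs : s ∈ Icc 0 h) :
    ‖f (x + s) + f (x - s) - r s‖ ≤ B * s ^ 2 := by
  refine norm_le_mul_sq_of_second_deriv (p := fun s => f (x + s) + f (x - s) - r s)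
    (p₁ := fun s => f₁ (x + s) - f₁ (x - s) - r₁ s)
    (p₂ := fun s => f₂ (x + s) + f₂ (x - s) - r₂ s) (fun t ht => ?_) (fun t ht => ?_) ?_ ?_ hB hs
  · have := ((hasDerivWithinAt_add_left hf ht).add (hasDerivWithinAt_sub_left hf ht)).sub
      (hr t).hasDerivWithinAt
    rwa [← sub_eq_add_neg] at this
  · have := ((hasDerivWithinAt_add_left hf₁ ht).sub (hasDerivWithinAt_sub_left hf₁ ht)).sub
      (hr₁ t).hasDerivWithinAt
    rwa [sub_neg_eq_add] at this
  · simp [h0]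
  · simp [h1]

/-- Second-order accuracy of the average of two symmetric values. -/
theorem norm_symm_sum_sub_two_smul_le {f f₁ f₂ : ℝ → E} {x h B : ℝ} (hh : 0 ≤ h)
    (hf : ∀ y ∈ Icc (x - h) (x + h), HasDerivWithinAt f (f₁ y) (Icc (x - h) (x + h)) y)
    (hf₁ : ∀ y ∈ Icc (x - h) (x + h), HasDerivWithinAt f₁ (f₂ y) (Icc (x - h) (x + h)) y)
    (hB : ∀ y ∈ Icc (x - h) (x + h), ‖f₂ y‖ ≤ B) :
    ‖f (x + h) + f (x - h) - (f x + f x)‖ ≤ 2 * B * h ^ 2 := by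
  refine norm_symm_sum_sub_le (r := fun _ => f x + f x) (r₁ := fun _ => 0) (r₂ := fun _ => 0)
    hf hf₁ (fun s => hasDerivAt_const _ _) (fun s => hasDerivAt_const _ _) rfl rfl (fun s hs => ?_)
    (right_mem_Icc.2 hh)
  rw [sub_zero]
  have h1 := hB (x + s) ⟨by linarith [hs.1, hs.2], by linarith [hs.2]⟩
  have h2 := hB (x - s) ⟨by linarith [hs.2], by linarith [hs.1, hs.2]⟩
  calc _ ≤ _ := norm_add_le _ _
    _ ≤ _ := by linarith

/-- Second-order accuracy of the centred difference quotient. -/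
theorem norm_centred_diff_sub_le {f f₁ f₂ f₃ : ℝ → E} {x h B : ℝ} (hh : 0 ≤ h)
    (hf : ∀ y ∈ Icc (x - h) (x + h), HasDerivWithinAt f (f₁ y) (Icc (x - h) (x + h)) y)
    (hf₁ : ∀ y ∈ Icc (x - h) (x + h), HasDerivWithinAt f₁ (f₂ y) (Icc (x - h) (x + h)) y)
    (hf₂ : ∀ y ∈ Icc (x - h) (x + h), HasDerivWithinAt f₂ (f₃ y) (Icc (x - h) (x + h)) y)
    (hB : ∀ y ∈ Icc (x - h) (x + h), ‖f₃ y‖ ≤ B) :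
    ‖f (x + h) - f (x - h) - (2 * h) • f₁ x‖ ≤ 2 * B * h ^ 3 := by
  have hB0 : 0 ≤ B := (norm_nonneg _).trans (hB x ⟨by linarith, by linarith⟩)
  have := norm_le_mul_of_deriv (p := fun s => f (x + s) - f (x - s) - (2 * s) • f₁ x)
    (p₁ := fun s => f₁ (x + s) + f₁ (x - s) - (f₁ x + f₁ x)) (h := h) (B := 2 * B * h ^ 2)
    (fun s hs => ?_) (by simp) (fun s hs => ?_) (right_mem_Icc.2 hh)
  · calc _ ≤ _ := this
      _ = _ := by ring
  · have h1 : HasDerivWithinAt (fun s : ℝ => (2 * s) • f₁ x) (f₁ x + f₁ x) (Icc 0 h) s := by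
      have := (((hasDerivAt_id s).const_mul 2).smul_const (f₁ x)).hasDerivWithinAt (s := Icc 0 h)
      simpa [two_smul] using this
    have h2 := ((hasDerivWithinAt_add_left hf hs).sub (hasDerivWithinAt_sub_left hf hs)).sub h1
    rwa [sub_neg_eq_add] at h2
  · have hsub : Icc (x - s) (x + s) ⊆ Icc (x - h) (x + h) :=
      Icc_subset_Icc (by linarith [hs.2]) (by linarith [hs.2])
    refine (norm_symm_sum_sub_two_smul_le hs.1 (fun y hy => (hf₁ y (hsub hy)).mono hsub)
      (fun y hy => (hf₂ y (hsub hy)).mono hsub) (fun y hy => hB y (hsub hy))).trans ?_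
    have := hs.1
    have := hs.2
    gcongr

end Taylor

/-! ### Grid functions sampled from Sobolev functions -/

section Grid

variable {a b : ℝ} {M m : ℕ}

theorem mesh_pos (hab : a < b) (hM : 1 ≤ M) : 0 < mesh a b M :=
  div_pos (sub_pos.2 hab) (by exact_mod_cast hM)

theorem gridPt_zero : gridPt a b M 0 = a := by simp [gridPt]

theorem gridPt_last (hM : 1 ≤ M) : gridPt a b M M = b := by
  have : (M : ℝ) ≠ 0 := by positivity
  rw [gridPt, mesh]; field_simp; ring

theorem gridPt_succ (j : ℕ) : gridPt a b M (j + 1) = gridPt a b M j + mesh a b M := by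
  simp only [gridPt]; push_cast; ring

theorem gridPt_mono (hab : a < b) (hM : 1 ≤ M) {i j : ℕ} (hij : i ≤ j) :
    gridPt a b M i ≤ gridPt a b M j := by
  have := mesh_pos hab hM
  have : (i : ℝ) ≤ j := by exact_mod_cast hij
  unfold gridPt
  gcongr

theorem gridPt_mem (hab : a < b) (hM : 1 ≤ M) {j : ℕ} (hj : j ≤ M) :
    gridPt a b M j ∈ Icc a b := by
  constructor
  · exact gridPt_zero.symm.le.trans (gridPt_mono hab hM (Nat.zero_le j))
  · exact (gridPt_mono hab hM hj).trans (gridPt_last hM).le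

theorem gridPt_mem_Ioo (hab : a < b) (hM : 1 ≤ M) {j : ℕ} (hj : j ∈ Finset.Icc 1 (M - 1)) :
    gridPt a b M j ∈ Ioo a b := by
  rw [Finset.mem_Icc] at hj
  have hh := mesh_pos hab hM
  constructor
  · have := (gridPt_mem hab hM (j := j - 1) (by omega)).1
    have h2 := gridPt_succ (a := a) (b := b) (M := M) (j - 1)
    rw [Nat.sub_add_cancel hj.1] at h2
    linarith
  · have := (gridPt_mem hab hM (j := j + 1) (by omega)).2
    have h2 := gridPt_succ (a := a) (b := b) (M := M) j
    linarith

theorem sum_integral_cells (hab : a < b) (hM : 1 ≤ M) {e : ℝ → ℝ} (he : IntegrableOn e (Ioo a b)) :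
    ∑ j ∈ Finset.range M, ∫ x in gridPt a b M j..gridPt a b M (j + 1), e x = ∫ x in a..b, e x := by
  rw [intervalIntegral.sum_integral_adjacent_intervals, gridPt_zero, gridPt_last hM]
  intro k hk
  exact intervalIntegrable_of_integrableOn_Ioo he (gridPt_mem hab hM hk.le)
    (gridPt_mem hab hM hk)

theorem integral_cell_nonneg (hab : a < b) (hM : 1 ≤ M) {e : ℝ → ℝ} (he : ∀ x, 0 ≤ e x) (j : ℕ) :
    0 ≤ ∫ x in gridPt a b M j..gridPt a b M (j + 1), e x :=
  intervalIntegral.integral_nonneg (gridPt_mono hab hM j.le_succ) fun x _ => he x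

theorem sum_integral_double_cells_le (hab : a < b) (hM : 1 ≤ M) {e : ℝ → ℝ}
    (he : IntegrableOn e (Ioo a b)) (he0 : ∀ x, 0 ≤ e x) :
    ∑ j ∈ Finset.Icc 1 (M - 1), ∫ x in gridPt a b M (j - 1)..gridPt a b M (j + 1), e x ≤
      2 * ∫ x in a..b, e x := by
  obtain ⟨n, rfl⟩ : ∃ n, M = n + 1 := ⟨M - 1, by omega⟩
  rw [sum_Icc_pred_eq_sum_range, ← sum_integral_cells hab hM he]
  set c : ℕ → ℝ := fun j => ∫ x in gridPt a b (n + 1) j..gridPt a b (n + 1) (j + 1), e x with hc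
  have hc0 : ∀ j, 0 ≤ c j := integral_cell_nonneg hab hM he0
  have e1 : ∀ j ∈ Finset.range n, ∫ x in gridPt a b (n + 1) (j + 1 - 1)..gridPt a b (n + 1)
      (j + 1 + 1), e x = c j + c (j + 1) := by
    intro j hj
    rw [Finset.mem_range] at hj
    rw [Nat.add_sub_cancel, hc]
    refine (intervalIntegral.integral_add_adjacent_intervals ?_ ?_).symm
    · exact intervalIntegrable_of_integrableOn_Ioo he (gridPt_mem hab hM (by omega))
        (gridPt_mem hab hM (by omega))
    · exact intervalIntegrable_of_integrableOn_Ioo he (gridPt_mem hab hM (by omega))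
        (gridPt_mem hab hM (by omega))
  rw [Finset.sum_congr rfl e1, Finset.sum_add_distrib]
  have e2 := Finset.sum_range_succ c n
  have e3 := Finset.sum_range_succ' c n
  have := hc0 n
  have := hc0 0
  linarith

theorem gridL2_value_le (F : Sobolev a b m) (hab : a < b) {k : ℕ} (hk : k < m) (hM : 1 ≤ M)
    (hh1 : mesh a b M ≤ 1) :
    gridL2 (mesh a b M) M (fun j => Sobolev.value F k (gridPt a b M j)) ≤ 2 * ‖F‖ := by
  have hh := mesh_pos hab hM
  have hn := norm_nonneg F
  refine Real.sqrt_le_iff.2 ⟨by positivity, ?_⟩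
  set h := mesh a b M with hdef
  have i0 := Sobolev.integrableOn_comp_sq F k
  have i1 := Sobolev.integrableOn_comp_sq F (k + 1)
  have step : ∀ j ∈ Finset.range M, h * ‖Sobolev.value F k (gridPt a b M j)‖ ^ 2 ≤
      2 * (∫ y in gridPt a b M j..gridPt a b M (j + 1), ‖Sobolev.comp F k y‖ ^ 2) +
      2 * h ^ 2 * ∫ y in gridPt a b M j..gridPt a b M (j + 1), ‖Sobolev.comp F (k + 1) y‖ ^ 2 := by
    intro j hj
    rw [Finset.mem_range] at hj
    have h1 := Sobolev.mul_norm_value_sq_le F hab hk (gridPt_mem hab hM hj.le).1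
      (gridPt_mem hab hM hj).2 (left_mem_Icc.2 (gridPt_mono hab hM j.le_succ))
    rwa [gridPt_succ, add_sub_cancel_left, ← gridPt_succ, ← hdef] at h1
  rw [Finset.mul_sum]
  calc _ ≤ ∑ j ∈ Finset.range M, h * ‖Sobolev.value F k (gridPt a b M j)‖ ^ 2 := by
        refine Finset.sum_le_sum_of_subset_of_nonneg (fun j hj => ?_) fun j _ _ => by positivity
        rw [Finset.mem_Icc] at hj
        rw [Finset.mem_range]; omega
    _ ≤ _ := Finset.sum_le_sum step
    _ = 2 * (∫ y in a..b, ‖Sobolev.comp F k y‖ ^ 2) +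
        2 * h ^ 2 * ∫ y in a..b, ‖Sobolev.comp F (k + 1) y‖ ^ 2 := by
        rw [Finset.sum_add_distrib, ← Finset.mul_sum, ← Finset.mul_sum,
          sum_integral_cells hab hM i0, sum_integral_cells hab hM i1]
    _ ≤ 2 * ‖F‖ ^ 2 + 2 * 1 ^ 2 * ‖F‖ ^ 2 := by
        have := Sobolev.integral_comp_sq_le F hab.le k
        have := Sobolev.integral_comp_sq_le F hab.le (k + 1)
        have : 0 ≤ ∫ y in a..b, ‖Sobolev.comp F (k + 1) y‖ ^ 2 :=
          intervalIntegral.integral_nonneg hab.le fun _ _ => by positivity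
        gcongr
    _ = _ := by ring

theorem gridH1Semi_value_le (F : Sobolev a b m) (hab : a < b) (k : ℕ) (hM : 1 ≤ M) :
    gridH1Semi (mesh a b M) M (fun j => Sobolev.value F k (gridPt a b M j)) ≤ ‖F‖ := by
  have hh := mesh_pos hab hM
  have hn := norm_nonneg F
  refine Real.sqrt_le_iff.2 ⟨hn, ?_⟩
  set h := mesh a b M with hdef
  have i1 := Sobolev.integrableOn_comp_sq F (k + 1)
  have step : ∀ j ∈ Finset.range M,
      h * ‖dxPlus h (fun j => Sobolev.value F k (gridPt a b M j)) j‖ ^ 2 ≤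
      ∫ y in gridPt a b M j..gridPt a b M (j + 1), ‖Sobolev.comp F (k + 1) y‖ ^ 2 := by
    intro j hj
    rw [Finset.mem_range] at hj
    have m0 := gridPt_mem hab hM hj.le
    have m1 := gridPt_mem hab hM (Nat.succ_le_of_lt hj)
    have hle := gridPt_mono hab hM j.le_succ
    have h1 := Sobolev.norm_value_sub_le F k m0.1 m1.2 (right_mem_Icc.2 hle) (left_mem_Icc.2 hle)
    have h2 := sq_integral_norm_le hle (Sobolev.intervalIntegrable_comp F (k + 1) m0 m1)
      (Sobolev.intervalIntegrable_comp_sq F (k + 1) m0 m1)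
    have h3 := (pow_le_pow_left₀ (norm_nonneg _) h1 2).trans h2
    rw [Nat.succ_eq_add_one, gridPt_succ, add_sub_cancel_left, ← gridPt_succ, ← hdef] at h3
    rw [dxPlus, norm_div, Complex.norm_real, Real.norm_of_nonneg hh.le, div_pow]
    have e : h * (‖Sobolev.value F k (gridPt a b M (j + 1)) -
        Sobolev.value F k (gridPt a b M j)‖ ^ 2 / h ^ 2) =
        ‖Sobolev.value F k (gridPt a b M (j + 1)) -
        Sobolev.value F k (gridPt a b M j)‖ ^ 2 / h := by field_simp
    rw [e, div_le_iff₀ hh]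
    linarith
  rw [Finset.mul_sum]
  calc _ ≤ _ := Finset.sum_le_sum step
    _ = _ := sum_integral_cells hab hM i1
    _ ≤ _ := Sobolev.integral_comp_sq_le F hab.le (k + 1)

/-- The second difference of `f - (h² / 12) f''` agrees with `f''` up to fourth order terms, with a
remainder that is controlled by the fifth derivative on the two adjacent cells. -/
theorem norm_corrected_second_diff_le (F : Sobolev a b 5) (hab : a < b) {x h : ℝ} (hh : 0 ≤ h)
    (hxa : a ≤ x - h) (hxb : x + h ≤ b) :
    ‖Sobolev.value F 0 (x + h) + Sobolev.value F 0 (x - h) - 2 * Sobolev.value F 0 x -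
        (h : ℂ) ^ 2 * Sobolev.value F 2 x - (h : ℂ) ^ 2 / 12 * (Sobolev.value F 2 (x + h) +
        Sobolev.value F 2 (x - h) - 2 * Sobolev.value F 2 x)‖ ≤
      3 * h ^ 4 * ∫ y in (x - h)..(x + h), ‖Sobolev.comp F 5 y‖ := by
  set D := ∫ y in (x - h)..(x + h), ‖Sobolev.comp F 5 y‖ with hD
  have hD0 : 0 ≤ D := intervalIntegral.integral_nonneg (by linarith) fun _ _ => norm_nonneg _
  have hsub : Icc (x - h) (x + h) ⊆ Icc a b := Icc_subset_Icc hxa hxb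
  have hder : ∀ k, k + 1 < 5 → ∀ y ∈ Icc (x - h) (x + h), HasDerivWithinAt (Sobolev.value F k)
      (Sobolev.value F (k + 1) y) (Icc (x - h) (x + h)) y := fun k hk y hy =>
    (Sobolev.hasDerivWithinAt_value F hab hk (hsub hy)).mono hsub
  have hpow : ∀ (n : ℕ) (c : ℂ) (s : ℝ),
      HasDerivAt (fun s : ℝ => (s : ℂ) ^ (n + 1) * c) ((n + 1) * (s : ℂ) ^ n * c) s := by
    intro n c s
    have h1 := ((Complex.ofRealCLM.hasDerivAt (x := s)).pow (n + 1)).mul_const c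
    simpa using h1
  -- expansion of the symmetric sums of `f''` and, by two more integrations, of `f`; in the
  -- combination of the two the terms with `f''''` cancel
  have q2 : ∀ s ∈ Icc 0 h, ‖Sobolev.value F 2 (x + s) + Sobolev.value F 2 (x - s) -
      (Sobolev.value F 2 x + Sobolev.value F 2 x + (s : ℂ) ^ 2 * Sobolev.value F 4 x)‖ ≤
      2 * D * s ^ 2 := by
    intro s hs
    refine norm_symm_sum_sub_le (h := h)
      (r := fun s : ℝ => Sobolev.value F 2 x + Sobolev.value F 2 x +
        (s : ℂ) ^ 2 * Sobolev.value F 4 x)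
      (r₁ := fun s : ℝ => (s : ℂ) ^ 1 * (2 * Sobolev.value F 4 x))
      (r₂ := fun s : ℝ => 2 * Sobolev.value F 4 x)
      (hder 2 (by norm_num)) (hder 3 (by norm_num)) (fun t => ?_) (fun t => ?_) (by simp) (by simp)
      (fun t ht => ?_) hs
    · have := (hpow 1 (Sobolev.value F 4 x) t).const_add
        (Sobolev.value F 2 x + Sobolev.value F 2 x)
      exact this.congr_deriv (by push_cast; ring)
    · have := hpow 0 (2 * Sobolev.value F 4 x) t
      exact this.congr_deriv (by push_cast; ring)
    · have b1 := Sobolev.norm_value_sub_le F 4 (x := x + t) (y := x) hxa hxb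
        ⟨by linarith [ht.1, ht.2], by linarith [ht.2]⟩ ⟨by linarith, by linarith⟩
      have b2 := Sobolev.norm_value_sub_le F 4 (x := x - t) (y := x) hxa hxb
        ⟨by linarith [ht.2], by linarith [ht.1, ht.2]⟩ ⟨by linarith, by linarith⟩
      rw [show Sobolev.value F 4 (x + t) + Sobolev.value F 4 (x - t) - 2 * Sobolev.value F 4 x =
        (Sobolev.value F 4 (x + t) - Sobolev.value F 4 x) +
        (Sobolev.value F 4 (x - t) - Sobolev.value F 4 x) by ring]
      calc _ ≤ _ := norm_add_le _ _
        _ ≤ D + D := add_le_add b1 b2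
        _ = _ := by ring
  have q0 := norm_symm_sum_sub_le (x := x) (h := h) (B := 2 * D * h ^ 2)
      (r := fun s : ℝ => Sobolev.value F 0 x + Sobolev.value F 0 x +
        (s : ℂ) ^ 2 * Sobolev.value F 2 x + (s : ℂ) ^ 4 * (Sobolev.value F 4 x / 12))
      (r₁ := fun s : ℝ => (s : ℂ) ^ 1 * (2 * Sobolev.value F 2 x) +
        (s : ℂ) ^ 3 * (Sobolev.value F 4 x / 3))
      (r₂ := fun s : ℝ => Sobolev.value F 2 x + Sobolev.value F 2 x +
        (s : ℂ) ^ 2 * Sobolev.value F 4 x)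
      (hder 0 (by norm_num)) (hder 1 (by norm_num)) (fun t => ?_) (fun t => ?_) (by simp) (by simp)
      (fun t ht => ?_) (right_mem_Icc.2 hh)
  · have q2h := q2 h (right_mem_Icc.2 hh)
    have e : Sobolev.value F 0 (x + h) + Sobolev.value F 0 (x - h) - 2 * Sobolev.value F 0 x -
        (h : ℂ) ^ 2 * Sobolev.value F 2 x - (h : ℂ) ^ 2 / 12 * (Sobolev.value F 2 (x + h) +
        Sobolev.value F 2 (x - h) - 2 * Sobolev.value F 2 x) =
        (Sobolev.value F 0 (x + h) + Sobolev.value F 0 (x - h) -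
          (Sobolev.value F 0 x + Sobolev.value F 0 x +
        (h : ℂ) ^ 2 * Sobolev.value F 2 x + (h : ℂ) ^ 4 * (Sobolev.value F 4 x / 12))) -
        ((h ^ 2 / 12 : ℝ) : ℂ) * (Sobolev.value F 2 (x + h) + Sobolev.value F 2 (x - h) -
          (Sobolev.value F 2 x + Sobolev.value F 2 x + (h : ℂ) ^ 2 * Sobolev.value F 4 x)) := by
      push_cast; ring
    rw [e]
    refine (norm_sub_le _ _).trans ?_
    rw [norm_mul, Complex.norm_real, Real.norm_of_nonneg (by positivity)]
    have h1 := mul_le_mul_of_nonneg_left q2h (show 0 ≤ h ^ 2 / 12 by positivity)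
    have h2 : 0 ≤ h ^ 4 * D := by positivity
    calc _ ≤ 2 * D * h ^ 2 * h ^ 2 + h ^ 2 / 12 * (2 * D * h ^ 2) := add_le_add q0 h1
      _ ≤ _ := by nlinarith
  · have := ((hpow 1 (Sobolev.value F 2 x) t).const_add
        (Sobolev.value F 0 x + Sobolev.value F 0 x)).add (hpow 3 (Sobolev.value F 4 x / 12) t)
    exact this.congr_deriv (by push_cast; ring)
  · have := (hpow 0 (2 * Sobolev.value F 2 x) t).add (hpow 2 (Sobolev.value F 4 x / 3) t)
    exact this.congr_deriv (by push_cast; ring)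
  · refine (q2 t ht).trans ?_
    have := ht.1
    have := ht.2
    gcongr

theorem gridL2_corrected_second_diff_le (F : Sobolev a b 5) (hab : a < b) (hM : 1 ≤ M) {P : ℕ → ℂ}
    (hP : ∀ j ∈ Finset.Icc 1 (M - 1), P j =
      dxx (mesh a b M) (fun i => Sobolev.value F 0 (gridPt a b M i)) j -
        Sobolev.value F 2 (gridPt a b M j) - (mesh a b M : ℂ) ^ 2 / 12 *
        dxx (mesh a b M) (fun i => Sobolev.value F 2 (gridPt a b M i)) j) :
    gridL2 (mesh a b M) M P ≤ 6 * mesh a b M ^ 3 * ‖F‖ := by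
  have hh := mesh_pos hab hM
  have hn := norm_nonneg F
  refine Real.sqrt_le_iff.2 ⟨by positivity, ?_⟩
  set h := mesh a b M with hdef
  have hc : (h : ℂ) ≠ 0 := by exact_mod_cast hh.ne'
  have i1 := Sobolev.integrableOn_comp_sq F 5
  have step : ∀ j ∈ Finset.Icc 1 (M - 1), h * ‖P j‖ ^ 2 ≤ 18 * h ^ 6 *
      ∫ y in gridPt a b M (j - 1)..gridPt a b M (j + 1), ‖Sobolev.comp F 5 y‖ ^ 2 := by
    intro j hj
    rw [hP j hj]
    rw [Finset.mem_Icc] at hj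
    have m0 := gridPt_mem hab hM (j := j - 1) (by omega)
    have m1 := gridPt_mem hab hM (j := j + 1) (by omega)
    have e1 : gridPt a b M (j + 1) = gridPt a b M j + h := gridPt_succ j
    have e0 : gridPt a b M (j - 1) = gridPt a b M j - h := by
      have := gridPt_succ (a := a) (b := b) (M := M) (j - 1)
      rw [Nat.sub_add_cancel hj.1] at this
      rw [this]; ring
    simp only [dxx]
    rw [e0, e1]
    rw [e0] at m0
    rw [e1] at m1
    set x := gridPt a b M j with hx
    have h1 := norm_corrected_second_diff_le F hab hh.le m0.1 m1.2
    have hle : x - h ≤ x + h := by linarith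
    have h2 := sq_integral_norm_le hle (Sobolev.intervalIntegrable_comp F 5 m0 m1)
      (Sobolev.intervalIntegrable_comp_sq F 5 m0 m1)
    rw [show x + h - (x - h) = 2 * h by ring] at h2
    set D := ∫ y in (x - h)..(x + h), ‖Sobolev.comp F 5 y‖
    set S := ∫ y in (x - h)..(x + h), ‖Sobolev.comp F 5 y‖ ^ 2
    have e : (Sobolev.value F 0 (x + h) - 2 * Sobolev.value F 0 x + Sobolev.value F 0 (x - h)) /
        (h : ℂ) ^ 2 - Sobolev.value F 2 x - (h : ℂ) ^ 2 / 12 * ((Sobolev.value F 2 (x + h) -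
        2 * Sobolev.value F 2 x + Sobolev.value F 2 (x - h)) / (h : ℂ) ^ 2) =
        (Sobolev.value F 0 (x + h) + Sobolev.value F 0 (x - h) - 2 * Sobolev.value F 0 x -
        (h : ℂ) ^ 2 * Sobolev.value F 2 x - (h : ℂ) ^ 2 / 12 * (Sobolev.value F 2 (x + h) +
        Sobolev.value F 2 (x - h) - 2 * Sobolev.value F 2 x)) / ((h ^ 2 : ℝ) : ℂ) := by
      push_cast
      field_simp
      ring
    rw [e, norm_div, Complex.norm_real, Real.norm_of_nonneg (by positivity), div_pow]
    have h3 := pow_le_pow_left₀ (norm_nonneg _) h1 2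
    calc _ ≤ h * ((3 * h ^ 4 * D) ^ 2 / (h ^ 2) ^ 2) := by gcongr
      _ = 9 * h ^ 5 * D ^ 2 := by field_simp; ring
      _ ≤ 9 * h ^ 5 * (2 * h * S) := by gcongr
      _ = _ := by ring
  rw [Finset.mul_sum]
  calc _ ≤ _ := Finset.sum_le_sum step
    _ ≤ 18 * h ^ 6 * (2 * ∫ y in a..b, ‖Sobolev.comp F 5 y‖ ^ 2) := by
        rw [← Finset.mul_sum]
        gcongr
        exact sum_integral_double_cells_le hab hM i1 fun _ => by positivity
    _ ≤ 18 * h ^ 6 * (2 * ‖F‖ ^ 2) := by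
        gcongr
        exact Sobolev.integral_comp_sq_le F hab.le 5
    _ = _ := by ring

end Grid

/-! ### Regularity in time -/

/-- For continuous functions, the essential supremum over an open set bounds the function on
every set between the open set and its closure. -/
theorem norm_le_of_eLpNorm_top_le {X E : Type*} [TopologicalSpace X] [MeasurableSpace X]
    [BorelSpace X] [NormedAddCommGroup E] {μ : Measure X} [μ.IsOpenPosMeasure]
    {f : X → E} {s t : Set X} (hs : IsOpen s) (hst : s ⊆ t) (hts : t ⊆ closure s)
    (hf : ContinuousOn f t) {C : ℝ} (hC : 0 ≤ C)
    (h : eLpNorm f ∞ (μ.restrict s) ≤ ENNReal.ofReal C) {x : X} (hx : x ∈ t) : ‖f x‖ ≤ C := by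
  rw [eLpNorm_exponent_top] at h
  have h1 : (fun x => max ‖f x‖ C) =ᵐ[μ.restrict s] fun _ => C := by
    filter_upwards [enorm_ae_le_eLpNormEssSup f (μ.restrict s)] with y hy
    have h2 := hy.trans h
    rw [← ofReal_norm, ENNReal.ofReal_le_ofReal_iff hC] at h2
    exact max_eq_right h2
  have hc : ContinuousOn (fun x => max ‖f x‖ C) t := hf.norm.sup continuousOn_const
  have h3 := (Measure.eqOn_open_of_ae_eq h1 hs (hc.mono hst) continuousOn_const).of_subset_closure
    hc continuousOn_const hst hts
  exact (le_max_left _ _).trans (h3 hx).le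

theorem hasDerivWithinAt_iteratedDerivWithin {E : Type*} [NormedAddCommGroup E] [NormedSpace ℝ E]
    {f : ℝ → E} {s : Set ℝ} (hs : UniqueDiffOn ℝ s) {n k : ℕ} (hf : ContDiffOn ℝ n f s) (hk : k < n)
    {t : ℝ} (ht : t ∈ s) :
    HasDerivWithinAt (iteratedDerivWithin k f s) (iteratedDerivWithin (k + 1) f s t) s t := by
  rw [iteratedDerivWithin_succ]
  exact (hf.differentiableOn_iteratedDerivWithin (by exact_mod_cast hk) hs t ht).hasDerivWithinAt

/-- A function `u` of class `C([0,T]; H⁵) ∩ C²([0,T]; H⁴) ∩ C³([0,T]; H²)`, given by its curves in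
the three spaces and their derivatives, with bounds for the highest ones. -/
structure RegularCurves (a b T C₀ : ℝ) (u : ℝ → ℝ → ℂ) where
  /-- The curve in `H⁵`. -/
  U5 : ℝ → Sobolev a b 5
  /-- The curve in `H⁴`. -/
  U4 : ℝ → Sobolev a b 4
  /-- The first time derivative in `H⁴`. -/
  dU4 : ℝ → Sobolev a b 4
  /-- The second time derivative in `H⁴`. -/
  ddU4 : ℝ → Sobolev a b 4
  /-- The curve in `H²`. -/
  U2 : ℝ → Sobolev a b 2
  /-- The first time derivative in `H²`. -/
  dU2 : ℝ → Sobolev a b 2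
  /-- The second time derivative in `H²`. -/
  ddU2 : ℝ → Sobolev a b 2
  /-- The third time derivative in `H²`. -/
  dddU2 : ℝ → Sobolev a b 2
  rep5 : Represents a b T U5 u
  rep4 : Represents a b T U4 u
  rep2 : Represents a b T U2 u
  cont5 : ContinuousOn U5 (Icc 0 T)
  deriv4 : ∀ t ∈ Icc 0 T, HasDerivWithinAt U4 (dU4 t) (Icc 0 T) t
  deriv4' : ∀ t ∈ Icc 0 T, HasDerivWithinAt dU4 (ddU4 t) (Icc 0 T) t
  deriv2 : ∀ t ∈ Icc 0 T, HasDerivWithinAt U2 (dU2 t) (Icc 0 T) t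
  deriv2' : ∀ t ∈ Icc 0 T, HasDerivWithinAt dU2 (ddU2 t) (Icc 0 T) t
  deriv2'' : ∀ t ∈ Icc 0 T, HasDerivWithinAt ddU2 (dddU2 t) (Icc 0 T) t
  bound5 : ∀ t ∈ Icc 0 T, ‖U5 t‖ ≤ C₀
  bound4 : ∀ t ∈ Icc 0 T, ‖ddU4 t‖ ≤ C₀
  bound2 : ∀ t ∈ Icc 0 T, ‖dddU2 t‖ ≤ C₀

theorem RegularWithBound.nonempty_regularCurves {a b T C₀ : ℝ} (hT : 0 < T) (hC₀ : 0 ≤ C₀)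
    {u : ℝ → ℝ → ℂ} (h : RegularWithBound a b T C₀ u) : Nonempty (RegularCurves a b T C₀ u) := by
  obtain ⟨U5, U4, U2, r5, r4, r2, c5, c4, c2, hb⟩ := h
  have hS : UniqueDiffOn ℝ (Icc 0 T) := uniqueDiffOn_Icc hT
  have hcl : Icc 0 T ⊆ closure (Ioo 0 T) := by rw [closure_Ioo hT.ne]
  have h0 : ∀ {m : ℕ} (V : ℝ → Sobolev a b m) t, t ∈ Icc 0 T →
      iteratedDerivWithin 0 V (Icc 0 T) t = V t := fun V t _ => by simp
  refine ⟨⟨U5, U4, iteratedDerivWithin 1 U4 (Icc 0 T), iteratedDerivWithin 2 U4 (Icc 0 T), U2,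
    iteratedDerivWithin 1 U2 (Icc 0 T), iteratedDerivWithin 2 U2 (Icc 0 T),
    iteratedDerivWithin 3 U2 (Icc 0 T), r5, r4, r2, c5, ?_, ?_, ?_, ?_, ?_, ?_, ?_, ?_⟩⟩
  · intro t ht
    have := hasDerivWithinAt_iteratedDerivWithin hS c4 (k := 0) (by norm_num) ht
    simpa using this
  · exact fun t ht => hasDerivWithinAt_iteratedDerivWithin hS c4 (k := 1) (by norm_num) ht
  · intro t ht
    have := hasDerivWithinAt_iteratedDerivWithin hS c2 (k := 0) (by norm_num) ht
    simpa using this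
  · exact fun t ht => hasDerivWithinAt_iteratedDerivWithin hS c2 (k := 1) (by norm_num) ht
  · exact fun t ht => hasDerivWithinAt_iteratedDerivWithin hS c2 (k := 2) (by norm_num) ht
  · exact fun t ht => norm_le_of_eLpNorm_top_le isOpen_Ioo Ioo_subset_Icc_self hcl c5 hC₀
      ((le_self_add.trans le_self_add).trans hb) ht
  · exact fun t ht => norm_le_of_eLpNorm_top_le isOpen_Ioo Ioo_subset_Icc_self hcl
      (c4.continuousOn_iteratedDerivWithin le_rfl hS) hC₀
      ((le_add_self.trans le_self_add).trans hb) ht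
  · exact fun t ht => norm_le_of_eLpNorm_top_le isOpen_Ioo Ioo_subset_Icc_self hcl
      (c2.continuousOn_iteratedDerivWithin le_rfl hS) hC₀ (le_add_self.trans hb) ht

theorem hasDerivWithinAt_value_curve {a b T : ℝ} {m : ℕ} (hab : a < b) {V : ℝ → Sobolev a b m}
    {V' : Sobolev a b m} {t : ℝ} (h : HasDerivWithinAt V V' (Icc 0 T) t) {k : ℕ} (hk : k < m)
    {x : ℝ} (hx : x ∈ Icc a b) :
    HasDerivWithinAt (fun s => Sobolev.value (V s) k x) (Sobolev.value V' k x) (Icc 0 T) t :=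
  (valueCLM hab hk hx).hasFDerivAt.comp_hasDerivWithinAt t h

theorem continuousOn_value_curve {a b T : ℝ} {m : ℕ} (hab : a < b) {V : ℝ → Sobolev a b m}
    (h : ContinuousOn V (Icc 0 T)) {k : ℕ} (hk : k < m) {x : ℝ} (hx : x ∈ Icc a b) :
    ContinuousOn (fun s => Sobolev.value (V s) k x) (Icc 0 T) :=
  (valueCLM hab hk hx).continuous.comp_continuousOn h

section Solution

variable {a b T C₀ ε : ℝ} {u₀ : ℝ → ℂ} {u : ℝ → ℝ → ℂ}

theorem IsSolution.continuousOn_left (sol : IsSolution a b T ε u₀ u) {t : ℝ} (ht : t ∈ Icc 0 T) :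
    ContinuousOn (fun x => u x t) (Icc a b) :=
  sol.continuousOn.comp (f := fun x => (x, t)) (by fun_prop) fun _ hx => ⟨hx, ht⟩

theorem IsSolution.continuousOn_right (sol : IsSolution a b T ε u₀ u) {x : ℝ} (hx : x ∈ Icc a b) :
    ContinuousOn (fun t => u x t) (Icc 0 T) :=
  sol.continuousOn.comp (f := fun t => (x, t)) (by fun_prop) fun _ ht => ⟨hx, ht⟩

namespace RegularCurves

theorem value_eq (R : RegularCurves a b T C₀ u) (hab : a < b) (sol : IsSolution a b T ε u₀ u)
    {t x : ℝ} (ht : t ∈ Icc 0 T) (hx : x ∈ Icc a b) :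
    Sobolev.value (R.U5 t) 0 x = u x t ∧ Sobolev.value (R.U4 t) 0 x = u x t ∧
      Sobolev.value (R.U2 t) 0 x = u x t :=
  have hc := sol.continuousOn_left ht
  ⟨Sobolev.value_zero_eq _ hab (by norm_num) hc (R.rep5 t ht) hx,
    Sobolev.value_zero_eq _ hab (by norm_num) hc (R.rep4 t ht) hx,
    Sobolev.value_zero_eq _ hab (by norm_num) hc (R.rep2 t ht) hx⟩

theorem comp_ae_eq (R : RegularCurves a b T C₀ u) {t : ℝ} (ht : t ∈ Icc 0 T) :
    Sobolev.comp (R.U4 t) 0 =ᵐ[volume.restrict (Ioo a b)] Sobolev.comp (R.U5 t) 0 :=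
  (R.rep4 t ht).trans (R.rep5 t ht).symm

theorem value_two_eq (R : RegularCurves a b T C₀ u) (hab : a < b) {t x : ℝ} (ht : t ∈ Icc 0 T)
    (hx : x ∈ Icc a b) : Sobolev.value (R.U4 t) 2 x = Sobolev.value (R.U5 t) 2 x :=
  Sobolev.value_congr _ hab _ (R.comp_ae_eq ht) (by norm_num) (by norm_num) hx

theorem hasDerivWithinAt_time (R : RegularCurves a b T C₀ u) (hab : a < b)
    (sol : IsSolution a b T ε u₀ u) {t x : ℝ} (ht : t ∈ Icc 0 T) (hx : x ∈ Icc a b) :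
    HasDerivWithinAt (fun s => u x s) (Sobolev.value (R.dU2 t) 0 x) (Icc 0 T) t :=
  (hasDerivWithinAt_value_curve hab (R.deriv2 t ht) (by norm_num : 0 < 2) hx).congr
    (fun s hs => (R.value_eq hab sol hs hx).2.2.symm) (R.value_eq hab sol ht hx).2.2.symm

theorem dU4_value_eq (R : RegularCurves a b T C₀ u) (hab : a < b) (hT : 0 < T)
    (sol : IsSolution a b T ε u₀ u) {t x : ℝ} (ht : t ∈ Icc 0 T) (hx : x ∈ Icc a b) :
    Sobolev.value (R.dU4 t) 0 x = Sobolev.value (R.dU2 t) 0 x :=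
  (uniqueDiffOn_Icc hT t ht).eq_deriv _
    ((hasDerivWithinAt_value_curve hab (R.deriv4 t ht) (by norm_num : 0 < 4) hx).congr
      (fun s hs => (R.value_eq hab sol hs hx).2.1.symm) (R.value_eq hab sol ht hx).2.1.symm)
    (R.hasDerivWithinAt_time hab sol ht hx)

theorem iteratedDeriv_two_eq (R : RegularCurves a b T C₀ u) (hab : a < b)
    (sol : IsSolution a b T ε u₀ u) {t x : ℝ} (ht : t ∈ Icc 0 T) {f : ℝ → ℂ}
    (hf : ∀ y ∈ Icc a b, f y = u y t) (hx : x ∈ Icc a b) :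
    iteratedDerivWithin 2 f (Icc a b) x = Sobolev.value (R.U5 t) 2 x := by
  have hS : UniqueDiffOn ℝ (Icc a b) := uniqueDiffOn_Icc hab
  have h1 : ∀ y ∈ Icc a b, derivWithin f (Icc a b) y = Sobolev.value (R.U5 t) 1 y := fun y hy =>
    ((Sobolev.hasDerivWithinAt_value (R.U5 t) hab (by norm_num) hy).congr
      (fun z hz => (hf z hz).trans (R.value_eq hab sol ht hz).1.symm)
      ((hf y hy).trans (R.value_eq hab sol ht hy).1.symm)).derivWithin (hS y hy)
  rw [iteratedDerivWithin_succ, iteratedDerivWithin_one]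
  exact ((Sobolev.hasDerivWithinAt_value (R.U5 t) hab (by norm_num) hx).congr h1
    (h1 x hx)).derivWithin (hS x hx)

/-- The equation extends to the closed rectangle, with the continuous representatives of `∂ₜu` and
`∂ₓₓu`. -/
theorem equation (R : RegularCurves a b T C₀ u) (hab : a < b) (hT : 0 < T) (hε : 0 < ε)
    (sol : IsSolution a b T ε u₀ u) {t x : ℝ} (ht : t ∈ Icc 0 T) (hx : x ∈ Icc a b) :
    Complex.I * Sobolev.value (R.dU2 t) 0 x + Sobolev.value (R.U5 t) 2 x =
      logNonlin ε (u x t) := by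
  have hN := continuous_logNonlin hε
  have h1 : ∀ t ∈ Ioo 0 T, ∀ x ∈ Ioo a b, Complex.I * Sobolev.value (R.dU2 t) 0 x +
      Sobolev.value (R.U5 t) 2 x = logNonlin ε (u x t) := by
    intro t ht x hx
    have ht' := Ioo_subset_Icc_self ht
    have hx' := Ioo_subset_Icc_self hx
    rw [← sol.equation x hx t ht]
    congr 2
    · exact ((R.hasDerivWithinAt_time hab sol ht' hx').hasDerivAt
        (Icc_mem_nhds ht.1 ht.2)).deriv.symm
    · rw [← R.iteratedDeriv_two_eq hab sol ht' (fun y _ => rfl) hx']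
      exact iteratedDerivWithin_eq_iteratedDeriv (uniqueDiffOn_Icc hab)
        ((sol.contDiffOn_space t ht).contDiffAt (Ioo_mem_nhds hx.1 hx.2)) hx'
  have h2 : ∀ t ∈ Ioo 0 T, ∀ x ∈ Icc a b, Complex.I * Sobolev.value (R.dU2 t) 0 x +
      Sobolev.value (R.U5 t) 2 x = logNonlin ε (u x t) := fun t ht x hx =>
    EqOn.of_subset_closure (s := Ioo a b) (h1 t ht)
      ((continuousOn_const.mul (Sobolev.continuousOn_value _ hab 0)).add
        (Sobolev.continuousOn_value _ hab 2))
      (hN.comp_continuousOn (sol.continuousOn_left (Ioo_subset_Icc_self ht))) Ioo_subset_Icc_self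
      (by rw [closure_Ioo hab.ne]) hx
  exact EqOn.of_subset_closure (s := Ioo 0 T) (fun t ht => h2 t ht x hx)
    ((continuousOn_const.mul (continuousOn_value_curve hab
      (fun s hs => (R.deriv2' s hs).continuousWithinAt) (by norm_num : 0 < 2) hx)).add
      (continuousOn_value_curve hab R.cont5 (by norm_num : 2 < 5) hx))
    (hN.comp_continuousOn (sol.continuousOn_right hx)) Ioo_subset_Icc_self
    (by rw [closure_Ioo hT.ne]) ht

theorem dU2_boundary (R : RegularCurves a b T C₀ u) (hab : a < b) (hT : 0 < T)
    (sol : IsSolution a b T ε u₀ u) {t : ℝ} (ht : t ∈ Icc 0 T) :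
    Sobolev.value (R.dU2 t) 0 a = 0 ∧ Sobolev.value (R.dU2 t) 0 b = 0 :=
  ⟨(uniqueDiffOn_Icc hT t ht).eq_deriv _
    (R.hasDerivWithinAt_time hab sol ht (left_mem_Icc.2 hab.le))
    ((hasDerivWithinAt_const t (Icc 0 T) (0 : ℂ)).congr (fun s hs => (sol.boundary s hs).1)
      (sol.boundary t ht).1),
  (uniqueDiffOn_Icc hT t ht).eq_deriv _
    (R.hasDerivWithinAt_time hab sol ht (right_mem_Icc.2 hab.le))
    ((hasDerivWithinAt_const t (Icc 0 T) (0 : ℂ)).congr (fun s hs => (sol.boundary s hs).2)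
      (sol.boundary t ht).2)⟩

/-- The equation forces `∂ₓₓu` to vanish at the end points. -/
theorem U5_two_boundary (R : RegularCurves a b T C₀ u) (hab : a < b) (hT : 0 < T) (hε : 0 < ε)
    (sol : IsSolution a b T ε u₀ u) {t : ℝ} (ht : t ∈ Icc 0 T) :
    Sobolev.value (R.U5 t) 2 a = 0 ∧ Sobolev.value (R.U5 t) 2 b = 0 := by
  obtain ⟨ha, hb⟩ := R.dU2_boundary hab hT sol ht
  have h1 := R.equation hab hT hε sol ht (left_mem_Icc.2 hab.le)
  have h2 := R.equation hab hT hε sol ht (right_mem_Icc.2 hab.le)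
  rw [ha, (sol.boundary t ht).1, logNonlin_zero] at h1
  rw [hb, (sol.boundary t ht).2, logNonlin_zero] at h2
  exact ⟨by simpa using h1, by simpa using h2⟩

/-- The bound for `∂ₜu` in `H⁴` that follows from those for `u` and `∂ₜ²u`. The factor `1 / T`
is harmless: it is integrated over a time interval of length `T`. -/
theorem norm_dU4_le (R : RegularCurves a b T C₀ u) (hT : 0 < T) {t : ℝ}
    (ht : t ∈ Icc 0 T) : ‖R.dU4 t‖ ≤ C₀ * (2 / T + T) := by
  have hC₀ : 0 ≤ C₀ := (norm_nonneg _).trans (R.bound5 t ht)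
  have hU : ∀ s ∈ Icc 0 T, ‖R.U4 s‖ ≤ C₀ := fun s hs =>
    (Sobolev.norm_le_norm_of_ae_eq _ _ (by norm_num) (R.comp_ae_eq hs)).trans (R.bound5 s hs)
  have hlip : ∀ s ∈ Icc 0 T, ‖R.dU4 s - R.dU4 t‖ ≤ C₀ * T := fun s hs => by
    refine ((convex_Icc 0 T).norm_image_sub_le_of_norm_hasDerivWithin_le R.deriv4' R.bound4 ht
      hs).trans ?_
    gcongr
    rw [Real.norm_eq_abs, abs_le]
    constructor <;> linarith [hs.1, hs.2, ht.1, ht.2]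
  -- Landau's argument: `T ∂ₜu(t)` differs from the increment `u(T) - u(0)` by the oscillation of
  -- `∂ₜu`
  have h1 := norm_le_mul_of_deriv (p := fun s => R.U4 s - R.U4 0 - s • R.dU4 t)
    (p₁ := fun s => R.dU4 s - R.dU4 t) (h := T) (B := C₀ * T) (fun s hs => by
      have h2 := ((hasDerivAt_id s).smul_const (R.dU4 t)).hasDerivWithinAt (s := Icc 0 T)
      simp only [id_eq, one_smul] at h2
      exact ((R.deriv4 s hs).sub_const (R.U4 0)).sub h2) (by simp) hlip (right_mem_Icc.2 hT.le)
  have h3 : T • R.dU4 t = (R.U4 T - R.U4 0) - (R.U4 T - R.U4 0 - T • R.dU4 t) := by abel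
  have h4 : T * ‖R.dU4 t‖ ≤ 2 * C₀ + C₀ * T * T := by
    have h10 : ‖T • R.dU4 t‖ = T * ‖R.dU4 t‖ := by rw [norm_smul, Real.norm_of_nonneg hT.le]
    rw [← h10, h3]
    have h5 := hU T (right_mem_Icc.2 hT.le)
    have h6 := hU 0 (left_mem_Icc.2 hT.le)
    have h7 := norm_sub_le (R.U4 T - R.U4 0) (R.U4 T - R.U4 0 - T • R.dU4 t)
    have h8 := norm_sub_le (R.U4 T) (R.U4 0)
    linarith
  have h9 : C₀ * (2 / T + T) = (2 * C₀ + C₀ * T * T) / T := by field_simp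
  rw [h9, le_div_iff₀ hT]
  linarith

theorem norm_u_le (R : RegularCurves a b T C₀ u) (hab : a < b) (sol : IsSolution a b T ε u₀ u)
    {t x : ℝ} (ht : t ∈ Icc 0 T) (hx : x ∈ Icc a b) : ‖u x t‖ ≤ 2 * C₀ := by
  have ha := left_mem_Icc.2 hab.le
  rw [← (R.value_eq hab sol ht hx).1]
  refine (Sobolev.norm_value_le (R.U5 t) hab (by norm_num) hx (Or.inl ⟨a, ha, ?_⟩)).trans ?_
  · rw [(R.value_eq hab sol ht ha).1, (sol.boundary t ht).1]
  · linarith [R.bound5 t ht]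

/-- `u(·, t)` is Lipschitz, with a constant that does not depend on the length of the interval:
`∂ₓu` has mean value zero. -/
theorem norm_u_sub_le (R : RegularCurves a b T C₀ u) (hab : a < b) (sol : IsSolution a b T ε u₀ u)
    {t x y : ℝ} (ht : t ∈ Icc 0 T) (hx : x ∈ Icc a b) (hy : y ∈ Icc a b) :
    ‖u x t - u y t‖ ≤ 2 * C₀ * |x - y| := by
  have ha := left_mem_Icc.2 hab.le
  have hb := right_mem_Icc.2 hab.le
  have h0 : ∫ z in a..b, Sobolev.value (R.U5 t) 1 z = 0 := by
    have h1 := Sobolev.value_sub (R.U5 t) 0 hb ha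
    rw [(R.value_eq hab sol ht hb).1, (R.value_eq hab sol ht ha).1, (sol.boundary t ht).1,
      (sol.boundary t ht).2, sub_zero, intervalIntegral.integral_of_le hab.le,
      integral_Ioc_eq_integral_Ioo, integral_congr_ae (Sobolev.comp_ae_eq_value (R.U5 t) hab
        (by norm_num : 0 + 1 < 5))] at h1
    rw [intervalIntegral.integral_of_le hab.le, integral_Ioc_eq_integral_Ioo]
    exact h1.symm
  rw [← (R.value_eq hab sol ht hx).1, ← (R.value_eq hab sol ht hy).1, ← Real.norm_eq_abs]
  refine (convex_Icc a b).norm_image_sub_le_of_norm_hasDerivWithin_le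
    (fun z hz => Sobolev.hasDerivWithinAt_value (R.U5 t) hab (by norm_num) hz) (fun z hz => ?_)
    hy hx
  have := Sobolev.norm_value_le (R.U5 t) hab (k := 1) (by norm_num) hz (Or.inr h0)
  simp only [zero_add]
  linarith [R.bound5 t ht]

end RegularCurves

theorem IsSolution.norm_le_spaceTimeSup (sol : IsSolution a b T ε u₀ u) (hab : a < b) (hT : 0 < T)
    {t x : ℝ} (ht : t ∈ Icc 0 T) (hx : x ∈ Icc a b) : ‖u x t‖ ≤ spaceTimeSup a b T u := by
  have hsub : Ioo a b ×ˢ Ioo 0 T ⊆ Icc a b ×ˢ Icc 0 T :=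
    prod_mono Ioo_subset_Icc_self Ioo_subset_Icc_self
  obtain ⟨B, hB⟩ := (isCompact_Icc.prod isCompact_Icc).exists_bound_of_continuousOn sol.continuousOn
  have hfin : eLpNorm (fun p : ℝ × ℝ => u p.1 p.2) ∞ (volume.restrict (Ioo a b ×ˢ Ioo 0 T)) < ⊤ := by
    rw [eLpNorm_exponent_top]
    refine eLpNormEssSup_lt_top_of_ae_bound (C := B) ?_
    filter_upwards [ae_restrict_mem (measurableSet_Ioo.prod measurableSet_Ioo)] with p hp
    exact hB p (hsub hp)
  refine norm_le_of_eLpNorm_top_le (μ := (volume : Measure (ℝ × ℝ)))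
    (f := fun p : ℝ × ℝ => u p.1 p.2) (isOpen_Ioo.prod isOpen_Ioo) hsub ?_
    sol.continuousOn ENNReal.toReal_nonneg (ENNReal.ofReal_toReal hfin.ne).ge
    (show (x, t) ∈ _ from ⟨hx, ht⟩)
  rw [closure_prod_eq, closure_Ioo hab.ne, closure_Ioo hT.ne]

end Solution

/-! ### Consistency of the scheme for the corrected solution -/

section Consistency

variable {a b T C₀ ε τ : ℝ} {M : ℕ} {u₀ : ℝ → ℂ} {u : ℝ → ℝ → ℂ} {U : ℕ → ℕ → ℂ}

/-- The corrector `(h² / 12) ∂ₓₓu`. Subtracting it from `u` removes the leading term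
`(h² / 12) ∂ₓ⁴u` of the spatial truncation error, which need not vanish at the end points. The
corrector itself does vanish there. -/
noncomputable def RegularCurves.corrector (R : RegularCurves a b T C₀ u) (τ : ℝ) (M k j : ℕ) : ℂ :=
  (mesh a b M : ℂ) ^ 2 / 12 * Sobolev.value (R.U5 (k * τ)) 2 (gridPt a b M j)

/-- The difference between the corrected solution and the finite difference solution. -/
noncomputable def RegularCurves.correctedErr (R : RegularCurves a b T C₀ u) (τ : ℝ) (M : ℕ)
    (U : ℕ → ℕ → ℂ) (k j : ℕ) : ℂ :=
  err a b τ M u U k j - R.corrector τ M k j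

theorem norm_mesh_sq_div (h : ℝ) : ‖(h : ℂ) ^ 2 / 12‖ = h ^ 2 / 12 := by
  have : (h : ℂ) ^ 2 / 12 = ((h ^ 2 / 12 : ℝ) : ℂ) := by push_cast; rfl
  rw [this, Complex.norm_real, Real.norm_of_nonneg (by positivity)]

theorem natCast_mul_mem_Icc (hτ : 0 < τ) {k : ℕ} (hk : k * τ ≤ T) : (k : ℝ) * τ ∈ Icc 0 T :=
  ⟨by positivity, hk⟩

theorem err_boundary (hM : 1 ≤ M) (sol : IsSolution a b T ε u₀ u) (hU : IsSIFD a b τ ε M u₀ U)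
    {k : ℕ} (hk : (k : ℝ) * τ ∈ Icc 0 T) :
    err a b τ M u U k 0 = 0 ∧ err a b τ M u U k M = 0 := by
  simp only [err, gridPt_zero, gridPt_last hM, (sol.boundary _ hk).1, (sol.boundary _ hk).2,
    (hU.boundary k).1, (hU.boundary k).2, sub_zero, and_self]

namespace RegularCurves

theorem corrector_boundary (R : RegularCurves a b T C₀ u) (hab : a < b) (hT : 0 < T) (hε : 0 < ε)
    (sol : IsSolution a b T ε u₀ u) (hM : 1 ≤ M) {k : ℕ} (hk : (k : ℝ) * τ ∈ Icc 0 T) :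
    R.corrector τ M k 0 = 0 ∧ R.corrector τ M k M = 0 := by
  have h := R.U5_two_boundary hab hT hε sol hk
  simp only [corrector, gridPt_zero, gridPt_last hM, h.1, h.2, mul_zero, and_self]

theorem correctedErr_boundary (R : RegularCurves a b T C₀ u) (hab : a < b) (hT : 0 < T)
    (hε : 0 < ε) (sol : IsSolution a b T ε u₀ u) (hM : 1 ≤ M) (hU : IsSIFD a b τ ε M u₀ U) {k : ℕ}
    (hk : (k : ℝ) * τ ∈ Icc 0 T) :
    R.correctedErr τ M U k 0 = 0 ∧ R.correctedErr τ M U k M = 0 := by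
  have h1 := err_boundary hM sol hU hk
  have h2 := R.corrector_boundary hab hT hε sol hM hk
  simp only [correctedErr, h1.1, h1.2, h2.1, h2.2, sub_zero, and_self]

theorem gridL2_corrector_le (R : RegularCurves a b T C₀ u) (hab : a < b) (hM : 1 ≤ M)
    (hh1 : mesh a b M ≤ 1) {k : ℕ} (hk : (k : ℝ) * τ ∈ Icc 0 T) :
    gridL2 (mesh a b M) M (R.corrector τ M k) ≤ C₀ * mesh a b M ^ 2 := by
  have h1 := gridL2_value_le (R.U5 (k * τ)) hab (k := 2) (by norm_num) hM hh1
  have h2 := R.bound5 _ hk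
  have e : gridL2 (mesh a b M) M (R.corrector τ M k) = _ := gridL2_mul_left _ _ _ _
  rw [e, norm_mesh_sq_div]
  have h3 := mul_le_mul_of_nonneg_left (h1.trans (mul_le_mul_of_nonneg_left h2 zero_le_two))
    (show 0 ≤ mesh a b M ^ 2 / 12 by positivity)
  have h4 : 0 ≤ C₀ * mesh a b M ^ 2 := mul_nonneg ((norm_nonneg _).trans h2) (by positivity)
  linarith

theorem gridH1Semi_corrector_le (R : RegularCurves a b T C₀ u) (hab : a < b) (hM : 1 ≤ M) {k : ℕ}
    (hk : (k : ℝ) * τ ∈ Icc 0 T) :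
    gridH1Semi (mesh a b M) M (R.corrector τ M k) ≤ C₀ * mesh a b M ^ 2 := by
  have h1 := gridH1Semi_value_le (R.U5 (k * τ)) hab 2 hM
  have h2 := R.bound5 _ hk
  have e : gridH1Semi (mesh a b M) M (R.corrector τ M k) = _ := gridH1Semi_mul_left _ _ _ _
  rw [e, norm_mesh_sq_div]
  have h3 := mul_le_mul_of_nonneg_left (h1.trans h2)
    (show 0 ≤ mesh a b M ^ 2 / 12 by positivity)
  have h4 : 0 ≤ C₀ * mesh a b M ^ 2 := mul_nonneg ((norm_nonneg _).trans h2) (by positivity)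
  linarith

theorem gridL2_err_le (R : RegularCurves a b T C₀ u) (hab : a < b) (hM : 1 ≤ M)
    (hh1 : mesh a b M ≤ 1) {k : ℕ} (hk : (k : ℝ) * τ ∈ Icc 0 T) :
    gridL2 (mesh a b M) M (err a b τ M u U k) ≤
      gridL2 (mesh a b M) M (R.correctedErr τ M U k) + C₀ * mesh a b M ^ 2 := by
  have h := gridL2_add_le (mesh_pos hab hM).le M (R.correctedErr τ M U k) (R.corrector τ M k)
  simp only [correctedErr, sub_add_cancel] at h
  have := R.gridL2_corrector_le hab hM hh1 hk
  exact h.trans (add_le_add le_rfl this)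

theorem gridH1Semi_err_le (R : RegularCurves a b T C₀ u) (hab : a < b) (hM : 1 ≤ M)
    {k : ℕ} (hk : (k : ℝ) * τ ∈ Icc 0 T) :
    gridH1Semi (mesh a b M) M (err a b τ M u U k) ≤
      gridH1Semi (mesh a b M) M (R.correctedErr τ M U k) + C₀ * mesh a b M ^ 2 := by
  have h := gridH1Semi_add_le (mesh_pos hab hM).le M (R.correctedErr τ M U k) (R.corrector τ M k)
  simp only [correctedErr, sub_add_cancel] at h
  have := R.gridH1Semi_corrector_le hab hM hk
  exact h.trans (add_le_add le_rfl this)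

theorem correctedErr_eq_add (R : RegularCurves a b T C₀ u) (k : ℕ) :
    R.correctedErr τ M U k = fun j => err a b τ M u U k j + (-1) * R.corrector τ M k j := by
  funext j; rw [correctedErr]; ring

theorem gridL2_correctedErr_le (R : RegularCurves a b T C₀ u) (hab : a < b) (hM : 1 ≤ M)
    (hh1 : mesh a b M ≤ 1) {k : ℕ} (hk : (k : ℝ) * τ ∈ Icc 0 T) :
    gridL2 (mesh a b M) M (R.correctedErr τ M U k) ≤
      gridL2 (mesh a b M) M (err a b τ M u U k) + C₀ * mesh a b M ^ 2 := by
  rw [correctedErr_eq_add]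
  refine (gridL2_add_le (mesh_pos hab hM).le M _ _).trans (add_le_add le_rfl ?_)
  rw [gridL2_mul_left, norm_neg, norm_one, one_mul]
  exact R.gridL2_corrector_le hab hM hh1 hk

theorem gridH1Semi_correctedErr_le (R : RegularCurves a b T C₀ u) (hab : a < b) (hM : 1 ≤ M)
    {k : ℕ} (hk : (k : ℝ) * τ ∈ Icc 0 T) :
    gridH1Semi (mesh a b M) M (R.correctedErr τ M U k) ≤
      gridH1Semi (mesh a b M) M (err a b τ M u U k) + C₀ * mesh a b M ^ 2 := by
  rw [correctedErr_eq_add]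
  refine (gridH1Semi_add_le (mesh_pos hab hM).le M _ _).trans (add_le_add le_rfl ?_)
  rw [gridH1Semi_mul_left, norm_neg, norm_one, one_mul]
  exact R.gridH1Semi_corrector_le hab hM hk

theorem err_zero (hab : a < b) (hM : 1 ≤ M) (sol : IsSolution a b T ε u₀ u)
    (hU : IsSIFD a b τ ε M u₀ U) {j : ℕ} (hj : j ≤ M) : err a b τ M u U 0 j = 0 := by
  rw [err, hU.initial j hj, Nat.cast_zero, zero_mul, sol.initial _ (gridPt_mem hab hM hj), sub_self]

/-- The first step is a step of Euler's method, hence second-order accurate. -/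
theorem exists_err_one_eq (R : RegularCurves a b T C₀ u) (hab : a < b) (hT : 0 < T) (hε : 0 < ε)
    (sol : IsSolution a b T ε u₀ u) (hM : 1 ≤ M) (hU : IsSIFD a b τ ε M u₀ U) (hτ : 0 < τ)
    (hτT : τ ≤ T) : ∃ V : Sobolev a b 4, ‖V‖ ≤ C₀ * τ ^ 2 ∧
      ∀ j ≤ M, err a b τ M u U 1 j = Sobolev.value V 0 (gridPt a b M j) := by
  have h0 : (0 : ℝ) ∈ Icc 0 T := left_mem_Icc.2 hT.le
  have hτm : τ ∈ Icc 0 T := ⟨hτ.le, hτT⟩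
  have hsub : Icc 0 τ ⊆ Icc 0 T := Icc_subset_Icc_right hτT
  refine ⟨R.U4 τ - R.U4 0 - τ • R.dU4 0, ?_, fun j hj => ?_⟩
  · refine norm_le_mul_sq_of_second_deriv (p := fun s => R.U4 s - R.U4 0 - s • R.dU4 0)
      (p₁ := fun s => R.dU4 s - R.dU4 0) (p₂ := R.ddU4) (h := τ) (fun s hs => ?_) (fun s hs => ?_)
      (by simp) (by simp) (fun s hs => R.bound4 s (hsub hs)) (right_mem_Icc.2 hτ.le)
    · have h2 := ((hasDerivAt_id s).smul_const (R.dU4 0)).hasDerivWithinAt (s := Icc 0 τ)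
      simp only [id_eq, one_smul] at h2
      exact (((R.deriv4 s (hsub hs)).mono hsub).sub_const (R.U4 0)).sub h2
    · exact ((R.deriv4' s (hsub hs)).mono hsub).sub_const (R.dU4 0)
  · have hx := gridPt_mem hab hM hj
    have e : Sobolev.value (R.U4 τ - R.U4 0 - τ • R.dU4 0) 0 (gridPt a b M j) =
        u (gridPt a b M j) τ - u (gridPt a b M j) 0 -
          τ * Sobolev.value (R.dU2 0) 0 (gridPt a b M j) := by
      change valueCLM hab (by norm_num : 0 < 4) hx _ = _
      rw [map_sub, map_sub, map_smul, valueCLM_apply, valueCLM_apply, valueCLM_apply,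
        (R.value_eq hab sol hτm hx).2.1, (R.value_eq hab sol h0 hx).2.1,
        R.dU4_value_eq hab hT sol h0 hx, Complex.real_smul]
    have heq := R.equation hab hT hε sol h0 hx
    rw [e, err, hU.first_step j hj, hU.initial j hj, ← sol.initial _ hx,
      R.iteratedDeriv_two_eq hab sol h0 (fun y hy => (sol.initial y hy).symm) hx, ← heq]
    rw [Nat.cast_one, one_mul]
    linear_combination ((τ : ℂ) * Sobolev.value (R.dU2 0) 0 (gridPt a b M j)) * Complex.I_mul_I

set_option maxHeartbeats 1000000 in
/-- The corrected solution satisfies the scheme up to a source `X` of second order, both in `L²`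
and in `H¹₀`. -/
theorem exists_source (R : RegularCurves a b T C₀ u) (hab : a < b) (hT : 0 < T) (hε : 0 < ε)
    (sol : IsSolution a b T ε u₀ u) (hM : 1 ≤ M) (hU : IsSIFD a b τ ε M u₀ U) (hτ : 0 < τ)
    (hh1 : mesh a b M ≤ 1) {k : ℕ} (hk : 1 ≤ k) (hkT : ((k + 1 : ℕ) : ℝ) * τ ≤ T) :
    ∃ X : ℕ → ℂ, X 0 = 0 ∧ X M = 0 ∧
      (∀ j ∈ Finset.Icc 1 (M - 1), Complex.I * ((R.correctedErr τ M U (k + 1) j -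
        R.correctedErr τ M U (k - 1) j) / (2 * (τ : ℂ))) = -(1 / 2) * dxx (mesh a b M)
        (fun i => R.correctedErr τ M U (k + 1) i + R.correctedErr τ M U (k - 1) i) j +
        (X j + (logNonlin ε (u (gridPt a b M j) (k * τ)) - logNonlin ε (U k j)))) ∧
      gridL2 (mesh a b M) M X ≤ 12 * C₀ * (mesh a b M ^ 2 + τ ^ 2) * (1 + 1 / T + T) ∧
      gridH1Semi (mesh a b M) M X ≤ 12 * C₀ * (mesh a b M ^ 2 + τ ^ 2) * (1 + 1 / T + T) := by
  have hh := mesh_pos hab hM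
  set h := mesh a b M with hh_def
  set t : ℝ := k * τ with ht_def
  have hk1 : (1 : ℝ) ≤ k := by exact_mod_cast hk
  have ep : ((k + 1 : ℕ) : ℝ) * τ = t + τ := by push_cast; ring
  have em : ((k - 1 : ℕ) : ℝ) * τ = t - τ := by rw [Nat.cast_sub hk]; push_cast; ring
  rw [ep] at hkT
  have htτ : 0 ≤ t - τ := by
    have := mul_le_mul_of_nonneg_right hk1 hτ.le
    linarith
  have hsub : Icc (t - τ) (t + τ) ⊆ Icc 0 T := Icc_subset_Icc htτ hkT
  have ht : t ∈ Icc 0 T := hsub ⟨by linarith, by linarith⟩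
  have htp : t + τ ∈ Icc 0 T := hsub ⟨by linarith, by linarith⟩
  have htm : t - τ ∈ Icc 0 T := hsub ⟨by linarith, by linarith⟩
  have hC₀ : 0 ≤ C₀ := (norm_nonneg _).trans (R.bound5 t ht)
  have hτc : (τ : ℂ) ≠ 0 := by exact_mod_cast hτ.ne'
  -- the average of the solution over the two outer time levels, to which the scheme applies
  -- the second difference
  set F : Sobolev a b 5 := (1 / 2 : ℝ) • (R.U5 (t + τ) + R.U5 (t - τ)) with hF
  -- truncation errors of the time discretization: `X₁` of the difference quotient, `X₂` of the
  -- average, and `X₃` the difference quotient that acts on the corrector; all three are elements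
  -- of Sobolev spaces, so that their grid norms are controlled by Sobolev norms
  set X₁ : Sobolev a b 2 := (1 / (2 * τ)) • (R.U2 (t + τ) - R.U2 (t - τ) - (2 * τ) • R.dU2 t)
    with hX₁
  set X₂ : Sobolev a b 4 := (1 / 2 : ℝ) • (R.U4 (t + τ) + R.U4 (t - τ) - (R.U4 t + R.U4 t)) with hX₂
  set X₃ : Sobolev a b 4 := (1 / (2 * τ)) • (R.U4 (t + τ) - R.U4 (t - τ)) with hX₃
  have nF : ‖F‖ ≤ C₀ := by
    rw [hF, norm_smul, Real.norm_of_nonneg (by norm_num)]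
    have := norm_add_le (R.U5 (t + τ)) (R.U5 (t - τ))
    linarith [R.bound5 _ htp, R.bound5 _ htm]
  have n₁ : ‖X₁‖ ≤ C₀ * τ ^ 2 := by
    rw [hX₁, norm_smul, Real.norm_of_nonneg (by positivity)]
    have := norm_centred_diff_sub_le (f := R.U2) (f₁ := R.dU2) (f₂ := R.ddU2) (f₃ := R.dddU2)
      (B := C₀) hτ.le (fun y hy => (R.deriv2 y (hsub hy)).mono hsub)
      (fun y hy => (R.deriv2' y (hsub hy)).mono hsub)
      (fun y hy => (R.deriv2'' y (hsub hy)).mono hsub) (fun y hy => R.bound2 y (hsub hy))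
    calc _ ≤ 1 / (2 * τ) * (2 * C₀ * τ ^ 3) := by gcongr
      _ = _ := by field_simp
  have n₂ : ‖X₂‖ ≤ C₀ * τ ^ 2 := by
    rw [hX₂, norm_smul, Real.norm_of_nonneg (by norm_num)]
    have := norm_symm_sum_sub_two_smul_le (f := R.U4) (f₁ := R.dU4) (f₂ := R.ddU4) (B := C₀) hτ.le
      (fun y hy => (R.deriv4 y (hsub hy)).mono hsub)
      (fun y hy => (R.deriv4' y (hsub hy)).mono hsub) (fun y hy => R.bound4 y (hsub hy))
    linarith
  have n₃ : ‖X₃‖ ≤ C₀ * (2 / T + T) := by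
    rw [hX₃, norm_smul, Real.norm_of_nonneg (by positivity)]
    have := (convex_Icc 0 T).norm_image_sub_le_of_norm_hasDerivWithin_le R.deriv4
      (fun s hs => R.norm_dU4_le hT hs) htm htp
    rw [show t + τ - (t - τ) = 2 * τ by ring, Real.norm_of_nonneg (by positivity)] at this
    calc _ ≤ 1 / (2 * τ) * (C₀ * (2 / T + T) * (2 * τ)) := by gcongr
      _ = _ := by field_simp
  -- the spatial truncation error, extended by zero to the end points, where the inverse inequality
  -- needs it to vanish
  set P : ℕ → ℂ := fun j => if j ∈ Finset.Icc 1 (M - 1) then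
      dxx h (fun i => Sobolev.value F 0 (gridPt a b M i)) j - Sobolev.value F 2 (gridPt a b M j) -
        (h : ℂ) ^ 2 / 12 * dxx h (fun i => Sobolev.value F 2 (gridPt a b M i)) j else 0 with hP
  have P0 : P 0 = 0 := by simp [hP]
  have PM : P M = 0 := by
    simp only [hP, Finset.mem_Icc]
    rw [if_neg (by omega)]
  have nP := gridL2_corrected_second_diff_le F hab hM (P := P) fun j hj => by
    simp only [hP, if_pos hj]; rw [← hh_def]
  rw [← hh_def] at nP
  have nP' : gridL2 h M P ≤ 6 * h ^ 3 * C₀ := nP.trans (by gcongr)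
  have nP'' : gridH1Semi h M P ≤ 12 * h ^ 2 * C₀ := by
    refine (gridH1Semi_le_of_boundary hh P0 PM).trans ?_
    calc 2 / h * gridL2 h M P ≤ 2 / h * (6 * h ^ 3 * C₀) := by gcongr
      _ = _ := by field_simp; ring
  -- point values of the four Sobolev functions
  have vF0 : ∀ x ∈ Icc a b, Sobolev.value F 0 x = (u x (t + τ) + u x (t - τ)) / 2 := by
    intro x hx
    change valueCLM hab (by norm_num : 0 < 5) hx _ = _
    rw [hF, map_smul, map_add, valueCLM_apply, valueCLM_apply, (R.value_eq hab sol htp hx).1,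
      (R.value_eq hab sol htm hx).1, Complex.real_smul]
    push_cast; ring
  have vF2 : ∀ x ∈ Icc a b, Sobolev.value F 2 x =
      (Sobolev.value (R.U5 (t + τ)) 2 x + Sobolev.value (R.U5 (t - τ)) 2 x) / 2 := by
    intro x hx
    change valueCLM hab (by norm_num : 2 < 5) hx _ = _
    rw [hF, map_smul, map_add, valueCLM_apply, valueCLM_apply, Complex.real_smul]
    push_cast; ring
  have v₁ : ∀ x ∈ Icc a b, Sobolev.value X₁ 0 x =
      (u x (t + τ) - u x (t - τ)) / (2 * τ) - Sobolev.value (R.dU2 t) 0 x := by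
    intro x hx
    change valueCLM hab (by norm_num : 0 < 2) hx _ = _
    rw [hX₁, map_smul, map_sub, map_sub, map_smul, valueCLM_apply, valueCLM_apply, valueCLM_apply,
      (R.value_eq hab sol htp hx).2.2, (R.value_eq hab sol htm hx).2.2, Complex.real_smul,
      Complex.real_smul]
    push_cast; field_simp
  have v₂ : ∀ x ∈ Icc a b, Sobolev.value X₂ 2 x = (Sobolev.value (R.U5 (t + τ)) 2 x +
      Sobolev.value (R.U5 (t - τ)) 2 x) / 2 - Sobolev.value (R.U5 t) 2 x := by
    intro x hx
    change valueCLM hab (by norm_num : 2 < 4) hx _ = _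
    rw [hX₂, map_smul, map_sub, map_add, map_add, valueCLM_apply, valueCLM_apply, valueCLM_apply,
      R.value_two_eq hab htp hx, R.value_two_eq hab htm hx, R.value_two_eq hab ht hx,
      Complex.real_smul]
    push_cast; ring
  have v₃ : ∀ x ∈ Icc a b, Sobolev.value X₃ 2 x = (Sobolev.value (R.U5 (t + τ)) 2 x -
      Sobolev.value (R.U5 (t - τ)) 2 x) / (2 * τ) := by
    intro x hx
    change valueCLM hab (by norm_num : 2 < 4) hx _ = _
    rw [hX₃, map_smul, map_sub, valueCLM_apply, valueCLM_apply,
      R.value_two_eq hab htp hx, R.value_two_eq hab htm hx, Complex.real_smul]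
    push_cast; field_simp
  -- all truncation errors in time vanish at the end points, because `u`, `∂ₜu` and `∂ₓₓu` do
  have ha := left_mem_Icc.2 hab.le
  have hb := right_mem_Icc.2 hab.le
  have bd : ∀ x ∈ Icc a b, (∀ s ∈ Icc 0 T, u x s = 0) → Sobolev.value (R.dU2 t) 0 x = 0 →
      (∀ s ∈ Icc 0 T, Sobolev.value (R.U5 s) 2 x = 0) →
      Sobolev.value X₁ 0 x = 0 ∧ Sobolev.value X₂ 2 x = 0 ∧ Sobolev.value X₃ 2 x = 0 := by
    intro x hx h1 h2 h3
    rw [v₁ x hx, v₂ x hx, v₃ x hx, h1 _ htp, h1 _ htm, h2, h3 _ htp, h3 _ htm, h3 _ ht]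
    simp
  have bda := bd a ha (fun s hs => (sol.boundary s hs).1) (R.dU2_boundary hab hT sol ht).1
    fun s hs => (R.U5_two_boundary hab hT hε sol hs).1
  have bdb := bd b hb (fun s hs => (sol.boundary s hs).2) (R.dU2_boundary hab hT sol ht).2
    fun s hs => (R.U5_two_boundary hab hT hε sol hs).2
  set G₁ : ℕ → ℂ := fun j => Sobolev.value X₁ 0 (gridPt a b M j) with hG₁
  set G₂ : ℕ → ℂ := fun j => Sobolev.value X₂ 2 (gridPt a b M j) with hG₂
  set G₃ : ℕ → ℂ := fun j => Sobolev.value X₃ 2 (gridPt a b M j) with hG₃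
  set c₃ : ℂ := -Complex.I * ((h : ℂ) ^ 2 / 12) with hc₃
  have nc₃ : ‖c₃‖ = h ^ 2 / 12 := by
    rw [hc₃, norm_mul, norm_neg, Complex.norm_I, one_mul, norm_mesh_sq_div]
  refine ⟨fun j => ((Complex.I * G₁ j + P j) + (G₂ j + c₃ * G₃ j)), ?_, ?_, fun j hj => ?_, ?_, ?_⟩
  · simp only [hG₁, hG₂, hG₃, gridPt_zero, bda.1, bda.2.1, bda.2.2, P0]; simp
  · simp only [hG₁, hG₂, hG₃, gridPt_last hM, bdb.1, bdb.2.1, bdb.2.2, PM]; simp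
  · have hjI := gridPt_mem_Ioo hab hM hj
    have hx := Ioo_subset_Icc_self hjI
    have hstep := hU.step k hk j hj
    have heq := R.equation hab hT hε sol ht hx
    have hj' := Finset.mem_Icc.1 hj
    have hx1 := gridPt_mem hab hM (j := j + 1) (by omega)
    have hx0 := gridPt_mem hab hM (j := j - 1) (by omega)
    rw [← heq]
    simp only [hG₁, hG₂, hG₃, hP, if_pos hj, correctedErr, corrector, err, dxx, ep, em,
      v₁ _ hx, v₂ _ hx, v₃ _ hx, vF0 _ hx, vF0 _ hx1, vF0 _ hx0, vF2 _ hx, vF2 _ hx1, vF2 _ hx0,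
      dtc, ← hh_def, hc₃] at hstep ⊢
    linear_combination -hstep
  · have g₁ := gridL2_value_le X₁ hab (k := 0) (by norm_num) hM hh1
    have g₂ := gridL2_value_le X₂ hab (k := 2) (by norm_num) hM hh1
    have g₃ := gridL2_value_le X₃ hab (k := 2) (by norm_num) hM hh1
    rw [← hh_def] at g₁ g₂ g₃
    have s1 := gridL2_add_le hh.le M (fun j => Complex.I * G₁ j + P j)
      (fun j => G₂ j + c₃ * G₃ j)
    have s2 := gridL2_add_le hh.le M (fun j => Complex.I * G₁ j) P
    have s3 := gridL2_add_le hh.le M G₂ (fun j => c₃ * G₃ j)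
    rw [gridL2_mul_left, Complex.norm_I, one_mul] at s2
    rw [gridL2_mul_left, nc₃] at s3
    have s4 : h ^ 2 / 12 * gridL2 h M G₃ ≤ h ^ 2 / 12 * (2 * (C₀ * (2 / T + T))) := by
      gcongr
      exact g₃.trans (by gcongr)
    have s5 : 6 * h ^ 3 * C₀ ≤ 6 * h ^ 2 * C₀ := by
      have : h ^ 3 ≤ h ^ 2 := pow_le_pow_of_le_one hh.le hh1 (by norm_num)
      gcongr
    have s6 : 2 / T = 2 * (1 / T) := by ring
    have p1 : 0 ≤ C₀ * h ^ 2 * (1 / T) := by positivity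
    have p2 : 0 ≤ C₀ * h ^ 2 * T := by positivity
    have p3 : 0 ≤ C₀ * τ ^ 2 * (1 / T) := by positivity
    have p4 : 0 ≤ C₀ * τ ^ 2 * T := by positivity
    have p5 : 0 ≤ C₀ * τ ^ 2 := by positivity
    have p6 : 0 ≤ C₀ * h ^ 2 := by positivity
    rw [s6] at s4
    linarith
  · have g₁ := gridH1Semi_value_le X₁ hab 0 hM
    have g₂ := gridH1Semi_value_le X₂ hab 2 hM
    have g₃ := gridH1Semi_value_le X₃ hab 2 hM
    rw [← hh_def] at g₁ g₂ g₃
    have s1 := gridH1Semi_add_le hh.le M (fun j => Complex.I * G₁ j + P j)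
      (fun j => G₂ j + c₃ * G₃ j)
    have s2 := gridH1Semi_add_le hh.le M (fun j => Complex.I * G₁ j) P
    have s3 := gridH1Semi_add_le hh.le M G₂ (fun j => c₃ * G₃ j)
    rw [gridH1Semi_mul_left, Complex.norm_I, one_mul] at s2
    rw [gridH1Semi_mul_left, nc₃] at s3
    have s4 : h ^ 2 / 12 * gridH1Semi h M G₃ ≤ h ^ 2 / 12 * (C₀ * (2 / T + T)) := by
      gcongr
      exact g₃.trans n₃
    have s6 : 2 / T = 2 * (1 / T) := by ring
    have p1 : 0 ≤ C₀ * h ^ 2 * (1 / T) := by positivity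
    have p2 : 0 ≤ C₀ * h ^ 2 * T := by positivity
    have p3 : 0 ≤ C₀ * τ ^ 2 * (1 / T) := by positivity
    have p4 : 0 ≤ C₀ * τ ^ 2 * T := by positivity
    have p5 : 0 ≤ C₀ * τ ^ 2 := by positivity
    rw [s6] at s4
    linarith

end RegularCurves

end Consistency

/-! ### Error estimates -/

section Nonlinear

variable {h ε B C₀ : ℝ} {M : ℕ} {v w : ℕ → ℂ}

theorem gridL2_logNonlin_sub_le (hh : 0 ≤ h) (hε : 0 < ε) (hε1 : ε < 1) (hB : 0 ≤ B)
    (hv : ∀ j ≤ M, ‖v j‖ ≤ B) (hw : ∀ j ≤ M, ‖w j‖ ≤ B) :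
    gridL2 h M (fun j => logNonlin ε (v j) - logNonlin ε (w j)) ≤
      (2 * |Real.log ε| + 2 * B + 2) * gridL2 h M (fun j => v j - w j) := by
  set L : ℝ := 2 * |Real.log ε| + 2 * B + 2 with hL
  have hL0 : 0 ≤ L := by positivity
  have e : L * gridL2 h M (fun j => v j - w j) = gridL2 h M (fun j => (L : ℂ) * (v j - w j)) := by
    rw [gridL2_mul_left, Complex.norm_real, Real.norm_of_nonneg hL0]
  rw [e]
  refine l2Norm_mono hh fun j hj => ?_
  rw [Finset.mem_Icc] at hj
  rw [norm_mul, Complex.norm_real, Real.norm_of_nonneg hL0]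
  exact norm_logNonlin_sub_le hε hε1 (hv j (by omega)) (hw j (by omega))

theorem gridH1Semi_logNonlin_sub_le (hh : 0 < h) (hε : 0 < ε) (hε1 : ε < 1) (hB : 0 ≤ B)
    (hC₀ : 0 ≤ C₀) (hw : ∀ j ≤ M, ‖w j‖ ≤ B)
    (hlip : ∀ j < M, ‖v (j + 1) - v j‖ ≤ 2 * C₀ * h) (h0 : v 0 - w 0 = 0) (hM : v M - w M = 0) :
    gridH1Semi h M (fun j => logNonlin ε (v j) - logNonlin ε (w j)) ≤
      (2 * |Real.log ε| + 2 * B + 2) * gridH1Semi h M (fun j => v j - w j) +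
        40 * C₀ / ε * gridL2 h M (fun j => v j - w j) := by
  set L : ℝ := 2 * |Real.log ε| + 2 * B + 2 with hL
  have hL0 : 0 ≤ L := by positivity
  set e : ℕ → ℂ := fun j => v j - w j with he
  set c : ℝ := 20 * C₀ / ε with hc
  have hc0 : 0 ≤ c := by positivity
  set s := Finset.range M
  -- real-valued majorants, viewed as complex-valued grid functions
  set m₁ : ℕ → ℂ := fun j => (L : ℂ) * dxPlus h e j with hm₁
  set m₂ : ℕ → ℂ := fun j => (c : ℂ) * ((‖e j‖ : ℝ) : ℂ) with hm₂
  set m₃ : ℕ → ℂ := fun j => (c : ℂ) * ((‖e (j + 1)‖ : ℝ) : ℂ) with hm₃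
  set m : ℕ → ℂ := fun j => ((‖m₁ j‖ : ℝ) : ℂ) + (m₂ j + m₃ j) with hm
  have hmn : ∀ j, ‖m j‖ = L * ‖dxPlus h e j‖ + (c * ‖e j‖ + c * ‖e (j + 1)‖) := by
    intro j
    have e1 : m j = ((L * ‖dxPlus h e j‖ + (c * ‖e j‖ + c * ‖e (j + 1)‖) : ℝ) : ℂ) := by
      simp only [hm, hm₁, hm₂, hm₃, norm_mul, Complex.norm_real, Real.norm_of_nonneg hL0]
      push_cast
      ring
    rw [e1, Complex.norm_real, Real.norm_of_nonneg (by positivity)]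
  have step : gridH1Semi h M (fun j => logNonlin ε (v j) - logNonlin ε (w j)) ≤ l2Norm h s m := by
    refine l2Norm_mono hh.le fun j hj => ?_
    rw [Finset.mem_range] at hj
    rw [hmn, dxPlus, norm_div, Complex.norm_real, Real.norm_of_nonneg hh.le, div_le_iff₀ hh]
    have h1 := norm_logNonlin_sub_sub_le hε hε1 (E := ‖e j‖ + ‖e (j + 1)‖) (hw j hj.le)
      (hw (j + 1) hj) (z₀ := v j) (z₁ := v (j + 1)) (le_add_of_nonneg_right (norm_nonneg _))
      (le_add_of_nonneg_left (norm_nonneg _))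
    have h2 : ‖(v (j + 1) - w (j + 1)) - (v j - w j)‖ = ‖dxPlus h e j‖ * h := by
      rw [dxPlus, norm_div, Complex.norm_real, Real.norm_of_nonneg hh.le]
      field_simp
      rfl
    rw [h2] at h1
    refine h1.trans ?_
    calc _ ≤ L * (‖dxPlus h e j‖ * h) + 10 / ε * (‖e j‖ + ‖e (j + 1)‖) * (2 * C₀ * h) := by
          gcongr
          exact hlip j hj
      _ = _ := by rw [hc]; ring
  have n₁ : l2Norm h s (fun j => ((‖m₁ j‖ : ℝ) : ℂ)) = L * gridH1Semi h M e := by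
    have : l2Norm h s (fun j => ((‖m₁ j‖ : ℝ) : ℂ)) = l2Norm h s m₁ := by simp [l2Norm]
    rw [this, hm₁, l2Norm_mul_left, Complex.norm_real, Real.norm_of_nonneg hL0]
    rfl
  have n₂ : l2Norm h s m₂ = c * gridL2 h M e := by
    rw [hm₂, l2Norm_mul_left, Complex.norm_real, Real.norm_of_nonneg hc0,
      ← l2Norm_range_eq_gridL2 h h0]
    simp [l2Norm, s]
  have n₃ : l2Norm h s m₃ = c * gridL2 h M e := by
    rw [hm₃, l2Norm_mul_left, Complex.norm_real, Real.norm_of_nonneg hc0,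
      ← l2Norm_range_succ_eq_gridL2 h hM]
    simp [l2Norm, s]
  have s1 := l2Norm_add_le hh.le s (fun j => ((‖m₁ j‖ : ℝ) : ℂ)) (fun j => m₂ j + m₃ j)
  have s2 := l2Norm_add_le hh.le s m₂ m₃
  have e2 : 40 * C₀ / ε = 2 * c := by rw [hc]; ring
  rw [e2]
  linarith

end Nonlinear

section Bootstrap

variable {a b T C₀ ε τ : ℝ} {M : ℕ} {u₀ : ℝ → ℂ} {u : ℝ → ℝ → ℂ} {U : ℕ → ℕ → ℂ}

namespace RegularCurves

/-- One step of the error estimates, as long as the error at the current time is at most one. -/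
theorem step_le (R : RegularCurves a b T C₀ u) (hab : a < b) (hT : 0 < T) (hε : 0 < ε)
    (hε1 : ε < 1) (sol : IsSolution a b T ε u₀ u) (hM : 1 ≤ M) (hU : IsSIFD a b τ ε M u₀ U)
    (hτ : 0 < τ) (hh1 : mesh a b M ≤ 1) {k : ℕ} (hk : 1 ≤ k) (hkT : ((k + 1 : ℕ) : ℝ) * τ ≤ T)
    (hgood : ∀ j ≤ M, ‖err a b τ M u U k j‖ ≤ 1) {L ρ : ℝ}
    (hL : L = 2 * |Real.log ε| + 2 * (2 * C₀ + 1) + 2)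
    (hρ : ρ = 12 * C₀ * (mesh a b M ^ 2 + τ ^ 2) * (1 + 1 / T + T) + L * (C₀ * mesh a b M ^ 2)) :
    gridL2 (mesh a b M) M (R.correctedErr τ M U (k + 1)) ≤
      gridL2 (mesh a b M) M (R.correctedErr τ M U (k - 1)) +
        2 * τ * (L * gridL2 (mesh a b M) M (R.correctedErr τ M U k) + ρ) ∧
    gridH1Semi (mesh a b M) M (R.correctedErr τ M U (k + 1)) ≤
      gridH1Semi (mesh a b M) M (R.correctedErr τ M U (k - 1)) +
        2 * τ * (L * gridH1Semi (mesh a b M) M (R.correctedErr τ M U k) +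
          (ρ + 40 * C₀ / ε * gridL2 (mesh a b M) M (err a b τ M u U k))) := by
  have hh := mesh_pos hab hM
  have ht1 := natCast_mul_mem_Icc hτ hkT
  have ht : (k : ℝ) * τ ∈ Icc 0 T := natCast_mul_mem_Icc hτ
    ((mul_le_mul_of_nonneg_right (by push_cast; linarith) hτ.le).trans hkT)
  have ht0 : ((k - 1 : ℕ) : ℝ) * τ ∈ Icc 0 T := natCast_mul_mem_Icc hτ
    ((mul_le_mul_of_nonneg_right (by exact_mod_cast (by omega)) hτ.le).trans hkT)
  have hC₀ : 0 ≤ C₀ := (norm_nonneg _).trans (R.bound5 _ ht)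
  obtain ⟨X, X0, XM, hX, nX, nX'⟩ := R.exists_source hab hT hε sol hM hU hτ hh1 hk hkT
  have b1 := R.correctedErr_boundary hab hT hε sol hM hU ht1
  have b0 := R.correctedErr_boundary hab hT hε sol hM hU ht0
  have eb := err_boundary hM sol hU ht
  set v : ℕ → ℂ := fun j => u (gridPt a b M j) (k * τ) with hv
  have hvB : ∀ j ≤ M, ‖v j‖ ≤ 2 * C₀ + 1 := fun j hj =>
    (R.norm_u_le hab sol ht (gridPt_mem hab hM hj)).trans (by linarith)
  have hUB : ∀ j ≤ M, ‖U k j‖ ≤ 2 * C₀ + 1 := fun j hj => by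
    have h1 := hgood j hj
    have h2 := R.norm_u_le hab sol ht (gridPt_mem hab hM hj)
    have h3 : U k j = v j - err a b τ M u U k j := by rw [err]; ring
    rw [h3]
    exact (norm_sub_le _ _).trans (add_le_add h2 h1)
  have hLip : ∀ j < M, ‖v (j + 1) - v j‖ ≤ 2 * C₀ * mesh a b M := fun j hj => by
    have := R.norm_u_sub_le hab sol ht (gridPt_mem hab hM (Nat.succ_le_of_lt hj))
      (gridPt_mem hab hM hj.le)
    rwa [Nat.succ_eq_add_one, gridPt_succ, add_sub_cancel_left, abs_of_pos hh, ← gridPt_succ]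
      at this
  have hB : 0 ≤ 2 * C₀ + 1 := by linarith
  have nN := gridL2_logNonlin_sub_le hh.le hε hε1 hB hvB hUB
  have nN' := gridH1Semi_logNonlin_sub_le hh hε hε1 hB hC₀ hUB hLip eb.1 eb.2
  rw [← hL] at nN nN'
  have hL0 : 0 ≤ L := by rw [hL]; positivity
  change gridL2 _ _ _ ≤ L * gridL2 _ _ (err a b τ M u U k) at nN
  change gridH1Semi _ _ _ ≤ L * gridH1Semi _ _ (err a b τ M u U k) +
    40 * C₀ / ε * gridL2 _ _ (err a b τ M u U k) at nN'
  have e1 := mul_le_mul_of_nonneg_left (R.gridL2_err_le (U := U) hab hM hh1 ht) hL0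
  have e2 := mul_le_mul_of_nonneg_left (R.gridH1Semi_err_le (U := U) hab hM ht) hL0
  have a1 := gridL2_add_le hh.le M X (fun j => logNonlin ε (v j) - logNonlin ε (U k j))
  have a2 := gridH1Semi_add_le hh.le M X (fun j => logNonlin ε (v j) - logNonlin ε (U k j))
  constructor
  · refine (gridL2_leapfrog_le hh hτ b1.1 b1.2 b0.1 b0.2 hX).trans (add_le_add le_rfl ?_)
    refine mul_le_mul_of_nonneg_left ?_ (by linarith)
    change gridL2 _ _ (fun j => X j + (logNonlin ε (v j) - logNonlin ε (U k j))) ≤ _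
    rw [hρ]
    linarith
  · refine (gridH1Semi_leapfrog_le hh hτ b1.1 b1.2 b0.1 b0.2 ?_ ?_ hX).trans
      (add_le_add le_rfl ?_)
    · rw [X0, gridPt_zero, (sol.boundary _ ht).1, (hU.boundary k).1]; simp
    · rw [XM, gridPt_last hM, (sol.boundary _ ht).2, (hU.boundary k).2]; simp
    refine mul_le_mul_of_nonneg_left ?_ (by linarith)
    change gridH1Semi _ _ (fun j => X j + (logNonlin ε (v j) - logNonlin ε (U k j))) ≤ _
    rw [hρ]
    linarith

theorem initial_le (R : RegularCurves a b T C₀ u) (hab : a < b) (hT : 0 < T) (hε : 0 < ε)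
    (sol : IsSolution a b T ε u₀ u) (hM : 1 ≤ M) (hU : IsSIFD a b τ ε M u₀ U)
    (hτ : 0 < τ) (hh1 : mesh a b M ≤ 1) :
    (gridL2 (mesh a b M) M (R.correctedErr τ M U 0) ≤ 2 * C₀ * (mesh a b M ^ 2 + τ ^ 2) ∧
      gridH1Semi (mesh a b M) M (R.correctedErr τ M U 0) ≤ 2 * C₀ * (mesh a b M ^ 2 + τ ^ 2)) ∧
    (τ ≤ T →
      gridL2 (mesh a b M) M (R.correctedErr τ M U 1) ≤ 2 * C₀ * (mesh a b M ^ 2 + τ ^ 2) ∧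
      gridH1Semi (mesh a b M) M (R.correctedErr τ M U 1) ≤ 2 * C₀ * (mesh a b M ^ 2 + τ ^ 2)) := by
  have h0 : ((0 : ℕ) : ℝ) * τ ∈ Icc 0 T := by simp [hT.le]
  have hC₀ : 0 ≤ C₀ := (norm_nonneg _).trans (R.bound5 _ h0)
  have p1 : 0 ≤ C₀ * mesh a b M ^ 2 := by positivity
  have p2 : 0 ≤ C₀ * τ ^ 2 := by positivity
  have hz : ∀ j ≤ M, err a b τ M u U 0 j = 0 * 0 := fun j hj => by
    rw [err_zero hab hM sol hU hj, mul_zero]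
  refine ⟨⟨?_, ?_⟩, fun hτT => ?_⟩
  · refine (R.gridL2_correctedErr_le hab hM hh1 h0).trans ?_
    rw [gridL2_congr _ hz, gridL2_mul_left, norm_zero]
    linarith
  · refine (R.gridH1Semi_correctedErr_le hab hM h0).trans ?_
    rw [gridH1Semi_congr _ hz, gridH1Semi_mul_left, norm_zero]
    linarith
  · have h1 : ((1 : ℕ) : ℝ) * τ ∈ Icc 0 T := natCast_mul_mem_Icc hτ (by simpa using hτT)
    obtain ⟨V, hV, hVe⟩ := R.exists_err_one_eq hab hT hε sol hM hU hτ hτT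
    constructor
    · refine (R.gridL2_correctedErr_le hab hM hh1 h1).trans ?_
      rw [gridL2_congr _ hVe]
      have := gridL2_value_le V hab (k := 0) (by norm_num) hM hh1
      linarith
    · refine (R.gridH1Semi_correctedErr_le hab hM h1).trans ?_
      rw [gridH1Semi_congr _ hVe]
      have := gridH1Semi_value_le V hab 0 hM
      linarith

end RegularCurves

/-- Elementary estimate of the bound produced by the Gronwall inequality in `L²`. -/
theorem exp_mul_le_of_L2 {L h : ℝ} (hL : 0 ≤ L) (hT : 0 < T) (hC₀ : 0 ≤ C₀) :
    Real.exp (2 * L * T) * (2 * C₀ * (h ^ 2 + τ ^ 2) + 2 * T * (12 * C₀ * (h ^ 2 + τ ^ 2) *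
      (1 + 1 / T + T) + L * (C₀ * h ^ 2))) + C₀ * h ^ 2 ≤
      28 * C₀ * Real.exp ((2 + 4 * L) * T) * (h ^ 2 + τ ^ 2) := by
  set δ := h ^ 2 + τ ^ 2 with hδ
  have hδ0 : 0 ≤ δ := by positivity
  have hhδ : h ^ 2 ≤ δ := by rw [hδ]; linarith [sq_nonneg τ]
  set A := Real.exp (2 * L * T) with hA
  set B := Real.exp (2 * T) with hB
  have e : Real.exp ((2 + 4 * L) * T) = B * A * A := by
    rw [hA, hB, ← Real.exp_add, ← Real.exp_add]; congr 1; ring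
  have hA1 : 1 ≤ A := Real.one_le_exp (by positivity)
  have hB1 : 1 ≤ B := Real.one_le_exp (by positivity)
  have hLA : 2 * T * L ≤ A := by
    have := Real.add_one_le_exp (2 * L * T); rw [← hA] at this; linarith
  -- powers of `T`, which the constants must not contain, are absorbed by the exponential
  have hTB : 1 + T + T ^ 2 ≤ B := by
    have h1 := Real.add_one_le_exp T
    have h2 : B = Real.exp T * Real.exp T := by rw [hB, ← Real.exp_add]; congr 1; ring
    rw [h2]
    nlinarith
  have hCδ : 0 ≤ C₀ * δ := by positivity
  have hBA : 1 ≤ B * A := by nlinarith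
  have h1 : 2 * C₀ * δ + 2 * T * (12 * C₀ * δ * (1 + 1 / T + T) + L * (C₀ * h ^ 2)) ≤
      C₀ * δ * (27 * (B * A)) := by
    have e1 : 2 * C₀ * δ + 2 * T * (12 * C₀ * δ * (1 + 1 / T + T) + L * (C₀ * h ^ 2)) =
        C₀ * δ * (2 + 24 * (1 + T + T ^ 2)) + 2 * T * L * (C₀ * h ^ 2) := by
      field_simp; ring
    have e2 : 2 * T * L * (C₀ * h ^ 2) ≤ A * (C₀ * δ) := by gcongr
    have e3 : A ≤ B * A := le_mul_of_one_le_left (by linarith) hB1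
    have e4 : B ≤ B * A := le_mul_of_one_le_right (by linarith) hA1
    rw [e1]
    calc _ ≤ C₀ * δ * (2 + 24 * (1 + T + T ^ 2)) + A * (C₀ * δ) := by linarith
      _ = C₀ * δ * (2 + 24 * (1 + T + T ^ 2) + A) := by ring
      _ ≤ _ := mul_le_mul_of_nonneg_left (by linarith) hCδ
  rw [e]
  have hBAA : 1 ≤ B * A * A := by nlinarith
  calc _ ≤ A * (C₀ * δ * (27 * (B * A))) + C₀ * δ * (B * A * A) := by
        refine add_le_add (mul_le_mul_of_nonneg_left h1 (by linarith)) ?_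
        calc C₀ * h ^ 2 ≤ C₀ * δ := by gcongr
          _ ≤ _ := le_mul_of_one_le_right hCδ hBAA
    _ = _ := by ring

/-- The exponent bookkeeping behind the `H¹` estimate: inserting the `L²` error bound into the
Grönwall bound costs one more power of the growth factor and a factor `1 / ε`. -/
theorem exp_mul_le_of_H1 {L T C₀ ε G δ h ρ : ℝ} (hL0 : 0 ≤ L) (hT : 0 < T) (hC₀ : 0 ≤ C₀)
    (hε : 0 < ε) (hε1 : ε ≤ 1) (hδ0 : 0 ≤ δ) (hG : G = Real.exp ((2 + 4 * L) * T))
    (key : Real.exp (2 * L * T) * (2 * C₀ * δ + 2 * T * ρ) + C₀ * h ^ 2 ≤ 28 * C₀ * G * δ) :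
    Real.exp (2 * L * T) * (2 * C₀ * δ + 2 * T * (ρ + 40 * C₀ / ε * (28 * C₀ * G * δ))) +
      C₀ * h ^ 2 ≤ (28 * C₀ + 1120 * C₀ ^ 2) / ε * G ^ 2 * δ := by
  have hG1 : 1 ≤ G := by rw [hG]; exact Real.one_le_exp (by positivity)
  have h2 : Real.exp (2 * L * T) * (2 * T) ≤ G := by
    have e : G = Real.exp (2 * L * T) * Real.exp ((2 + 2 * L) * T) := by
      rw [hG, ← Real.exp_add]; congr 1; ring
    rw [e]
    have h3 := Real.add_one_le_exp ((2 + 2 * L) * T)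
    have h4 : 0 ≤ L * T := by positivity
    gcongr
    linarith
  have h6 : (Real.exp (2 * L * T) * (2 * T)) * (40 * C₀ / ε * (28 * C₀ * G * δ)) ≤
      G * (40 * C₀ / ε * (28 * C₀ * G * δ)) := by gcongr
  have h7 : 28 * C₀ * G * δ ≤ 28 * C₀ / ε * G ^ 2 * δ := by
    have : 28 * C₀ ≤ 28 * C₀ / ε := le_div_self (by positivity) hε hε1
    have : G ≤ G ^ 2 := le_self_pow₀ hG1 two_ne_zero
    gcongr
  calc _ = (Real.exp (2 * L * T) * (2 * C₀ * δ + 2 * T * ρ) + C₀ * h ^ 2) +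
          (Real.exp (2 * L * T) * (2 * T)) * (40 * C₀ / ε * (28 * C₀ * G * δ)) := by ring
    _ ≤ 28 * C₀ / ε * G ^ 2 * δ + G * (40 * C₀ / ε * (28 * C₀ * G * δ)) := by linarith
    _ = _ := by ring

/-- Error estimates and boundedness of the numerical solution, by induction over the time levels. -/
theorem RegularCurves.error_bounds (R : RegularCurves a b T C₀ u) (hab : a < b) (hT : 0 < T)
    (hε : 0 < ε) (hε1 : ε < 1) (sol : IsSolution a b T ε u₀ u) (hM : 1 ≤ M)
    (hU : IsSIFD a b τ ε M u₀ U) (hτ : 0 < τ) (hh1 : mesh a b M ≤ 1) {G K δ : ℝ}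
    (hG : G = Real.exp ((2 + 4 * (2 * |Real.log ε| + 2 * (2 * C₀ + 1) + 2)) * T))
    (hK : K = 28 * C₀ + 1120 * C₀ ^ 2) (hδ : δ = mesh a b M ^ 2 + τ ^ 2)
    (hsmall : 2 * (28 * C₀ * G * δ * (K / ε * G ^ 2 * δ)) ≤ 1) (k : ℕ) (hk : (k : ℝ) * τ ≤ T) :
    gridL2 (mesh a b M) M (err a b τ M u U k) ≤ 28 * C₀ * G * δ ∧
    gridH1Semi (mesh a b M) M (err a b τ M u U k) ≤ K / ε * G ^ 2 * δ ∧
    ∀ j ≤ M, ‖err a b τ M u U k j‖ ≤ 1 := by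
  have hh := mesh_pos hab hM
  have hC₀ : 0 ≤ C₀ := (norm_nonneg _).trans (R.bound5 _ (left_mem_Icc.2 hT.le))
  set h := mesh a b M with hh_def
  set L : ℝ := 2 * |Real.log ε| + 2 * (2 * C₀ + 1) + 2 with hL
  have hL0 : 0 ≤ L := by positivity
  have hδ0 : 0 ≤ δ := by rw [hδ]; positivity
  have hG1 : 1 ≤ G := by rw [hG]; exact Real.one_le_exp (by positivity)
  set ρ : ℝ := 12 * C₀ * (h ^ 2 + τ ^ 2) * (1 + 1 / T + T) + L * (C₀ * h ^ 2) with hρ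
  have hρ0 : 0 ≤ ρ := by positivity
  -- only the first time level of the scheme needs `τ ≤ T`; otherwise `k = 0` is the only level
  obtain ⟨⟨i0, i0'⟩, i1⟩ := R.initial_le hab hT hε sol hM hU hτ hh1
  rw [← hh_def, ← hδ] at i0 i0' i1
  have key := exp_mul_le_of_L2 (τ := τ) (h := h) hL0 hT hC₀
  rw [← hρ, ← hδ, ← hG] at key
  have hS : 0 ≤ 2 * C₀ * δ := by positivity
  induction k using Nat.strong_induction_on with
  | _ k ih =>
    have ht := natCast_mul_mem_Icc hτ hk
    have hlt : ∀ i, i < k → (i : ℝ) * τ ≤ T := fun i hi =>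
      (mul_le_mul_of_nonneg_right (by exact_mod_cast hi.le) hτ.le).trans hk
    have hτT : 1 ≤ k → τ ≤ T := fun h1 => by
      have : (1 : ℝ) * τ ≤ k * τ := mul_le_mul_of_nonneg_right (by exact_mod_cast h1) hτ.le
      linarith
    have hstep : ∀ i, 1 ≤ i → i < k → _ := fun i h1 h2 =>
      R.step_le hab hT hε hε1 sol hM hU hτ hh1 h1
        ((mul_le_mul_of_nonneg_right (by exact_mod_cast h2) hτ.le).trans hk)
        (ih i h2 (hlt i h2)).2.2 hL hρ
    have mono : ∀ ρ' : ℝ, 0 ≤ ρ' →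
        Real.exp (2 * L * (τ * k)) * (2 * C₀ * δ + 2 * (τ * k) * ρ') ≤
        Real.exp (2 * L * T) * (2 * C₀ * δ + 2 * T * ρ') := by
      intro ρ' hρ'
      rw [mul_comm τ]
      gcongr
    have g1 := gronwall_leapfrog (x := fun i => gridL2 h M (R.correctedErr τ M U i)) hτ.le hL0
      hρ0 hS (n := k) i0 (fun h1 => (i1 (hτT h1)).1) (fun i h1 h2 => (hstep i h1 h2).1) k le_rfl
    have r1 : gridL2 h M (err a b τ M u U k) ≤ 28 * C₀ * G * δ := by
      refine (R.gridL2_err_le hab hM hh1 ht).trans (le_trans ?_ key)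
      exact add_le_add (g1.trans (mono ρ hρ0)) le_rfl
    set ρ' : ℝ := ρ + 40 * C₀ / ε * (28 * C₀ * G * δ) with hρ'
    have hρ'0 : 0 ≤ ρ' := by positivity
    have g2 := gronwall_leapfrog (x := fun i => gridH1Semi h M (R.correctedErr τ M U i)) hτ.le hL0
      hρ'0 hS (n := k) i0' (fun h1 => (i1 (hτT h1)).2) (fun i h1 h2 => by
        refine (hstep i h1 h2).2.trans ?_
        have := (ih i h2 (hlt i h2)).1
        rw [hρ']
        gcongr) k le_rfl
    have r2 : gridH1Semi h M (err a b τ M u U k) ≤ K / ε * G ^ 2 * δ := by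
      have h1 := (R.gridH1Semi_err_le (U := U) hab hM ht).trans
        (add_le_add (g2.trans (mono ρ' hρ'0)) le_rfl)
      rw [← hh_def] at h1
      rw [hK]
      exact h1.trans (exp_mul_le_of_H1 hL0 hT hC₀ hε hε1.le hδ0 hG key)
    refine ⟨r1, r2, fun j hj => ?_⟩
    have eb := err_boundary hM sol hU ht
    have h1 := norm_sq_le_gridL2_mul_gridH1Semi hh eb.1 eb.2 hj
    have h2 : gridL2 h M (err a b τ M u U k) * gridH1Semi h M (err a b τ M u U k) ≤
        28 * C₀ * G * δ * (K / ε * G ^ 2 * δ) :=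
      mul_le_mul r1 r2 (gridH1Semi_nonneg _ _ _) (by positivity)
    refine abs_le_of_sq_le_sq' ?_ zero_le_one |>.2
    linarith

end Bootstrap

end RLogSE

theorem theorem3p1 (C₀ ε₀ : ℝ) (hC₀ : 0 < C₀) (hε₀ : 0 < ε₀) (hε₀1 : ε₀ < 1) :
    ∃ C c K : ℝ, 0 < C ∧ 0 < c ∧ 0 < K ∧
      ∀ (a b T ε : ℝ), a < b → 0 < T → 0 < ε → ε ≤ ε₀ →
      ∀ (u₀ : ℝ → ℂ) (u : ℝ → ℝ → ℂ),
        RLogSE.IsSolution a b T ε u₀ u → RLogSE.RegularWithBound a b T C₀ u →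
      ∀ (M : ℕ) (τ : ℝ) (U : ℕ → ℕ → ℂ), 1 ≤ M →
        RLogSE.IsSIFD a b τ ε M u₀ U →
        RLogSE.mesh a b M ≤ c * √ε * Real.exp (-(C * T * |Real.log ε| ^ 2)) →
        τ ≤ c * √ε * Real.exp (-(C * T * |Real.log ε| ^ 2)) →
        RLogSE.StabilityCondition T τ ε M U →
      ∀ k : ℕ, (k : ℝ) ≤ T / τ →
        RLogSE.gridL2 (RLogSE.mesh a b M) M (RLogSE.err a b τ M u U k) ≤
          K * Real.exp (C * T * |Real.log ε| ^ 2) * (RLogSE.mesh a b M ^ 2 + τ ^ 2) ∧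
        RLogSE.gridH1 (RLogSE.mesh a b M) M (RLogSE.err a b τ M u U k) ≤
          K / ε * Real.exp (C * T * |Real.log ε| ^ 2) * (RLogSE.mesh a b M ^ 2 + τ ^ 2) ∧
        RLogSE.gridSup M (U k) ≤ RLogSE.spaceTimeSup a b T u + 1 := by
  set l₀ := |Real.log ε₀| with hl₀
  have hl₀0 : 0 < l₀ := abs_pos.2 (Real.log_neg hε₀ hε₀1).ne
  set D : ℝ := 4 + 8 * (2 * (2 * C₀ + 1) + 2) with hD
  have hD0 : 0 < D := by positivity
  set K : ℝ := 56 * C₀ + 1120 * C₀ ^ 2 with hK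
  have hK0 : 0 < K := by positivity
  refine ⟨D / l₀ ^ 2 + 16 / l₀, 1 / (1 + 8 * K ^ 2), K, by positivity, by positivity, hK0, ?_⟩
  intro a b T ε hab hT hε hεε₀ u₀ u sol hreg M τ U hM hU hh hτc hstab k hk
  obtain ⟨R⟩ := hreg.nonempty_regularCurves hT hC₀.le
  set C : ℝ := D / l₀ ^ 2 + 16 / l₀ with hC
  set c : ℝ := 1 / (1 + 8 * K ^ 2) with hc
  set l := |Real.log ε| with hl
  set h := RLogSE.mesh a b M with hh_def
  set δ := h ^ 2 + τ ^ 2 with hδ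
  set E := Real.exp (C * T * l ^ 2) with hE
  have hε1 : ε < 1 := hεε₀.trans_lt hε₀1
  have hτ : 0 < τ := hstab.1
  have hh0 : 0 < h := RLogSE.mesh_pos hab hM
  have hkT : (k : ℝ) * τ ≤ T := (le_div_iff₀ hτ).1 hk
  have hll : l₀ ≤ l := by
    rw [hl, hl₀, abs_of_neg (Real.log_neg hε hε1), abs_of_neg (Real.log_neg hε₀ hε₀1)]
    exact neg_le_neg (Real.log_le_log hε hεε₀)
  have hC0 : 0 < C := by positivity
  have hE1 : 1 ≤ E := Real.one_le_exp (by positivity)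
  have hEinv : Real.exp (-(C * T * l ^ 2)) = E⁻¹ := Real.exp_neg _
  rw [hEinv] at hh hτc
  -- the growth rate of order `|ln ε|` is dominated by `C |ln ε|²`
  set G := Real.exp ((2 + 4 * (2 * l + 2 * (2 * C₀ + 1) + 2)) * T) with hG
  -- the `H¹` estimate costs two powers of `G`, whence the factor two in `D` and `C`
  have hG1 : 1 ≤ G := Real.one_le_exp (by positivity)
  have hGE : G ^ 2 ≤ E := by
    rw [hG, hE, ← Real.exp_nat_mul]
    refine Real.exp_le_exp.2 ?_
    have h1 : D ≤ D / l₀ ^ 2 * l ^ 2 := by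
      rw [div_mul_eq_mul_div, le_div_iff₀ (by positivity)]
      gcongr
    have h2 : 16 * l ≤ 16 / l₀ * l ^ 2 := by
      rw [div_mul_eq_mul_div, le_div_iff₀ hl₀0]
      have : 0 ≤ l := by positivity
      nlinarith
    have h3 : D + 16 * l ≤ C * l ^ 2 := by rw [hC, add_mul]; linarith
    have h4 := mul_le_mul_of_nonneg_right h3 hT.le
    rw [hD] at h4
    push_cast
    linarith
  have hGE' : G ≤ E := (le_self_pow₀ hG1 two_ne_zero).trans hGE
  have hc0 : 0 < c := by positivity
  have hc1 : c ≤ 1 := by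
    rw [hc, div_le_one (by positivity)]
    linarith [sq_nonneg K]
  have hcK : 8 * K ^ 2 * c ≤ 1 := by
    rw [hc, mul_one_div, div_le_one (by positivity)]
    linarith
  have hsq : √ε ≤ 1 := Real.sqrt_le_one.2 hε1.le
  have hE0 : 0 < E := by linarith
  have hEi1 : E⁻¹ ≤ 1 := inv_le_one_of_one_le₀ hE1
  have hh1 : h ≤ 1 := by
    refine hh.trans ?_
    calc c * √ε * E⁻¹ ≤ 1 * 1 * 1 := by gcongr
      _ = 1 := by norm_num
  have hδ0 : 0 ≤ δ := by positivity
  have hδE : δ * E ≤ 2 * c ^ 2 * ε := by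
    have h1 : h ^ 2 ≤ (c * √ε * E⁻¹) ^ 2 := by gcongr
    have h2 : τ ^ 2 ≤ (c * √ε * E⁻¹) ^ 2 := by gcongr
    have h3 : (c * √ε * E⁻¹) ^ 2 = c ^ 2 * ε * (E⁻¹ * E⁻¹) := by
      rw [mul_pow, mul_pow, Real.sq_sqrt hε.le]; ring
    have h4 : δ ≤ 2 * c ^ 2 * ε * E⁻¹ := by
      have h5 : c ^ 2 * ε * (E⁻¹ * E⁻¹) ≤ c ^ 2 * ε * (E⁻¹ * 1) := by gcongr
      rw [hδ]; linarith
    calc δ * E ≤ 2 * c ^ 2 * ε * E⁻¹ * E := by gcongr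
      _ = _ := by field_simp
  have hK1 : 28 * C₀ ≤ K := by
    have := sq_nonneg C₀
    rw [hK]; linarith
  have hK2 : 28 * C₀ + 1120 * C₀ ^ 2 ≤ K := by rw [hK]; linarith
  have hsmall : 2 * (28 * C₀ * G * δ * ((28 * C₀ + 1120 * C₀ ^ 2) / ε * G ^ 2 * δ)) ≤ 1 := by
    calc _ ≤ 2 * (K * E * δ * (K / ε * E * δ)) := by gcongr
      _ = 2 * K ^ 2 / ε * (δ * E) ^ 2 := by ring
      _ ≤ 2 * K ^ 2 / ε * (2 * c ^ 2 * ε) ^ 2 := by gcongr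
      _ = 8 * K ^ 2 * c * (c ^ 3 * ε) := by field_simp; ring
      _ ≤ 1 * (1 ^ 3 * 1) := by gcongr
      _ = 1 := by norm_num
  obtain ⟨r1, r2, r3⟩ := R.error_bounds hab hT hε hε1 sol hM hU hτ hh1 hG rfl hδ hsmall k hkT
  have q1 : 28 * C₀ * G * δ ≤ 28 * C₀ / ε * E * δ := by
    have : 28 * C₀ ≤ 28 * C₀ / ε := le_div_self (by positivity) hε hε1.le
    gcongr
  have q2 : (28 * C₀ + 1120 * C₀ ^ 2) / ε * G ^ 2 * δ ≤
      (28 * C₀ + 1120 * C₀ ^ 2) / ε * E * δ := by gcongr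
  refine ⟨r1.trans ?_, (RLogSE.gridH1_le (r1.trans q1) (r2.trans q2)).trans_eq ?_, ?_⟩
  · exact mul_le_mul_of_nonneg_right (mul_le_mul hK1 hGE' (by linarith) hK0.le) hδ0
  · rw [hK]; ring
  · refine Finset.sup'_le _ _ fun j hj => ?_
    have hj' : j ≤ M := by rw [Finset.mem_range] at hj; omega
    have h1 := sol.norm_le_spaceTimeSup hab hT (RLogSE.natCast_mul_mem_Icc hτ hkT)
      (RLogSE.gridPt_mem hab hM hj')
    have h2 : U k j = u (RLogSE.gridPt a b M j) (k * τ) - RLogSE.err a b τ M u U k j := by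
      rw [RLogSE.err]; ring
    rw [h2]
    exact (norm_sub_le _ _).trans (add_le_add h1 (r3 j hj'))
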